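/- **Notation.** Let $dA(w)=\frac1\pi\,dx\,dy$ for $w=x+iy$, let $\partial,\bar\partial$ be the Wirtinger derivatives and $\Delta=\partial\bar\partial$. To a function (pre-kernel) $\kappa:\mathbb C\times\mathbb C\to\mathbb C$ associate $$K(z,w)=e^{-|z|^2-|w|^2}\begin{pmatrix}\kappa(z,w)&\kappa(z,\bar w)\\ \kappa(\bar z,w)&\kappa(\bar z,\bar w)\end{pmatrix},\qquad R_k(z_1,\dots,z_k)=\prod_{j=1}^k(\bar z_j-z_j)\,\mathrm{Pf}\,[K(z_j,z_l)]_{j,l=1}^k,$$ $R=R_1$, and the Berezin kernel $B(z,w)=\dfrac{R(z)R(w)-R_2(z,w)}{R(z)}$. *Mass-one equation:* for every $z\in\mathbb C\setminus\mathbb R$ one has $R(z)\ne0$ and $\int_{\mathbb C}B(z,w)\,dA(w)=1$, where the integral is understood as the iterated integral $\frac1\pi\int_{\mathbb R}\big(\lim_{T\to\infty}\int_{-T}^{T}B(z,x+iy)\,dx\big)dy$ (the inner limit exists for every $y$ and is an integrable function of $y$). *Ward's equation:* for every $z\in\mathbb C\setminus\mathbb R$ one has $R(z)>0$, the integral $C(z)=\int_{\mathbb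 C}\frac{B(z,w)}{z-w}\,dA(w)$ converges absolutely, $C$ is (real) differentiable at $z$, and $$\bar\partial C(z)=R(z)-1-\tfrac12\Delta\log R(z)+\frac1{(z-\bar z)^2}.$$ *Translation-invariant pre-kernel:* $\kappa(z,w)=e^{z^2+w^2}\Psi(z-w)$ with $\Psi:\mathbb C\to\mathbb C$ odd and $$\Psi(z)=\frac1{2\pi}\,\mathrm{p.v.}\!\int_{\mathbb R}e^{izu}\widehat J(u)\,du=\lim_{\varepsilon\downarrow0}\frac1{2\pi}\int_{|u|>\varepsilon}e^{izu}\widehat J(u)\,du\qquad(z\in\mathbb C)$$ for some odd $\widehat J:\mathbb R\to\mathbb C$ such that $u\,e^{c|u|}\widehat J(u)\in L^1(\mathbb R)$ for all $c\in\mathbb R$ and $\frac{u}{1+|u|}\widehat J(u)\in L^2(\mathbb R)$. **Theorem.** A function $\kappa:\mathbb C\times\mathbb C\to\mathbb C$ is a translation-invariant pre-kernel that satisfies both the mass-one equation and Ward's equation if and only if $$\kappa(z,w)=\frac1{\sqrt\pi}\,e^{z^2+w^2}\int_E e^{-u^2}\sin\big(2u(z-w)\big)\frac{du}{u}\qquad(z,w\in\mathbb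 C),$$ where $E=(-a,a)$ for some $0<a\le\infty$. -/

import Mathlib

open MeasureTheory Filter Topology ComplexConjugate

namespace PlanarSymplectic

noncomputable section

/-! ### Pfaffian correlation functions attached to a pre-kernel -/

/-- The Pfaffian of a `2k × 2k` matrix whose rows and columns are indexed by
(block number, position in the block), in the order `(0,0), (0,1), (1,0), (1,1), …`:
`Pf A = 1 / (2^k k!) * ∑_σ sgn σ ∏ᵢ A_{σ(i,0), σ(i,1)}`. -/
def pfaffian {k : ℕ} (A : Matrix (Fin k × Fin 2) (Fin k × Fin 2) ℂ) : ℂ :=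
  ((2 : ℂ) ^ k * (k.factorial : ℂ))⁻¹ *
    ∑ σ : Equiv.Perm (Fin k × Fin 2),
      ((Equiv.Perm.sign σ : ℤ) : ℂ) * ∏ i : Fin k, A (σ (i, 0)) (σ (i, 1))

/-- The `2 × 2` matrix kernel with pre-kernel `κ` and Gaussian factor `e^{-|z|²-|w|²}`. -/
def matrixKernel (κ : ℂ → ℂ → ℂ) (z w : ℂ) : Matrix (Fin 2) (Fin 2) ℂ :=
  Complex.exp (-((‖z‖ : ℂ) ^ 2) - (‖w‖ : ℂ) ^ 2) •
    !![κ z w, κ z (conj w); κ (conj z) w, κ (conj z) (conj w)]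

/-- The `k`-point function `R_k(z₁,…,z_k) = ∏ⱼ (z̄ⱼ - zⱼ) Pf [K(zⱼ, z_l)]`. -/
def correlation (κ : ℂ → ℂ → ℂ) {k : ℕ} (z : Fin k → ℂ) : ℂ :=
  (∏ j, (conj (z j) - z j)) *
    pfaffian (Matrix.of fun p q : Fin k × Fin 2 => matrixKernel κ (z p.1) (z q.1) p.2 q.2)

/-- The one-point function `R = R₁`. -/
def onePoint (κ : ℂ → ℂ → ℂ) (z : ℂ) : ℂ := correlation κ ![z]

/-- The two-point function `R₂`. -/
def twoPoint (κ : ℂ → ℂ → ℂ) (z w : ℂ) : ℂ := correlation κ ![z, w]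

/-- The Berezin kernel `B(z,w) = (R(z) R(w) - R₂(z,w)) / R(z)`. -/
def berezin (κ : ℂ → ℂ → ℂ) (z w : ℂ) : ℂ :=
  (onePoint κ z * onePoint κ w - twoPoint κ z w) / onePoint κ z

/-! ### The mass-one equation -/

/-- The mass-one equation `∫_ℂ B(z,w) dA(w) = 1`, `dA = dx dy / π`, for all `z` off the real
axis (on which `R` vanishes identically).  In general `B(z,·)` decays only like `1 / Re w` along
horizontal lines, so the integral over `w = x + iy` is an iterated one, the inner integral in `x`
being the improper integral `lim_{T → ∞} ∫_{-T}^{T}`. -/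
def MassOneEquation (κ : ℂ → ℂ → ℂ) : Prop :=
  ∀ z : ℂ, z.im ≠ 0 →
    onePoint κ z ≠ 0 ∧
    ∃ b : ℝ → ℂ,
      (∀ y : ℝ, Tendsto (fun T : ℝ => ∫ x in (-T)..T, berezin κ z (⟨x, y⟩ : ℂ))
        atTop (𝓝 (b y))) ∧
      Integrable b ∧
      (Real.pi : ℂ)⁻¹ * ∫ y, b y = 1

/-! ### Ward's equation -/

/-- The Wirtinger derivative `∂ = (∂ₓ - i ∂_y) / 2`. -/
def wirtinger (f : ℂ → ℂ) (z : ℂ) : ℂ :=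
  (fderiv ℝ f z 1 - Complex.I * fderiv ℝ f z Complex.I) / 2

/-- The Wirtinger derivative `∂̄ = (∂ₓ + i ∂_y) / 2`. -/
def wirtingerBar (f : ℂ → ℂ) (z : ℂ) : ℂ :=
  (fderiv ℝ f z 1 + Complex.I * fderiv ℝ f z Complex.I) / 2

/-- `Δ = ∂ ∂̄`, a quarter of the usual Laplacian. -/
def quarterLaplacian (f : ℂ → ℂ) : ℂ → ℂ := wirtinger (wirtingerBar f)

/-- `C(z) = ∫_ℂ B(z,w) / (z - w) dA(w)`, `dA = dx dy / π`. -/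
def cauchyTransform (κ : ℂ → ℂ → ℂ) (z : ℂ) : ℂ :=
  (Real.pi : ℂ)⁻¹ * ∫ w : ℂ, berezin κ z w / (z - w)

/-- Ward's equation `∂̄C = R - 1 - ½ Δ log R + 1 / (z - z̄)²` at all `z` off the real axis.  That
its terms make sense is part of it: `R` is positive, the integral defining `C` converges
absolutely and `C` is differentiable. -/
def WardEquation (κ : ℂ → ℂ → ℂ) : Prop :=
  (∀ z : ℂ, z.im ≠ 0 →
    ((onePoint κ z).im = 0 ∧ 0 < (onePoint κ z).re) ∧
    Integrable (fun w : ℂ => berezin κ z w / (z - w))) ∧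
  ∀ z : ℂ, z.im ≠ 0 →
    DifferentiableAt ℝ (cauchyTransform κ) z ∧
    wirtingerBar (cauchyTransform κ) z =
      onePoint κ z - 1
        - 1 / 2 * quarterLaplacian (fun ζ => (Real.log (onePoint κ ζ).re : ℂ)) z
        + 1 / (z - conj z) ^ 2

/-! ### Translation-invariant pre-kernels -/

/-- `Ψ(z) = (1/2π) p.v. ∫_ℝ e^{izu} Ĵ(u) du` for all complex `z`, for an odd `Ĵ` such that
`u e^{c|u|} Ĵ(u)` is integrable for all `c` and `u Ĵ(u) / (1 + |u|)` is square-integrable.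
The principal value is taken at `u = 0`, where `Ĵ` may be singular like `1/u`. -/
structure IsFourierInversion (Ψ : ℂ → ℂ) (J : ℝ → ℂ) : Prop where
  odd : ∀ u, J (-u) = -J u
  integrable : ∀ c : ℝ, Integrable (fun u : ℝ => (Real.exp (c * |u|) : ℂ) * ((u : ℂ) * J u))
  memLp_two : MemLp (fun u : ℝ => ((u / (1 + |u|) : ℝ) : ℂ) * J u) 2
  inversion : ∀ z : ℂ,
    Tendsto (fun ε : ℝ => 1 / (2 * (Real.pi : ℂ)) *
        ∫ u in {u : ℝ | ε < |u|}, Complex.exp (Complex.I * z * u) * J u)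
      (𝓝[>] 0) (𝓝 (Ψ z))

/-- `κ(z,w) = e^{z²+w²} Ψ(z - w)` for an odd function `Ψ` given by Fourier inversion. -/
def IsTranslationInvariantPreKernel (κ : ℂ → ℂ → ℂ) : Prop :=
  ∃ (Ψ : ℂ → ℂ) (J : ℝ → ℂ),
    (∀ z, Ψ (-z) = -Ψ z) ∧ IsFourierInversion Ψ J ∧
    ∀ z w, κ z w = Complex.exp (z ^ 2 + w ^ 2) * Ψ (z - w)

end

end PlanarSymplectic

namespace PlanarSymplectic

noncomputable section

/-! ### Explicit correlation functions -/

/-! Write Ψ(z) = ∫ sin(2zu) h(u) du with h odd (a rescaled Ĵ), and Φ(y) = ∫ sinh(4yu) h(u) du. The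
one-point function is R(z) = 2y e^{-4y²} Φ(y), y = Im z. Ward's equation includes that R is real,
and this makes h real, because a sinh transform determines an odd density
(`SuperexpDecay.ae_eq_zero_of_sinhTransform_eq_zero`, `exists_real_density`). With w = x + iv and t
= x - Re z, the Berezin kernel becomes 2v e^{-4v²}/Φ(y) times |Ψ(t+i(y+v))|² - |Ψ(t+i(y-v))|²
(`berezin_sineTransform`).

The mass-one equation fixes the values of h. One has |Ψ|² = Re Ψ² + 2 (Im Ψ)². Since Ψ² is entire, a
contour shift makes the contributions of Re Ψ² from the two lines cancel, so only (Im Ψ)² matters.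
But Im Ψ(t+ib) is the cosine transform in t of sinh(2bu) h(u), and Plancherel gives 2π ∫ sinh(4yu)
sinh(4vu) h(u)² du for the x-integral. As that integral is only improper, the shift is made on
Gaussian means (Abel summation); the error vanishes because the L² hypothesis on Ĵ makes |Ψ(t)|² =
o(|t|) on the real axis. Integrating against v e^{-4v²} turns mass one into Φ(y) = ∫ sinh(4yu) √π u
e^{u²} h(u)² du. By uniqueness h = √π u e^{u²} h² almost everywhere, so h is pointwise 0 or
e^{-u²}/(√π u) (`SuperexpDecay.eq_of_massOne`). What remains free is a measurable set S ⊆ (0,∞), on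
which the doubled half-line density is (2/√π) e^{-u²}/u.

Ward's equation fixes S. The Cauchy transform is a fourfold integral over t, v and two frequencies
u, u'; the t-integral is a Poisson integral and the v-integral is Gaussian. For this particular
density the outcome is explicit (`cauchyTransform_truncatedDensity`): C(z) = i(-4 ∫₀^y v e^{-4v²}
Φ(v) dv + Φ'/(4Φ) - 1/(4y) - G/Φ), where G(y) is the integral of the density at u times cosh 4yu -
cosh 4yu' over u' in (0,u] outside S. All terms but the last reproduce the right side of Ward's
equation, so the equation says that G/Φ is constant on y > 0. Now G = O(y²) and Φ ≥ cy with c > 0 as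
y ↓ 0; hence G = 0 (`gapTransform_eq_zero`). As cosh is strictly increasing on the positive
half-line, almost every u in S has (0,u] ⊆ S up to a null set, so S is an initial interval (0,a) up
to a null set (`ae_eq_interval_of_ward`).

Conversely, for S = (0,a) an integration by parts gives Ψ'(z) = O(1/|z|) in horizontal strips
(`norm_deriv_sineTransform_le`). The contour shift then needs no regularization, the Cauchy integral
converges absolutely, h solves the quadratic equation and G = 0, so both equations follow from the
same computations (`massOneEquation_initialInterval`, `wardEquation_initialInterval`). -/

lemma pfaffian_one (A : Matrix (Fin 1 × Fin 2) (Fin 1 × Fin 2) ℂ) :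
    pfaffian A = (A (0, 0) (0, 1) - A (0, 1) (0, 0)) / 2 := by
  have : (Finset.univ : Finset (Equiv.Perm (Fin 1 × Fin 2))) =
      {1, Equiv.swap (0, 0) (0, 1)} := by decide
  simp only [pfaffian, this]
  rw [Finset.sum_pair (by decide)]
  simp
  ring

/-- Reindexing of the four positions of two blocks. -/
def blockEquiv : Fin 4 ≃ Fin 2 × Fin 2 where
  toFun := ![(0, 0), (0, 1), (1, 0), (1, 1)]
  invFun p := ![![0, 1], ![2, 3]] p.1 p.2
  left_inv := by decide
  right_inv := by decide

/-- Each of the three perfect matchings of four points arises from eight permutations, and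
antisymmetry makes these eight terms equal; the factor 2² · 2! = 8 cancels. -/
lemma pfaffian_two (A : Matrix (Fin 2 × Fin 2) (Fin 2 × Fin 2) ℂ)
    (hA : ∀ p q, A q p = -A p q) :
    pfaffian A = A (0, 0) (0, 1) * A (1, 0) (1, 1) - A (0, 0) (1, 0) * A (0, 1) (1, 1)
      + A (0, 0) (1, 1) * A (0, 1) (1, 0) := by
  have hsum : ∑ σ : Equiv.Perm (Fin 2 × Fin 2),
      ((Equiv.Perm.sign σ : ℤ) : ℂ) * ∏ i : Fin 2, A (σ (i, 0)) (σ (i, 1)) =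
      ∑ σ : Equiv.Perm (Fin 4), ((Equiv.Perm.sign σ : ℤ) : ℂ) *
        (A (blockEquiv (σ 0)) (blockEquiv (σ 1)) * A (blockEquiv (σ 2)) (blockEquiv (σ 3))) := by
    rw [← (Equiv.permCongr blockEquiv).sum_comp]
    refine Finset.sum_congr rfl fun σ _ => ?_
    rw [Equiv.Perm.sign_permCongr]
    simp only [Fin.prod_univ_two, Equiv.permCongr_apply]
    rfl
  -- The 24 permutations with their signs, listed explicitly; the kernel checks the equality of
  -- multisets, so that the sum over permutations unfolds into a list sum.
  have hperm : (Finset.univ : Finset (Equiv.Perm (Fin 4))).val.map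
      (fun σ => ((Equiv.Perm.sign σ : ℤ), σ 0, σ 1, σ 2, σ 3)) =
      ([(1, 0, 1, 2, 3), (-1, 0, 1, 3, 2), (-1, 0, 2, 1, 3), (1, 0, 2, 3, 1), (1, 0, 3, 1, 2),
        (-1, 0, 3, 2, 1), (-1, 1, 0, 2, 3), (1, 1, 0, 3, 2), (1, 1, 2, 0, 3), (-1, 1, 2, 3, 0),
        (-1, 1, 3, 0, 2), (1, 1, 3, 2, 0), (1, 2, 0, 1, 3), (-1, 2, 0, 3, 1), (-1, 2, 1, 0, 3),
        (1, 2, 1, 3, 0), (1, 2, 3, 0, 1), (-1, 2, 3, 1, 0), (-1, 3, 0, 1, 2), (1, 3, 0, 2, 1),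
        (1, 3, 1, 0, 2), (-1, 3, 1, 2, 0), (-1, 3, 2, 0, 1),
        (1, 3, 2, 1, 0)] : List (ℤ × Fin 4 × Fin 4 × Fin 4 × Fin 4)) := by
    decide +kernel
  have hlist := congrArg (fun l : Multiset (ℤ × Fin 4 × Fin 4 × Fin 4 × Fin 4) =>
    (l.map fun q => (q.1 : ℂ) * (A (blockEquiv q.2.1) (blockEquiv q.2.2.1) *
      A (blockEquiv q.2.2.2.1) (blockEquiv q.2.2.2.2))).sum) hperm
  simp only [Multiset.map_map, Function.comp_def] at hlist
  rw [pfaffian, hsum]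
  refine (congrArg _ hlist).trans ?_
  have h0 : blockEquiv 0 = (0, 0) := rfl
  have h1 : blockEquiv 1 = (0, 1) := rfl
  have h2 : blockEquiv 2 = (1, 0) := rfl
  have h3 : blockEquiv 3 = (1, 1) := rfl
  simp only [Multiset.map_coe, Multiset.sum_coe, List.map_cons, List.map_nil, List.sum_cons,
    List.sum_nil, h0, h1, h2, h3]
  rw [hA (0, 0) (0, 1), hA (0, 0) (1, 0), hA (0, 0) (1, 1), hA (0, 1) (1, 0), hA (0, 1) (1, 1),
    hA (1, 0) (1, 1)]
  norm_num [Nat.factorial]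
  ring

/-- The pre-kernel `e^{z² + w²} Ψ(z - w)`. -/
def translationKernel (Ψ : ℂ → ℂ) (z w : ℂ) : ℂ := Complex.exp (z ^ 2 + w ^ 2) * Ψ (z - w)

lemma conj_sub_self (z : ℂ) : conj z - z = -2 * Complex.I * z.im := by
  apply Complex.ext <;> simp; ring

/-- Since |z|² = z z̄, the total exponent is z² + z̄² - 2 z z̄ = (z̄ - z)² = -4 (Im z)²; this is why
R depends on Im z alone. -/
lemma gaussian_factor (z : ℂ) :
    Complex.exp (-((‖z‖ : ℂ) ^ 2) - (‖z‖ : ℂ) ^ 2) * Complex.exp (z ^ 2 + conj z ^ 2) =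
      Complex.exp (-4 * (z.im : ℂ) ^ 2) := by
  rw [← Complex.exp_add]
  congr 1
  have h1 : (‖z‖ : ℂ) ^ 2 = z * conj z := by
    rw [Complex.mul_conj, Complex.normSq_eq_norm_sq]; push_cast; rfl
  have h2 : (z.im : ℂ) = (conj z - z) / (-2 * Complex.I) := by
    rw [conj_sub_self]; field_simp
  rw [h1, h2, div_pow, mul_pow, Complex.I_sq]
  ring

lemma onePoint_translationKernel {Ψ : ℂ → ℂ} (hΨ : ∀ z, Ψ (-z) = -Ψ z) (z : ℂ) :
    onePoint (translationKernel Ψ) z =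
      -2 * Complex.I * z.im * Complex.exp (-4 * (z.im : ℂ) ^ 2) * Ψ (2 * Complex.I * z.im) := by
  have h2 : z - conj z = 2 * Complex.I * z.im := by
    rw [← neg_sub, conj_sub_self]; ring
  rw [onePoint, correlation, pfaffian_one]
  simp only [matrixKernel, translationKernel, Finset.univ_unique, Finset.prod_singleton,
    Matrix.of_apply, Matrix.smul_apply, smul_eq_mul]
  simp only [Fin.default_eq_zero, Matrix.cons_val_zero, Matrix.cons_val', Matrix.cons_val_fin_one,
    Matrix.cons_val_one]
  rw [← gaussian_factor, ← h2, ← neg_sub z (conj z), hΨ, add_comm (conj z ^ 2)]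
  linear_combination (-(Complex.exp (-(‖z‖ : ℂ) ^ 2 - (‖z‖ : ℂ) ^ 2) *
    Complex.exp (z ^ 2 + conj z ^ 2) * Ψ (z - conj z))) * h2

/-- Of the three matchings in the Pfaffian, the one that pairs each point with its own conjugate
yields R(z) R(w); the other two form the connected part, which is the numerator of the Berezin
kernel. -/
lemma twoPoint_translationKernel {Ψ : ℂ → ℂ} (hΨ : ∀ z, Ψ (-z) = -Ψ z) (z w : ℂ) :
    twoPoint (translationKernel Ψ) z w = onePoint (translationKernel Ψ) z *
      onePoint (translationKernel Ψ) w - (-2 * Complex.I * z.im) * (-2 * Complex.I * w.im) *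
        (Complex.exp (-4 * (z.im : ℂ) ^ 2) * Complex.exp (-4 * (w.im : ℂ) ^ 2)) *
        (Ψ (z - w) * Ψ (conj z - conj w) - Ψ (z - conj w) * Ψ (conj z - w)) := by
  have h2 : z - conj z = 2 * Complex.I * z.im := by
    rw [← neg_sub, conj_sub_self]; ring
  have h3 : w - conj w = 2 * Complex.I * w.im := by
    rw [← neg_sub, conj_sub_self]; ring
  rw [onePoint_translationKernel hΨ, onePoint_translationKernel hΨ, twoPoint, correlation,
    pfaffian_two]
  · simp only [matrixKernel, translationKernel, Fin.prod_univ_two,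
      Matrix.of_apply, Matrix.smul_apply, smul_eq_mul]
    simp only [Matrix.cons_val_zero, Matrix.cons_val', Matrix.cons_val_fin_one,
      Matrix.cons_val_one]
    rw [← gaussian_factor, ← gaussian_factor, ← h2, ← h3, conj_sub_self, conj_sub_self]
    simp only [sub_eq_add_neg, Complex.exp_add]
    ring
  · rintro ⟨i, a⟩ ⟨j, b⟩
    have h (x y : ℂ) : translationKernel Ψ y x = -translationKernel Ψ x y := by
      rw [translationKernel, translationKernel, ← neg_sub x y, hΨ, add_comm]; ring
    have hK (x y : ℂ) (a b : Fin 2) : matrixKernel (translationKernel Ψ) y x b a =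
        -matrixKernel (translationKernel Ψ) x y a b := by
      have he : Complex.exp (-((‖y‖ : ℂ) ^ 2) - (‖x‖ : ℂ) ^ 2) =
          Complex.exp (-((‖x‖ : ℂ) ^ 2) - (‖y‖ : ℂ) ^ 2) := by congr 1; ring
      fin_cases a <;> fin_cases b <;> simp [matrixKernel, he, h x y, h x (conj y), h (conj x) y,
        h (conj x) (conj y)]
    exact hK _ _ _ _

lemma berezin_translationKernel {Ψ : ℂ → ℂ} (hΨ : ∀ z, Ψ (-z) = -Ψ z) {z : ℂ} (hz : z.im ≠ 0)
    (w : ℂ) :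
    berezin (translationKernel Ψ) z w =
      -2 * Complex.I * w.im * Complex.exp (-4 * (w.im : ℂ) ^ 2) / Ψ (2 * Complex.I * z.im) *
        (Ψ (z - w) * Ψ (conj z - conj w) - Ψ (z - conj w) * Ψ (conj z - w)) := by
  rw [berezin, twoPoint_translationKernel hΨ, sub_sub_cancel, onePoint_translationKernel hΨ z]
  have h1 : (z.im : ℂ) ≠ 0 := by exact_mod_cast hz
  have h2 := Complex.exp_ne_zero (-4 * (z.im : ℂ) ^ 2)
  have h3 : -2 * Complex.I * (z.im : ℂ) * Complex.exp (-4 * (z.im : ℂ) ^ 2) ≠ 0 := by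
    simp [h1]
  rw [div_mul_eq_mul_div, ← mul_div_mul_left _ (Ψ (2 * Complex.I * z.im)) h3]
  congr 1
  ring

/-! ### Sine transforms -/

lemma norm_exp_I_mul (w : ℂ) : ‖Complex.exp (w * Complex.I)‖ = Real.exp (-w.im) := by
  rw [Complex.norm_exp]; simp

lemma norm_exp_neg_I_mul (w : ℂ) : ‖Complex.exp (-w * Complex.I)‖ = Real.exp w.im := by
  rw [Complex.norm_exp]; simp

lemma norm_cos_le (w : ℂ) : ‖Complex.cos w‖ ≤ Real.exp |w.im| := by
  rw [Complex.cos, norm_div, Complex.norm_ofNat, div_le_iff₀ two_pos]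
  refine (norm_add_le _ _).trans ?_
  rw [norm_exp_I_mul, norm_exp_neg_I_mul]
  have h1 := Real.exp_le_exp.2 (neg_le_abs w.im)
  have h2 := Real.exp_le_exp.2 (le_abs_self w.im)
  linarith

lemma norm_sin_le_exp (w : ℂ) : ‖Complex.sin w‖ ≤ Real.exp |w.im| := by
  rw [Complex.sin, norm_div, Complex.norm_ofNat, div_le_iff₀ two_pos, norm_mul, Complex.norm_I,
    mul_one]
  refine (norm_sub_le _ _).trans ?_
  rw [norm_exp_neg_I_mul, norm_exp_I_mul]
  have h1 := Real.exp_le_exp.2 (neg_le_abs w.im)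
  have h2 := Real.exp_le_exp.2 (le_abs_self w.im)
  linarith

/-- Mean value inequality from 0 to w in the convex strip |Im ζ| ≤ |Im w|, where the derivative cos
is bounded by e^{|Im w|}. The factor |w| compensates a density with a 1/u singularity. -/
lemma norm_sin_le_norm_mul_exp (w : ℂ) : ‖Complex.sin w‖ ≤ ‖w‖ * Real.exp |w.im| := by
  have h : ∀ ζ ∈ {ζ : ℂ | |ζ.im| ≤ |w.im|}, ‖Complex.cos ζ‖ ≤ Real.exp |w.im| := fun ζ hζ =>
    (norm_cos_le ζ).trans (Real.exp_le_exp.2 hζ)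
  have hc : Convex ℝ {ζ : ℂ | |ζ.im| ≤ |w.im|} := by
    have : {ζ : ℂ | |ζ.im| ≤ |w.im|} = Complex.imLm ⁻¹' (Set.Icc (-|w.im|) |w.im|) := by
      ext ζ; simp [abs_le]
    rw [this]
    exact (convex_Icc _ _).linear_preimage _
  have := hc.norm_image_sub_le_of_norm_hasDerivWithin_le
    (fun ζ _ => (Complex.hasDerivAt_sin ζ).hasDerivWithinAt) h
    (show (0 : ℂ) ∈ {ζ : ℂ | |ζ.im| ≤ |w.im|} by simp) (show w ∈ {ζ : ℂ | |ζ.im| ≤ |w.im|} by simp)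
  simpa [mul_comm] using this

/-- `u h(u)` decays faster than every exponential. -/
def SuperexpDecay (h : ℝ → ℝ) : Prop :=
  ∀ c : ℝ, Integrable fun u : ℝ => Real.exp (c * |u|) * (u * h u)

/-- `∫ sin(2zu) h(u) du`. -/
def sineTransform (h : ℝ → ℝ) (z : ℂ) : ℂ := ∫ u : ℝ, Complex.sin (2 * z * u) * h u

/-- `∫ sinh(4yu) h(u) du`. -/
def sinhTransform (h : ℝ → ℝ) (y : ℝ) : ℝ := ∫ u : ℝ, Real.sinh (4 * y * u) * h u

lemma SuperexpDecay.integrable_mul {h : ℝ → ℝ} (hh : SuperexpDecay h) :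
    Integrable fun u : ℝ => u * h u := by simpa using hh 0

lemma SuperexpDecay.aestronglyMeasurable {h : ℝ → ℝ} (hh : SuperexpDecay h) :
    AEStronglyMeasurable h := by
  have h1 : AEStronglyMeasurable (fun u : ℝ => u⁻¹ * (u * h u)) :=
    (measurable_inv.aestronglyMeasurable).mul hh.integrable_mul.aestronglyMeasurable
  refine h1.congr ?_
  filter_upwards [compl_mem_ae_iff.2 (measure_singleton (0 : ℝ))] with u hu
  have : u ≠ 0 := hu
  field_simp

/-- The weights against which functions of superexponential decay are integrable. -/
lemma SuperexpDecay.integrable_of_bound {h : ℝ → ℝ} (hh : SuperexpDecay h) {f : ℝ → ℂ}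
    (hf : AEStronglyMeasurable f) {A c : ℝ} (hb : ∀ u, ‖f u‖ ≤ A * (Real.exp (c * |u|) * |u|)) :
    Integrable fun u => f u * h u := by
  refine ((hh c).norm.const_mul A).mono'
    (hf.mul (Complex.continuous_ofReal.comp_aestronglyMeasurable hh.aestronglyMeasurable))
    (Eventually.of_forall fun u => ?_)
  rw [norm_mul, norm_mul, norm_mul, Complex.norm_real, Real.norm_eq_abs u,
    Real.norm_of_nonneg (Real.exp_nonneg _)]
  calc ‖f u‖ * ‖h u‖ ≤ A * (Real.exp (c * |u|) * |u|) * ‖h u‖ := by gcongr; exact hb u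
    _ = _ := by ring

lemma SuperexpDecay.integrable_of_bound_real {h : ℝ → ℝ} (hh : SuperexpDecay h) {f : ℝ → ℝ}
    (hf : AEStronglyMeasurable f) {A c : ℝ} (hb : ∀ u, |f u| ≤ A * (Real.exp (c * |u|) * |u|)) :
    Integrable fun u => f u * h u := by
  have := (hh.integrable_of_bound (f := fun u => (f u : ℂ))
    (Complex.continuous_ofReal.comp_aestronglyMeasurable hf) (A := A) (c := c)
    (by intro u; simpa using hb u)).re
  simpa using this

lemma norm_sin_two_mul_le (z : ℂ) (u : ℝ) :
    ‖Complex.sin (2 * z * u)‖ ≤ 2 * ‖z‖ * (Real.exp (2 * |z.im| * |u|) * |u|) := by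
  refine (norm_sin_le_norm_mul_exp _).trans (le_of_eq ?_)
  have : (2 * z * (u : ℂ)).im = 2 * z.im * u := by simp
  rw [this, abs_mul, abs_mul, norm_mul, norm_mul]
  simp; ring

lemma SuperexpDecay.integrable_sin {h : ℝ → ℝ} (hh : SuperexpDecay h) (z : ℂ) :
    Integrable fun u : ℝ => Complex.sin (2 * z * u) * h u :=
  hh.integrable_of_bound (by fun_prop) (norm_sin_two_mul_le z)

lemma abs_sinh_le (x : ℝ) : |Real.sinh x| ≤ |x| * Real.exp |x| := by
  have h1 := norm_sin_le_norm_mul_exp (x * Complex.I)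
  rw [Complex.sin_mul_I, norm_mul, norm_mul, Complex.norm_I, mul_one, mul_one,
    ← Complex.ofReal_sinh, Complex.norm_real, Complex.norm_real] at h1
  simpa using h1

lemma abs_sinh_mul_le (b u : ℝ) : |Real.sinh (b * u)| ≤ |b| * (Real.exp (|b| * |u|) * |u|) := by
  refine (abs_sinh_le _).trans (le_of_eq ?_)
  rw [abs_mul]; ring

lemma SuperexpDecay.integrable_sinh {h : ℝ → ℝ} (hh : SuperexpDecay h) (b : ℝ) :
    Integrable fun u : ℝ => Real.sinh (b * u) * h u :=
  hh.integrable_of_bound_real (by fun_prop) (abs_sinh_mul_le b)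

lemma SuperexpDecay.hasDerivAt_sineTransform {h : ℝ → ℝ} (hh : SuperexpDecay h) (z : ℂ) :
    HasDerivAt (sineTransform h) (∫ u : ℝ, Complex.cos (2 * z * u) * (2 * u) * h u) z := by
  refine (hasDerivAt_integral_of_dominated_loc_of_deriv_le
    (bound := fun u => 2 * ‖Real.exp (2 * (|z.im| + 1) * |u|) * (u * h u)‖)
    (F := fun z (u : ℝ) => Complex.sin (2 * z * u) * h u)
    (F' := fun z (u : ℝ) => Complex.cos (2 * z * u) * (2 * u) * h u)
    (Metric.ball_mem_nhds z one_pos) (Eventually.of_forall fun w => (hh.integrable_sin w).1)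
    (hh.integrable_sin z) ?_ (Eventually.of_forall fun u w hw => ?_)
    ((hh _).norm.const_mul 2) (Eventually.of_forall fun u w _ => ?_)).2
  · exact AEStronglyMeasurable.mul (by fun_prop)
      (Complex.continuous_ofReal.comp_aestronglyMeasurable hh.aestronglyMeasurable)
  · have h1 : |w.im| ≤ |z.im| + 1 := by
      have h2 : |(w - z).im| ≤ 1 := (Complex.abs_im_le_norm _).trans (mem_ball_iff_norm.1 hw).le
      have h3 : |w.im| ≤ |z.im| + |(w - z).im| := by
        have := abs_add_le z.im (w - z).im
        simpa using this
      linarith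
    have h2 := norm_cos_le (2 * w * u)
    have h3 : (2 * w * (u : ℂ)).im = 2 * w.im * u := by simp
    rw [h3, abs_mul, abs_mul, abs_two] at h2
    rw [norm_mul, norm_mul, norm_mul, norm_mul, norm_mul, Real.norm_of_nonneg (Real.exp_nonneg _),
      Complex.norm_real, Complex.norm_real, Complex.norm_ofNat]
    calc _ ≤ Real.exp (2 * (|z.im| + 1) * |u|) * (2 * ‖u‖) * ‖h u‖ := by
          gcongr
          refine h2.trans (Real.exp_le_exp.2 ?_)
          gcongr
      _ = _ := by ring
  · have h1 : HasDerivAt (fun w : ℂ => 2 * w * (u : ℂ)) (2 * u) w := by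
      simpa using ((hasDerivAt_id w).const_mul 2).mul_const (u : ℂ)
    exact ((Complex.hasDerivAt_sin _).comp w h1).mul_const _

lemma SuperexpDecay.differentiable_sineTransform {h : ℝ → ℝ} (hh : SuperexpDecay h) :
    Differentiable ℂ (sineTransform h) := fun z => (hh.hasDerivAt_sineTransform z).differentiableAt

lemma sineTransform_neg (h : ℝ → ℝ) (z : ℂ) : sineTransform h (-z) = -sineTransform h z := by
  rw [sineTransform, sineTransform, ← integral_neg]
  congr 1; ext u
  rw [mul_neg, neg_mul, Complex.sin_neg, neg_mul]

lemma sineTransform_conj (h : ℝ → ℝ) (z : ℂ) :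
    sineTransform h (conj z) = conj (sineTransform h z) := by
  rw [sineTransform, sineTransform, ← integral_conj]
  congr 1; ext u
  rw [map_mul, ← Complex.sin_conj]; simp [map_ofNat]

lemma sineTransform_I_mul (h : ℝ → ℝ) (y : ℝ) :
    sineTransform h (2 * Complex.I * y) = Complex.I * sinhTransform h y := by
  rw [sineTransform, sinhTransform, ← integral_complex_ofReal, ← integral_const_mul]
  congr 1; ext u
  have : 2 * (2 * Complex.I * (y : ℂ)) * u = ((4 * y * u : ℝ) : ℂ) * Complex.I := by
    push_cast; ring
  rw [this, Complex.sin_mul_I, ← Complex.ofReal_sinh]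
  push_cast; ring

lemma sin_two_mul_add_I (t b u : ℝ) : Complex.sin (2 * (t + b * Complex.I) * u) =
    ((Real.sin (2 * t * u) * Real.cosh (2 * b * u) : ℝ) : ℂ) +
      ((Real.cos (2 * t * u) * Real.sinh (2 * b * u) : ℝ) : ℂ) * Complex.I := by
  have : 2 * (t + b * Complex.I) * (u : ℂ) =
    ((2 * t * u : ℝ) : ℂ) + ((2 * b * u : ℝ) : ℂ) * Complex.I := by push_cast; ring
  rw [this, Complex.sin_add_mul_I]
  push_cast; ring

lemma SuperexpDecay.im_sineTransform {h : ℝ → ℝ} (hh : SuperexpDecay h) (t b : ℝ) :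
    (sineTransform h (t + b * Complex.I)).im =
      ∫ u : ℝ, Real.cos (2 * t * u) * (Real.sinh (2 * b * u) * h u) := by
  have h1 := integral_im (hh.integrable_sin (t + b * Complex.I))
  have h2 : (sineTransform h (t + b * Complex.I)).im =
    RCLike.im (∫ u : ℝ, Complex.sin (2 * (t + b * Complex.I) * u) * h u) := rfl
  rw [h2, ← h1]
  congr 1; ext u
  rw [sin_two_mul_add_I]
  simp only [RCLike.im_to_complex, Complex.mul_im, Complex.add_im,
    Complex.add_re, Complex.ofReal_re, Complex.ofReal_im, Complex.mul_re, Complex.I_re,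
    Complex.I_im]
  ring

lemma SuperexpDecay.re_sineTransform {h : ℝ → ℝ} (hh : SuperexpDecay h) (t b : ℝ) :
    (sineTransform h (t + b * Complex.I)).re =
      ∫ u : ℝ, Real.sin (2 * t * u) * (Real.cosh (2 * b * u) * h u) := by
  have h1 := integral_re (hh.integrable_sin (t + b * Complex.I))
  have h2 : (sineTransform h (t + b * Complex.I)).re =
    RCLike.re (∫ u : ℝ, Complex.sin (2 * (t + b * Complex.I) * u) * h u) := rfl
  rw [h2, ← h1]
  congr 1; ext u
  rw [sin_two_mul_add_I]
  simp only [RCLike.re_to_complex, Complex.mul_im, Complex.add_im,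
    Complex.add_re, Complex.ofReal_re, Complex.ofReal_im, Complex.mul_re, Complex.I_re,
    Complex.I_im]
  ring

lemma SuperexpDecay.exists_norm_sineTransform_le {h : ℝ → ℝ} (hh : SuperexpDecay h) (b : ℝ) :
    ∃ A, 0 ≤ A ∧ ∀ z : ℂ, |z.im| ≤ b → ‖sineTransform h z‖ ≤ A * ‖z‖ := by
  refine ⟨∫ u, 2 * ‖Real.exp (2 * b * |u|) * (u * h u)‖, integral_nonneg fun u => by positivity,
    fun z hz => ?_⟩
  rw [← integral_mul_const]
  refine norm_integral_le_of_norm_le (((hh _).norm.const_mul 2).mul_const _)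
    (Eventually.of_forall fun u => ?_)
  rw [norm_mul]
  refine (mul_le_mul_of_nonneg_right (norm_sin_two_mul_le z u) (norm_nonneg _)).trans ?_
  rw [norm_mul, norm_mul, Complex.norm_real, Real.norm_of_nonneg (Real.exp_nonneg _)]
  calc _ ≤ 2 * ‖z‖ * (Real.exp (2 * b * |u|) * |u|) * ‖h u‖ := by gcongr
    _ = _ := by rw [Real.norm_eq_abs u]; ring

/-! ### Uniqueness for two-sided Laplace transforms -/

/-- The densities define finite measures whose moment generating functions are finite everywhere and
agree on ℝ. By analytic continuation the complex ones agree, and these determine the measures. -/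
lemma withDensity_eq_of_integral_exp_eq {f g : ℝ → ℝ} (hf0 : 0 ≤ f) (hg0 : 0 ≤ g)
    (hf : ∀ x : ℝ, Integrable fun u => Real.exp (x * u) * f u)
    (hg : ∀ x : ℝ, Integrable fun u => Real.exp (x * u) * g u)
    (h : ∀ x : ℝ, ∫ u, Real.exp (x * u) * f u = ∫ u, Real.exp (x * u) * g u) : f =ᵐ[volume] g := by
  have key : ∀ {f : ℝ → ℝ}, 0 ≤ f → (∀ x : ℝ, Integrable fun u => Real.exp (x * u) * f u) →
      ∃ μ : Measure ℝ, μ = volume.withDensity (fun u => ENNReal.ofReal (f u)) ∧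
        IsFiniteMeasure μ ∧ (∀ x, ProbabilityTheory.mgf id μ x = ∫ u, Real.exp (x * u) * f u) ∧
        ProbabilityTheory.integrableExpSet id μ = Set.univ := by
    intro f h0 hf
    have hi : Integrable f := by simpa using hf 0
    refine ⟨_, rfl, isFiniteMeasure_withDensity_ofReal hi.2, fun x => ?_, ?_⟩
    · rw [ProbabilityTheory.mgf, integral_withDensity_eq_integral_toReal_smul₀
        hi.1.aemeasurable.ennreal_ofReal (Eventually.of_forall fun _ => ENNReal.ofReal_lt_top)]
      refine integral_congr_ae (Eventually.of_forall fun u => ?_)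
      simp [ENNReal.toReal_ofReal (h0 u), mul_comm]
    · refine Set.eq_univ_of_forall fun x => ?_
      change Integrable _ _
      rw [integrable_withDensity_iff_integrable_smul₀' hi.1.aemeasurable.ennreal_ofReal
        (Eventually.of_forall fun _ => ENNReal.ofReal_lt_top)]
      refine (hf x).congr (Eventually.of_forall fun u => ?_)
      simp [ENNReal.toReal_ofReal (h0 u), mul_comm]
  obtain ⟨μ, hμ, hμf, hμm, hμe⟩ := key hf0 hf
  obtain ⟨ν, hν, hνf, hνm, hνe⟩ := key hg0 hg
  have hmgf : ProbabilityTheory.mgf id μ = ProbabilityTheory.mgf id ν := by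
    ext x; rw [hμm, hνm, h]
  have hz : μ = 0 ↔ ν = 0 := by
    have h0 := congrFun hmgf 0
    rw [ProbabilityTheory.mgf_zero', ProbabilityTheory.mgf_zero'] at h0
    rw [← Measure.measure_univ_eq_zero, ← Measure.measure_univ_eq_zero,
      ← measureReal_eq_zero_iff, ← measureReal_eq_zero_iff, h0]
  have hμν : μ = ν := by
    refine Measure.ext_of_complexMGF_id_eq (funext fun z => ?_)
    exact ProbabilityTheory.eqOn_complexMGF_of_mgf' hmgf hz (by simp [hμe])
  rw [hμ, hν] at hμν
  have hif : Integrable f := by simpa using hf 0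
  have hig : Integrable g := by simpa using hg 0
  have := (withDensity_eq_iff hif.1.aemeasurable.ennreal_ofReal
    hig.1.aemeasurable.ennreal_ofReal (by
      have := hμf.1
      rw [hμ, withDensity_apply _ MeasurableSet.univ, setLIntegral_univ] at this
      exact this.ne)).1 hμν
  filter_upwards [this] with u hu
  exact (ENNReal.ofReal_eq_ofReal_iff (hf0 u) (hg0 u)).1 hu

/-- Apply the nonnegative case to the positive and negative parts of k, which have the same Laplace
transform; they are then equal, and at most one of them is nonzero at each point. -/
lemma ae_eq_zero_of_integral_exp_mul_eq_zero {k : ℝ → ℝ}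
    (hk : ∀ x : ℝ, Integrable fun u => Real.exp (x * u) * k u)
    (h : ∀ x : ℝ, ∫ u, Real.exp (x * u) * k u = 0) : k =ᵐ[volume] 0 := by
  have hp : ∀ x : ℝ, Integrable fun u => Real.exp (x * u) * max (k u) 0 := fun x => by
    refine (hk x).pos_part.congr (Eventually.of_forall fun u => ?_)
    simp only [mul_max_of_nonneg _ _ (Real.exp_nonneg (x * u)), mul_zero]
  have hn : ∀ x : ℝ, Integrable fun u => Real.exp (x * u) * max (-k u) 0 := fun x => by
    refine (hk x).neg_part.congr (Eventually.of_forall fun u => ?_)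
    simp only [mul_max_of_nonneg _ _ (Real.exp_nonneg (x * u)), mul_zero, mul_neg]
  have := withDensity_eq_of_integral_exp_eq (f := fun u => max (k u) 0)
    (g := fun u => max (-k u) 0) (fun u => le_max_right _ _) (fun u => le_max_right _ _) hp hn
    (fun x => by
      rw [← sub_eq_zero, ← integral_sub (hp x) (hn x)]
      refine Eq.trans ?_ (h x)
      congr 1; ext u
      rw [← mul_sub, max_zero_sub_max_neg_zero_eq_self])
  filter_upwards [this] with u hu
  rcases le_total (k u) 0 with h1 | h1
  · rw [max_eq_right h1, max_eq_left (by linarith)] at hu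
    simp only [Pi.zero_apply]; linarith
  · rw [max_eq_left h1, max_eq_right (by linarith)] at hu
    exact hu

/-- Because h may behave like 1/u at 0, the Laplace transform is taken of the even function sinh(u)
h(u). It vanishes because 2 cosh(xu) sinh(u) = sinh((x+1)u) - sinh((x-1)u). -/
lemma SuperexpDecay.ae_eq_zero_of_sinhTransform_eq_zero {h : ℝ → ℝ} (hh : SuperexpDecay h)
    (hodd : ∀ u, h (-u) = -h u) (h0 : ∀ y, sinhTransform h y = 0) : h =ᵐ[volume] 0 := by
  have hs : ∀ b : ℝ, ∫ u, Real.sinh (b * u) * h u = 0 := fun b => by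
    have := h0 (b / 4)
    rwa [sinhTransform, mul_div_cancel₀ _ (four_ne_zero)] at this
  have hi : ∀ x : ℝ, Integrable fun u => Real.exp (x * u) * (Real.sinh u * h u) := fun x => by
    have := hh.integrable_of_bound_real (f := fun u => Real.exp (x * u) * Real.sinh u)
      (by fun_prop) (A := 1) (c := |x| + 1) (fun u => ?_)
    · simpa only [mul_assoc] using this
    · rw [abs_mul, abs_of_pos (Real.exp_pos _), one_mul, add_mul, Real.exp_add, one_mul, mul_assoc]
      have h1 : x * u ≤ |x| * |u| := (le_abs_self _).trans (abs_mul x u).le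
      have h2 := abs_sinh_le u
      rw [mul_comm] at h2
      gcongr
  have hc : ∀ x : ℝ, ∫ u, Real.exp (x * u) * (Real.sinh u * h u) = 0 := fun x => by
    have h1 : ∫ u, Real.exp (x * u) * (Real.sinh u * h u) =
        ∫ u, Real.exp (-x * u) * (Real.sinh u * h u) := by
      rw [← integral_neg_eq_self]
      congr 1; ext u
      rw [Real.sinh_neg, hodd]; ring_nf
    have h2 : ∫ u, Real.exp (x * u) * (Real.sinh u * h u) +
        Real.exp (-x * u) * (Real.sinh u * h u) = 0 := by
      have h3 : ∀ u, Real.exp (x * u) * (Real.sinh u * h u) +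
          Real.exp (-x * u) * (Real.sinh u * h u) =
          Real.sinh ((x + 1) * u) * h u - Real.sinh ((x - 1) * u) * h u := fun u => by
        simp only [Real.sinh_eq, add_mul, sub_mul, one_mul, neg_mul, Real.exp_add, Real.exp_sub,
          neg_add, neg_sub, Real.exp_neg]
        field_simp; ring
      simp_rw [h3]
      rw [integral_sub (hh.integrable_sinh _) (hh.integrable_sinh _), hs, hs, sub_zero]
    rw [integral_add (hi x) (hi (-x)), ← h1] at h2
    linarith
  filter_upwards [ae_eq_zero_of_integral_exp_mul_eq_zero hi hc,
    compl_mem_ae_iff.2 (measure_singleton (0 : ℝ))] with u hu hu0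
  have h1 : Real.sinh u ≠ 0 := by rw [Ne, Real.sinh_eq_zero]; exact hu0
  exact (mul_eq_zero.1 hu).resolve_left h1

/-- With x = (|c|+1)|u|, sinh 2x = 2 sinh x cosh x dominates |u| e^{c|u|}, since sinh x ≥ |u| and 2
cosh x ≥ e^{c|u|}. It serves for the difference of h and its quadratic counterpart, about which only
sinh-integrability is known. -/
lemma superexpDecay_of_integrable_sinh {h : ℝ → ℝ} (hm : AEStronglyMeasurable h)
    (hi : ∀ b : ℝ, Integrable fun u => Real.sinh (b * u) * h u) : SuperexpDecay h := fun c => by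
  refine (hi (2 * (|c| + 1))).mono ?_ (Eventually.of_forall fun u => ?_)
  · exact AEStronglyMeasurable.mul (by fun_prop) (aestronglyMeasurable_id.mul hm)
  · rw [norm_mul, norm_mul, norm_mul, ← mul_assoc]
    gcongr
    rw [Real.norm_of_nonneg (Real.exp_nonneg _), Real.norm_eq_abs, Real.norm_eq_abs,
      Real.abs_sinh, abs_mul, abs_of_pos (by positivity : 0 < 2 * (|c| + 1)), mul_assoc,
      Real.sinh_two_mul]
    have h1 : |u| ≤ Real.sinh ((|c| + 1) * |u|) := by
      refine le_trans ?_ (Real.self_le_sinh_iff.2 (by positivity))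
      nlinarith [abs_nonneg c, abs_nonneg u]
    have h2 : Real.exp (c * |u|) ≤ 2 * Real.cosh ((|c| + 1) * |u|) := by
      rw [Real.cosh_eq]
      have h3 : Real.exp (c * |u|) ≤ Real.exp ((|c| + 1) * |u|) := by
        apply Real.exp_le_exp.2
        have := le_abs_self c
        gcongr; linarith
      have := Real.exp_pos (-((|c| + 1) * |u|))
      linarith
    calc _ ≤ 2 * Real.cosh ((|c| + 1) * |u|) * Real.sinh ((|c| + 1) * |u|) := by
          gcongr
      _ = _ := by ring

/-! ### Plancherel's theorem for integrable functions -/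

open FourierTransform in
lemma integral_fourier_mul_schwartz {k : ℝ → ℂ} (hk : Integrable k) (g : SchwartzMap ℝ ℂ) :
    ∫ x, 𝓕 k x * g x = ∫ x, k x * 𝓕 g x := by
  have := VectorFourier.integral_fourierIntegral_smul_eq_flip (μ := volume) (ν := volume)
    (L := innerₗ ℝ) (f := k) (g := g)
    Real.continuous_fourierChar continuous_inner hk g.integrable
  simp only [smul_eq_mul, flip_innerₗ] at this
  convert! this using 1

lemma ae_eq_of_integral_mul_schwartz {f g : ℝ → ℂ} (hf : LocallyIntegrable f)
    (hg : LocallyIntegrable g)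
    (h : ∀ φ : SchwartzMap ℝ ℂ, ∫ x, f x * φ x = ∫ x, g x * φ x) : f =ᵐ[volume] g := by
  refine ae_eq_of_integral_contDiff_smul_eq hf hg fun φ hφ hφc => ?_
  have hg₁ : HasCompactSupport (Complex.ofRealCLM ∘ φ) := hφc.comp_left rfl
  have hg₂ : ContDiff ℝ (⊤ : ℕ∞) (Complex.ofRealCLM ∘ φ) := by fun_prop
  have := h (hg₁.toSchwartzMap hg₂)
  simpa [mul_comm] using this

open FourierTransform in
-- The L² transform and the transform given by the integral agree when tested against Schwartz
-- functions, since both move the transform onto the test function.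
lemma fourier_toLp_ae_eq {k : ℝ → ℂ} (hk : Integrable k) (hk2 : MemLp k 2) :
    (𝓕 (hk2.toLp k) : Lp ℂ 2 volume) =ᵐ[volume] 𝓕 k := by
  refine ae_eq_of_integral_mul_schwartz ((Lp.memLp _).locallyIntegrable one_le_two)
    (VectorFourier.fourierIntegral_continuous Real.continuous_fourierChar continuous_inner
      hk).locallyIntegrable fun φ => ?_
  rw [integral_fourier_mul_schwartz hk]
  have h1 := congrArg (fun T => T φ) (Lp.fourier_toTemperedDistribution_eq (hk2.toLp k))
  simp only [TemperedDistribution.fourier_apply, Lp.toTemperedDistribution_apply,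
    smul_eq_mul] at h1
  calc _ = _ := by
        refine (?_ : _ = ∫ x, φ x * (𝓕 (hk2.toLp k) : Lp ℂ 2 volume) x)
        congr 1; ext x; ring
    _ = _ := h1.symm
    _ = _ := integral_congr_ae (by
      filter_upwards [hk2.coeFn_toLp] with x hx
      rw [hx, mul_comm])

open FourierTransform in
-- The L² inverse transform of 𝓕 k acts on Schwartz functions exactly as k does, so it coincides
-- with k almost everywhere. This reverse direction of Plancherel is what yields
-- square-integrability of sinh(2bu) h(u) from the mass-one equation.
lemma memLp_two_of_fourier {k : ℝ → ℂ} (hk : Integrable k) (hk2 : MemLp (𝓕 k) 2) :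
    MemLp k 2 := by
  have : (𝓕⁻ (hk2.toLp (𝓕 k)) : Lp ℂ 2 volume) =ᵐ[volume] k := by
    refine ae_eq_of_integral_mul_schwartz ((Lp.memLp _).locallyIntegrable one_le_two)
      hk.locallyIntegrable fun φ => ?_
    have h1 := congrArg (fun T => T φ) (Lp.fourierInv_toTemperedDistribution_eq (hk2.toLp (𝓕 k)))
    simp only [TemperedDistribution.fourierInv_apply, Lp.toTemperedDistribution_apply,
      smul_eq_mul] at h1
    calc _ = _ := by
          refine (?_ : _ = ∫ x, φ x * (𝓕⁻ (hk2.toLp (𝓕 k)) : Lp ℂ 2 volume) x)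
          congr 1; ext x; ring
      _ = _ := h1.symm
      _ = ∫ x, 𝓕 k x * (𝓕⁻ φ) x := integral_congr_ae (by
        filter_upwards [hk2.coeFn_toLp] with x hx
        rw [hx, mul_comm])
      _ = _ := by
        rw [integral_fourier_mul_schwartz hk, FourierTransform.fourier_fourierInv_eq]
  exact (memLp_congr_ae this).1 (Lp.memLp _)

open FourierTransform in
lemma memLp_two_fourier {k : ℝ → ℂ} (hk : Integrable k) (hk2 : MemLp k 2) :
    MemLp (𝓕 k) 2 := (memLp_congr_ae (fourier_toLp_ae_eq hk hk2)).1 (Lp.memLp _)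

open FourierTransform in
lemma integral_norm_sq_fourier_eq {k : ℝ → ℂ} (hk : Integrable k) (hk2 : MemLp k 2) :
    ∫ x, ‖𝓕 k x‖ ^ 2 = ∫ x, ‖k x‖ ^ 2 := by
  have h1 := Lp.norm_fourier_eq (hk2.toLp k)
  have h2 : ∀ f : Lp ℂ 2 (volume : Measure ℝ), ‖f‖ ^ 2 = ∫ x, ‖f x‖ ^ 2 := fun f => by
    have h3 : ‖f‖ ^ 2 = RCLike.re (inner ℂ f f) := norm_sq_eq_re_inner (𝕜 := ℂ) f
    rw [h3, L2.inner_def, ← integral_re (L2.integrable_inner f f)]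
    congr 1; ext x
    exact (norm_sq_eq_re_inner (𝕜 := ℂ) (f x)).symm
  have h3 : ∫ x, ‖(𝓕 (hk2.toLp k) : Lp ℂ 2 volume) x‖ ^ 2 = ∫ x, ‖hk2.toLp k x‖ ^ 2 := by
    rw [← h2, ← h2, h1]
  refine Eq.trans (integral_congr_ae ?_) (h3.trans (integral_congr_ae ?_))
  · filter_upwards [fourier_toLp_ae_eq hk hk2] with x hx
    rw [hx]
  · filter_upwards [hk2.coeFn_toLp] with x hx
    rw [hx]

open FourierTransform in
-- At the frequency t/π the character is e^{-2itu}; by evenness of k its sine part integrates to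
-- zero.
lemma fourier_ofReal_of_even {k : ℝ → ℝ} (hk : Integrable k) (heven : ∀ u, k (-u) = k u) (t : ℝ) :
    𝓕 (fun u => (k u : ℂ)) (t / Real.pi) = ((∫ u, Real.cos (2 * t * u) * k u : ℝ) : ℂ) := by
  have hi : Integrable fun u : ℝ => Complex.exp (-(2 * t * u : ℝ) * Complex.I) * k u :=
    hk.ofReal.bdd_mul (c := 1) (by fun_prop) (Eventually.of_forall fun u => by
      rw [← Complex.ofReal_neg, Complex.norm_exp_ofReal_mul_I])
  have h1 : 𝓕 (fun u => (k u : ℂ)) (t / Real.pi) =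
      ∫ u : ℝ, Complex.exp (-(2 * t * u : ℝ) * Complex.I) * k u := by
    rw [Real.fourier_real_eq_integral_exp_smul]
    congr 1; ext u
    rw [smul_eq_mul]
    congr 2
    push_cast
    field_simp
  have h2 : ∫ u : ℝ, Complex.exp (-(2 * t * u : ℝ) * Complex.I) * k u =
      ∫ u : ℝ, Complex.exp ((2 * t * u : ℝ) * Complex.I) * k u := by
    rw [← integral_neg_eq_self]
    congr 1; ext u
    rw [heven]; push_cast; ring_nf
  have hi' : Integrable fun u : ℝ => Complex.exp ((2 * t * u : ℝ) * Complex.I) * k u :=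
    hk.ofReal.bdd_mul (c := 1) (by fun_prop) (Eventually.of_forall fun u => by
      rw [Complex.norm_exp_ofReal_mul_I])
  have h3 : ∫ u : ℝ, Complex.exp (-(2 * t * u : ℝ) * Complex.I) * k u =
      (∫ u : ℝ, (Complex.exp ((2 * t * u : ℝ) * Complex.I) * k u +
        Complex.exp (-(2 * t * u : ℝ) * Complex.I) * k u)) / 2 := by
    rw [integral_add hi' hi, ← h2]; ring
  rw [h1, h3, ← integral_complex_ofReal, ← integral_div]
  congr 1; ext u
  push_cast
  rw [Complex.cos]
  ring

lemma memLp_two_cos_iff {k : ℝ → ℝ} (hk : Integrable k) (heven : ∀ u, k (-u) = k u) :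
    MemLp (fun t : ℝ => ∫ u, Real.cos (2 * t * u) * k u) 2 ↔ MemLp k 2 := by
  have hkc : Integrable fun u => (k u : ℂ) := hk.ofReal
  open FourierTransform in
  have hY : (fun t : ℝ => ‖∫ u, Real.cos (2 * t * u) * k u‖) =
      fun t => ‖𝓕 (fun u => (k u : ℂ)) (Real.pi⁻¹ * t)‖ := by
    ext t
    rw [inv_mul_eq_div, fourier_ofReal_of_even hk heven, Complex.norm_real]
  have hcont : Continuous (FourierTransform.fourier fun u => (k u : ℂ)) :=
    VectorFourier.fourierIntegral_continuous Real.continuous_fourierChar continuous_inner hk.ofReal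
  have hYc : AEStronglyMeasurable (fun t : ℝ => ∫ u, Real.cos (2 * t * u) * k u) := by
    have : (fun t : ℝ => ∫ u, Real.cos (2 * t * u) * k u) =
        fun t => (FourierTransform.fourier (fun u => (k u : ℂ)) (t / Real.pi)).re := by
      ext t; rw [fourier_ofReal_of_even hk heven, Complex.ofReal_re]
    rw [this]
    exact (Complex.continuous_re.comp (hcont.comp (by fun_prop))).aestronglyMeasurable
  have hk2 : MemLp k 2 ↔ MemLp (fun u => (k u : ℂ)) 2 := by
    rw [← memLp_norm_iff hk.1, ← memLp_norm_iff hkc.1]; simp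
  have hc2 : AEStronglyMeasurable fun t =>
      FourierTransform.fourier (fun u => (k u : ℂ)) (Real.pi⁻¹ * t) :=
    (hcont.comp (continuous_const_mul _)).aestronglyMeasurable
  rw [← memLp_norm_iff hYc, hY, memLp_norm_iff hc2, hk2, memLp_two_iff_integrable_sq_norm hc2,
    integrable_comp_mul_left_iff
      (fun t => ‖FourierTransform.fourier (fun u => (k u : ℂ)) t‖ ^ 2) (inv_ne_zero Real.pi_ne_zero),
    ← memLp_two_iff_integrable_sq_norm hcont.aestronglyMeasurable]
  exact ⟨memLp_two_of_fourier hkc, memLp_two_fourier hkc⟩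

lemma integral_sq_cos_transform {k : ℝ → ℝ} (hk : Integrable k) (heven : ∀ u, k (-u) = k u)
    (hk2 : MemLp k 2) :
    ∫ t : ℝ, (∫ u, Real.cos (2 * t * u) * k u) ^ 2 = Real.pi * ∫ u, k u ^ 2 := by
  have hkc : Integrable fun u => (k u : ℂ) := hk.ofReal
  have h2 := integral_norm_sq_fourier_eq hkc
    ((memLp_norm_iff hkc.1).1 (by simpa using hk2.norm))
  have h1 : (fun t : ℝ => (∫ u, Real.cos (2 * t * u) * k u) ^ 2) =
      fun t => ‖FourierTransform.fourier (fun u => (k u : ℂ)) (t / Real.pi)‖ ^ 2 := by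
    ext t
    rw [fourier_ofReal_of_even hk heven, Complex.norm_real, Real.norm_eq_abs, sq_abs]
  rw [h1, Measure.integral_comp_div
    (fun t => ‖FourierTransform.fourier (fun u => (k u : ℂ)) t‖ ^ 2), h2, smul_eq_mul,
    abs_of_pos Real.pi_pos]
  simp

/-! ### Abel summation with Gaussian weights -/

lemma integrable_gaussian_mul_of_le {P : ℝ → ℂ} (hP : Continuous P) {A : ℝ}
    (hA : ∀ t, ‖P t‖ ≤ A * (1 + t ^ 2)) {ε : ℝ} (hε : 0 < ε) :
    Integrable fun t => (Real.exp (-ε * t ^ 2) : ℂ) * P t := by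
  have h2 : Integrable fun t : ℝ => t ^ 2 * Real.exp (-ε * t ^ 2) := by
    have := integrable_rpow_mul_exp_neg_mul_sq hε (s := 2) (by norm_num)
    simpa using this
  refine (((integrable_exp_neg_mul_sq hε).add h2).const_mul A).mono'
    (Continuous.aestronglyMeasurable (by fun_prop)) (Eventually.of_forall fun t => ?_)
  rw [norm_mul, Complex.norm_real, Real.norm_of_nonneg (Real.exp_nonneg _)]
  calc _ ≤ Real.exp (-ε * t ^ 2) * (A * (1 + t ^ 2)) := by gcongr; exact hA t
    _ = _ := by simp only [Pi.add_apply]; ring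

lemma integrable_gaussian_mul_of_le_real {P : ℝ → ℝ} (hP : Continuous P) {A : ℝ}
    (hA : ∀ t, |P t| ≤ A * (1 + t ^ 2)) {ε : ℝ} (hε : 0 < ε) :
    Integrable fun t => Real.exp (-ε * t ^ 2) * P t := by
  have := (integrable_gaussian_mul_of_le (P := fun t => (P t : ℂ)) (by fun_prop) (A := A)
    (by simpa using hA) hε).re
  simpa only [← Complex.ofReal_mul, RCLike.re_to_complex, Complex.ofReal_re] using this

lemma exists_bound_of_tendsto {A : ℝ → ℝ} (hA : Continuous A) {l : ℝ}
    (hl : Tendsto A atTop (𝓝 l)) : ∃ M, ∀ T, 0 ≤ T → |A T| ≤ M := by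
  obtain ⟨T₀, hT₀⟩ := eventually_atTop.1 (hl.abs.eventually (gt_mem_nhds (lt_add_one |l|)))
  obtain ⟨C, hC⟩ := isCompact_Icc.exists_bound_of_continuousOn (hA.continuousOn (s := Set.Icc 0 T₀))
  refine ⟨max C (|l| + 1), fun T hT => ?_⟩
  rcases le_total T T₀ with h | h
  · exact (hC T ⟨hT, h⟩).trans (le_max_left _ _)
  · exact (hT₀ T h).le.trans (le_max_right _ _)

lemma hasDerivAt_integral_symm {P : ℝ → ℝ} (hP : Continuous P) (T : ℝ) :
    HasDerivAt (fun T => ∫ t in (-T)..T, P t) (P T + P (-T)) T := by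
  have h1 : HasDerivAt (fun T => (∫ t in (0 : ℝ)..T, P t) - ∫ t in (0 : ℝ)..(-T), P t)
      (P T - P (-T) * (-1)) T := by
    refine (intervalIntegral.integral_hasDerivAt_right (hP.intervalIntegrable _ _)
      (hP.stronglyMeasurableAtFilter _ _) hP.continuousAt).sub ?_
    exact (intervalIntegral.integral_hasDerivAt_right (hP.intervalIntegrable 0 (-T))
      (hP.stronglyMeasurableAtFilter _ _) hP.continuousAt).comp T (hasDerivAt_neg T)
  convert! h1 using 1
  · ext T
    rw [intervalIntegral.integral_interval_sub_left (hP.intervalIntegrable _ _)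
      (hP.intervalIntegrable _ _)]
  · ring

/-- Integration by parts, followed by s = √ε T, writes a Gaussian mean as an average of the
symmetric partial integrals at T = s/√ε with respect to the probability density 2s e^{-s²} on (0,∞).
-/
lemma gaussian_mean_eq {P : ℝ → ℝ} (hP : Continuous P) {B : ℝ}
    (hB : ∀ t, |P t| ≤ B * (1 + t ^ 2)) {M : ℝ}
    (hM : ∀ T, 0 ≤ T → |∫ t in (-T)..T, P t| ≤ M) {ε : ℝ} (hε : 0 < ε) :
    ∫ t, Real.exp (-ε * t ^ 2) * P t =
      ∫ s in Set.Ioi (0 : ℝ), 2 * s * Real.exp (-s ^ 2) * ∫ t in (-(s / √ε))..(s / √ε), P t := by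
  set A : ℝ → ℝ := fun T => ∫ t in (-T)..T, P t with hAdef
  have hA : ∀ T, HasDerivAt A (P T + P (-T)) T := hasDerivAt_integral_symm hP
  have hAc : Continuous A := continuous_iff_continuousAt.2 fun T => (hA T).continuousAt
  have hi := integrable_gaussian_mul_of_le_real hP hB hε
  have hv : ∀ T : ℝ, HasDerivAt (fun T => -Real.exp (-ε * T ^ 2))
      (2 * ε * T * Real.exp (-ε * T ^ 2)) T := fun T => by
    have := (((hasDerivAt_pow 2 T).const_mul (-ε)).exp).neg
    convert! this using 1
    simp; ring
  have hvi : Integrable fun T : ℝ => 2 * ε * T * Real.exp (-ε * T ^ 2) := by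
    refine ((integrable_mul_exp_neg_mul_sq hε).const_mul (2 * ε)).congr
      (Eventually.of_forall fun T => ?_)
    simp only; ring
  have hexp0 : Tendsto (fun T : ℝ => Real.exp (-ε * T ^ 2)) atTop (𝓝 0) := by
    refine Real.tendsto_exp_atBot.comp ?_
    exact (tendsto_pow_atTop two_ne_zero).const_mul_atTop_of_neg (by linarith)
  have hparts := integral_Ioi_mul_deriv_eq_deriv_mul (a := (0 : ℝ)) (u := A)
    (v := fun T => -Real.exp (-ε * T ^ 2)) (u' := fun T => P T + P (-T))
    (v' := fun T => 2 * ε * T * Real.exp (-ε * T ^ 2)) (a' := 0) (b' := 0)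
    (fun T _ => hA T) (fun T _ => hv T) ?_ ?_ ?_ ?_
  · have h1 : ∫ t, Real.exp (-ε * t ^ 2) * P t =
        ∫ T in Set.Ioi (0 : ℝ), A T * (2 * ε * T * Real.exp (-ε * T ^ 2)) := by
      rw [hparts, sub_zero, zero_sub, ← integral_neg, ← integral_add_compl measurableSet_Ioi hi,
        Set.compl_Ioi, ← integral_comp_neg_Ioi, neg_zero, ← integral_add hi.integrableOn]
      · refine integral_congr_ae (Eventually.of_forall fun t => ?_)
        simp only [neg_sq]; ring
      · have := (hi.comp_neg).integrableOn (s := Set.Ioi (0 : ℝ))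
        simpa [IntegrableOn] using this
    rw [h1]
    have hs : 0 < √ε := Real.sqrt_pos.2 hε
    have h2 := integral_comp_mul_left_Ioi
      (fun s => 2 * s * Real.exp (-s ^ 2) * A (s / √ε)) 0 hs
    rw [mul_zero] at h2
    rw [eq_inv_smul_iff₀ hs.ne'] at h2
    rw [← h2, smul_eq_mul, ← integral_const_mul]
    refine integral_congr_ae (Eventually.of_forall fun T => ?_)
    simp only
    rw [mul_div_cancel_left₀ _ hs.ne', mul_pow, Real.sq_sqrt hε.le]
    have : √ε * √ε = ε := Real.mul_self_sqrt hε.le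
    rw [neg_mul]
    linear_combination (- (2 * T * Real.exp (-(ε * T ^ 2)) * A T)) * this
  · refine Integrable.mono' ((hvi.norm.const_mul M).integrableOn)
      (Continuous.aestronglyMeasurable (by fun_prop)) ?_
    filter_upwards [ae_restrict_mem measurableSet_Ioi] with T hT
    rw [Pi.mul_apply, norm_mul]
    exact mul_le_mul_of_nonneg_right (hM T (le_of_lt hT)) (norm_nonneg _)
  · have h3 := (hi.add hi.comp_neg).neg.integrableOn (s := Set.Ioi (0 : ℝ))
    refine h3.congr (Eventually.of_forall fun T => ?_)
    simp only [Pi.neg_apply, Pi.add_apply, Pi.mul_apply, neg_sq]; ring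
  · have : Tendsto (A * fun T => -Real.exp (-ε * T ^ 2)) (𝓝[>] 0)
        (𝓝 (A 0 * -Real.exp (-ε * 0 ^ 2))) :=
      ((Continuous.tendsto (by fun_prop) 0).mono_left nhdsWithin_le_nhds)
    simpa [hAdef] using this
  · refine squeeze_zero_norm' (a := fun T => M * Real.exp (-ε * T ^ 2)) ?_
      (by simpa using hexp0.const_mul M)
    filter_upwards [eventually_ge_atTop 0] with T hT
    rw [Pi.mul_apply, norm_mul, norm_neg, Real.norm_of_nonneg (Real.exp_nonneg _)]
    exact mul_le_mul_of_nonneg_right (hM T hT) (Real.exp_nonneg _)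

/-- The abelian theorem: as ε ↓ 0 the partial integrals at s/√ε tend to l for each s > 0 while
staying bounded, so dominated convergence applies to their average. -/
lemma tendsto_gaussian_mean {P : ℝ → ℝ} (hP : Continuous P) {B : ℝ}
    (hB : ∀ t, |P t| ≤ B * (1 + t ^ 2)) {l : ℝ}
    (hl : Tendsto (fun T : ℝ => ∫ t in (-T)..T, P t) atTop (𝓝 l)) :
    Tendsto (fun ε : ℝ => ∫ t, Real.exp (-ε * t ^ 2) * P t) (𝓝[>] 0) (𝓝 l) := by
  have hAc : Continuous fun T : ℝ => ∫ t in (-T)..T, P t :=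
    continuous_iff_continuousAt.2 fun T => (hasDerivAt_integral_symm hP T).continuousAt
  obtain ⟨M, hM⟩ := exists_bound_of_tendsto hAc hl
  have h1 : (∫ s in Set.Ioi (0 : ℝ), 2 * s * Real.exp (-s ^ 2) * l) = l := by
    have h2 : ∫ s in Set.Ioi (0 : ℝ), s * Real.exp (-1 * s ^ 2) = 1 / 2 := by
      have := integral_mul_cexp_neg_mul_sq (b := 1) (by simp)
      have h3 := congrArg Complex.re this
      rw [← RCLike.re_to_complex, ← integral_re] at h3
      · rw [show (1 / 2 : ℝ) = ((2 * 1 : ℂ)⁻¹).re by norm_num, ← h3]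
        refine integral_congr_ae (Eventually.of_forall fun s => ?_)
        simp only [RCLike.re_to_complex]
        rw [show (s : ℂ) * Complex.exp (-1 * (s : ℂ) ^ 2) =
          ((s * Real.exp (-1 * s ^ 2) : ℝ) : ℂ) by push_cast; rfl, Complex.ofReal_re]
      · exact (integrable_mul_cexp_neg_mul_sq (by simp)).integrableOn
    rw [integral_mul_const]
    simp_rw [mul_assoc]
    rw [integral_const_mul]
    simp only [neg_mul, one_mul] at h2
    rw [h2]; ring
  rw [← h1]
  refine Tendsto.congr' (f₁ := fun ε : ℝ => ∫ s in Set.Ioi (0 : ℝ), 2 * s * Real.exp (-s ^ 2) *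
    ∫ t in (-(s / √ε))..(s / √ε), P t) ?_ ?_
  · filter_upwards [self_mem_nhdsWithin] with ε hε
    exact (gaussian_mean_eq hP hB hM hε).symm
  · refine tendsto_integral_filter_of_dominated_convergence
      (fun s => ‖2 * s * Real.exp (-s ^ 2)‖ * M) ?_ ?_ ?_ ?_
    · refine Eventually.of_forall fun ε => Continuous.aestronglyMeasurable ?_
      have := hAc.comp (continuous_id.div_const √ε)
      exact (by fun_prop : Continuous fun s : ℝ => 2 * s * Real.exp (-s ^ 2)).mul this
    · refine Eventually.of_forall fun ε => ?_
      filter_upwards [ae_restrict_mem measurableSet_Ioi] with s hs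
      rw [norm_mul]
      gcongr
      exact hM _ (div_nonneg (le_of_lt hs) (Real.sqrt_nonneg _))
    · have := ((integrable_mul_exp_neg_mul_sq one_pos).const_mul 2).norm.mul_const M
      refine (this.congr (Eventually.of_forall fun s => ?_)).integrableOn
      simp [mul_assoc]
    · filter_upwards [ae_restrict_mem measurableSet_Ioi] with s hs
      refine Tendsto.const_mul _ (hl.comp ?_)
      have h3 : Tendsto (fun ε : ℝ => √ε) (𝓝[>] 0) (𝓝[>] 0) := by
        refine tendsto_nhdsWithin_iff.2 ⟨?_, ?_⟩
        · have := Real.continuous_sqrt.tendsto 0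
          rw [Real.sqrt_zero] at this
          exact this.mono_left nhdsWithin_le_nhds
        · filter_upwards [self_mem_nhdsWithin] with ε hε
          exact Real.sqrt_pos.2 hε
      simpa [div_eq_mul_inv] using
        (tendsto_inv_nhdsGT_zero.comp h3).const_mul_atTop hs

/-! ### Shifting horizontal contours -/

/-- Cauchy's theorem on the rectangle with vertices ±T and ±T + ib; the vertical sides are kept as
an explicit error. -/
lemma integral_horizontal_shift {G : ℂ → ℂ} (hG : Differentiable ℂ G) (b T : ℝ) :
    ∫ t in (-T)..T, G (t + b * Complex.I) = (∫ t in (-T)..T, G t) +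
      Complex.I * ∫ s in (0 : ℝ)..b, (G (T + s * Complex.I) - G (-T + s * Complex.I)) := by
  have h := Complex.integral_boundary_rect_eq_zero_of_differentiableOn G (-T : ℝ)
    ((T : ℝ) + b * Complex.I) hG.differentiableOn
  have hc : ∀ a : ℂ, IntervalIntegrable (fun s : ℝ => G (a + s * Complex.I)) volume 0 b :=
    fun a => (hG.continuous.comp (by fun_prop)).intervalIntegrable _ _
  rw [intervalIntegral.integral_sub (hc T) (hc (-T))]
  simp only [Complex.ofReal_re, Complex.ofReal_im, Complex.add_re, Complex.mul_re, Complex.I_re,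
    mul_zero, Complex.I_im, sub_self, add_zero, Complex.add_im, Complex.mul_im,
    mul_one, zero_add, smul_eq_mul, Complex.ofReal_neg, Complex.neg_re, Complex.neg_im, neg_zero,
    Complex.ofReal_zero, zero_mul] at h
  linear_combination -h

lemma integral_horizontal_shift_of_tendsto {G : ℂ → ℂ} (hG : Differentiable ℂ G) {b : ℝ}
    (h0 : Integrable fun t : ℝ => G t) (hb : Integrable fun t : ℝ => G (t + b * Complex.I))
    {δ : ℝ → ℝ} (hδ : Tendsto δ atTop (𝓝 0))
    (hs : ∀ T : ℝ, ∀ s ∈ Set.uIoc 0 b, ‖G (T + s * Complex.I) - G (-T + s * Complex.I)‖ ≤ δ T) :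
    ∫ t : ℝ, G (t + b * Complex.I) = ∫ t : ℝ, G t := by
  have h1 := intervalIntegral_tendsto_integral hb tendsto_neg_atTop_atBot tendsto_id
  have h2 := intervalIntegral_tendsto_integral h0 tendsto_neg_atTop_atBot tendsto_id
  have h3 : Tendsto (fun T : ℝ => Complex.I * ∫ s in (0 : ℝ)..b,
      (G (T + s * Complex.I) - G (-T + s * Complex.I))) atTop (𝓝 0) := by
    refine squeeze_zero_norm (a := fun T => δ T * |b - 0|) (fun T => ?_)
      (by simpa using hδ.mul_const |b - 0|)
    rw [norm_mul, Complex.norm_I, one_mul]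
    exact intervalIntegral.norm_integral_le_of_norm_le_const (hs T)
  have h4 := h2.add h3
  rw [add_zero] at h4
  refine tendsto_nhds_unique (h1.congr fun T => ?_) h4
  exact integral_horizontal_shift hG b T

lemma SuperexpDecay.exists_norm_sq_sineTransform_le {h : ℝ → ℝ} (hh : SuperexpDecay h) (b : ℝ) :
    ∃ A, 0 ≤ A ∧ ∀ t s : ℝ, |s| ≤ |b| →
      ‖sineTransform h (t + s * Complex.I)‖ ^ 2 ≤ A * (1 + t ^ 2) := by
  obtain ⟨A, hA, h1⟩ := hh.exists_norm_sineTransform_le |b|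
  refine ⟨A ^ 2 * (1 + b ^ 2), by positivity, fun t s hs => ?_⟩
  have h2 := h1 (t + s * Complex.I) (by simpa using hs)
  have h3 : ‖(t : ℂ) + s * Complex.I‖ ^ 2 = t ^ 2 + s ^ 2 := by
    rw [← Complex.normSq_eq_norm_sq, Complex.normSq_add_mul_I]
  have h4 : s ^ 2 ≤ b ^ 2 := sq_le_sq.2 hs
  calc _ ≤ (A * ‖(t : ℂ) + s * Complex.I‖) ^ 2 := by gcongr
    _ = A ^ 2 * (t ^ 2 + s ^ 2) := by rw [mul_pow, h3]
    _ ≤ A ^ 2 * ((1 + b ^ 2) * (1 + t ^ 2)) := by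
        gcongr
        nlinarith [mul_nonneg (sq_nonneg b) (sq_nonneg t)]
    _ = _ := by ring

lemma re_ofReal_add_mul_I (x y : ℝ) : ((x : ℂ) + y * Complex.I).re = x := by simp

lemma im_ofReal_add_mul_I (x y : ℝ) : ((x : ℂ) + y * Complex.I).im = y := by simp

lemma norm_exp_neg_mul_sq (ε x y : ℝ) :
    ‖Complex.exp (-ε * (x + y * Complex.I) ^ 2)‖ = Real.exp (-ε * (x ^ 2 - y ^ 2)) := by
  rw [Complex.norm_exp]
  congr 1
  have : -(ε : ℂ) * (x + y * Complex.I) ^ 2 =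
      ((-ε * (x ^ 2 - y ^ 2) : ℝ) : ℂ) + ((-ε * (2 * x * y) : ℝ) : ℂ) * Complex.I := by
    push_cast
    linear_combination (-(ε : ℂ) * y ^ 2) * Complex.I_sq
  rw [this, re_ofReal_add_mul_I]

lemma tendsto_one_add_sq_mul_gaussian {ε : ℝ} (hε : 0 < ε) :
    Tendsto (fun T : ℝ => (1 + T ^ 2) * Real.exp (-ε * T ^ 2)) atTop (𝓝 0) := by
  have h1 : Tendsto (fun T : ℝ => T ^ 2) atTop atTop := tendsto_pow_atTop two_ne_zero
  have h2 : Tendsto (fun x : ℝ => x ^ 1 * Real.exp (-ε * x)) atTop (𝓝 0) := by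
    simpa using tendsto_rpow_mul_exp_neg_mul_atTop_nhds_zero 1 ε hε
  have h3 : Tendsto (fun x : ℝ => Real.exp (-ε * x)) atTop (𝓝 0) :=
    Real.tendsto_exp_atBot.comp (tendsto_id.const_mul_atTop_of_neg (by linarith))
  have h4 := (h3.add h2).comp h1
  rw [add_zero] at h4
  refine h4.congr fun T => ?_
  simp only [Function.comp_apply]; ring

/-- Gaussian means of `Ψ²` along a horizontal line, moved to the real axis. -/
lemma SuperexpDecay.integral_gaussian_mul_sq {h : ℝ → ℝ} (hh : SuperexpDecay h) (b : ℝ) {ε : ℝ}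
    (hε : 0 < ε) :
    ∫ t : ℝ, (Real.exp (-ε * t ^ 2) : ℂ) * sineTransform h (t + b * Complex.I) ^ 2 =
      ∫ t : ℝ, Complex.exp (-ε * (t - b * Complex.I) ^ 2) * sineTransform h t ^ 2 := by
  obtain ⟨A, hA0, hA⟩ := hh.exists_norm_sq_sineTransform_le b
  set G : ℂ → ℂ := fun z => Complex.exp (-ε * (z - b * Complex.I) ^ 2) * sineTransform h z ^ 2
  have hd := hh.differentiable_sineTransform
  have hc := hd.continuous
  have hG : Differentiable ℂ G := by fun_prop
  -- Between the two lines one has |s| ≤ |b| and |s - b| ≤ |b|, so the Gaussian loses at most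
  -- e^{εb²} while Ψ² grows at most quadratically. The same majorant controls both lines and the
  -- vertical sides.
  have hb : ∀ t s : ℝ, |s| ≤ |b| → |s - b| ≤ |b| → ‖G (t + s * Complex.I)‖ ≤
      Real.exp (ε * b ^ 2) * A * ((1 + t ^ 2) * Real.exp (-ε * t ^ 2)) := fun t s hs hsb => by
    have h1 : (t : ℂ) + s * Complex.I - b * Complex.I = t + ((s - b : ℝ) : ℂ) * Complex.I := by
      push_cast; ring
    simp only [G]
    rw [h1, norm_mul, norm_exp_neg_mul_sq, norm_pow]
    have h2 : Real.exp (-ε * (t ^ 2 - (s - b) ^ 2)) ≤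
        Real.exp (ε * b ^ 2) * Real.exp (-ε * t ^ 2) := by
      rw [← Real.exp_add]
      have : (s - b) ^ 2 ≤ b ^ 2 := sq_le_sq.2 hsb
      apply Real.exp_le_exp.2
      nlinarith
    calc _ ≤ (Real.exp (ε * b ^ 2) * Real.exp (-ε * t ^ 2)) * (A * (1 + t ^ 2)) := by
          gcongr; exact hA t s hs
      _ = _ := by ring
  have hmaj : Integrable fun t : ℝ =>
      Real.exp (ε * b ^ 2) * A * ((1 + t ^ 2) * Real.exp (-ε * t ^ 2)) := by
    refine Integrable.const_mul ?_ _
    have h2 := integrable_gaussian_mul_of_le_real (P := fun t => 1 + t ^ 2) (by fun_prop) (A := 1)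
      (fun t => by rw [abs_of_nonneg (by positivity)]; linarith) hε
    simpa only [mul_comm] using h2
  have h0 : Integrable fun t : ℝ => G t :=
    hmaj.mono' (Continuous.aestronglyMeasurable (by fun_prop)) (Eventually.of_forall fun t => by
      simpa using hb t 0 (by simp) (by simp))
  have h1 : Integrable fun t : ℝ => G (t + b * Complex.I) :=
    hmaj.mono' (Continuous.aestronglyMeasurable (by fun_prop)) (Eventually.of_forall fun t => by
      simpa using hb t b le_rfl (by simp))
  have h2 := integral_horizontal_shift_of_tendsto hG h0 h1
    (δ := fun T => 2 * (Real.exp (ε * b ^ 2) * A * ((1 + T ^ 2) * Real.exp (-ε * T ^ 2))))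
    (by simpa using ((tendsto_one_add_sq_mul_gaussian hε).const_mul
      (Real.exp (ε * b ^ 2) * A)).const_mul 2) (fun T s hs => ?_)
  · rw [← h2]
    refine integral_congr_ae (Eventually.of_forall fun t => ?_)
    simp only [G, add_sub_cancel_right]
    push_cast; rfl
  · have hs1 : |s| ≤ |b| ∧ |s - b| ≤ |b| := by
      rcases le_total 0 b with hb0 | hb0
      · rw [Set.uIoc_of_le hb0] at hs
        obtain ⟨h3, h4⟩ := hs
        rw [abs_of_nonneg hb0]
        exact ⟨abs_le.2 ⟨by linarith, h4⟩, abs_le.2 ⟨by linarith, by linarith⟩⟩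
      · rw [Set.uIoc_of_ge hb0] at hs
        obtain ⟨h3, h4⟩ := hs
        rw [abs_of_nonpos hb0]
        exact ⟨abs_le.2 ⟨by linarith, by linarith⟩, abs_le.2 ⟨by linarith, by linarith⟩⟩
    have h3 := hb T s hs1.1 hs1.2
    have h4 := hb (-T) s hs1.1 hs1.2
    rw [neg_sq] at h4
    push_cast at h4
    exact (norm_sub_le _ _).trans (by linarith)

lemma im_sineTransform_ofReal {h : ℝ → ℝ} (t : ℝ) :
    (sineTransform h t).im = 0 := by
  have := sineTransform_conj h t
  rw [Complex.conj_ofReal] at this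
  exact Complex.conj_eq_iff_im.1 this.symm

lemma norm_sq_eq_re_sq_add (w : ℂ) : ‖w‖ ^ 2 = (w ^ 2).re + 2 * w.im ^ 2 := by
  rw [← Complex.normSq_eq_norm_sq, Complex.normSq_apply, sq, Complex.mul_re]; ring

/-- Use |w|² = Re w² + 2 (Im w)² and shift the mean of Ψ² to the real axis, where Ψ is real. The
Gaussian becomes e^{-ε(t-ib)²} = e^{-εt²} e^{εb²} e^{2iεbt}, whose real part gives the cosine
weight. -/
lemma SuperexpDecay.integral_gaussian_mul_norm_sq {h : ℝ → ℝ} (hh : SuperexpDecay h) (b : ℝ)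
    {ε : ℝ} (hε : 0 < ε) :
    ∫ t : ℝ, Real.exp (-ε * t ^ 2) * ‖sineTransform h (t + b * Complex.I)‖ ^ 2 =
      2 * (∫ t : ℝ, Real.exp (-ε * t ^ 2) * (sineTransform h (t + b * Complex.I)).im ^ 2) +
      ∫ t : ℝ, Real.exp (-ε * t ^ 2) * (Real.exp (ε * b ^ 2) * Real.cos (2 * ε * b * t)) *
        ‖sineTransform h t‖ ^ 2 := by
  obtain ⟨A, hA0, hA⟩ := hh.exists_norm_sq_sineTransform_le b
  have hc := hh.differentiable_sineTransform.continuous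
  have h1 := congrArg Complex.re (hh.integral_gaussian_mul_sq b hε)
  have hi1 := integrable_gaussian_mul_of_le
    (P := fun t : ℝ => sineTransform h (t + b * Complex.I) ^ 2) (by fun_prop) (A := A)
    (fun t => by rw [norm_pow]; exact hA t b le_rfl) hε
  have hi0 := integrable_gaussian_mul_of_le
    (P := fun t : ℝ => Complex.exp (ε * b ^ 2 + 2 * ε * b * t * Complex.I) *
      sineTransform h t ^ 2) (by fun_prop) (A := Real.exp (ε * b ^ 2) * A) (fun t => by
        rw [norm_mul, norm_pow, Complex.norm_exp, mul_assoc (Real.exp _)]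
        have h2 := hA t 0 (by simp)
        simp only [Complex.ofReal_zero, zero_mul, add_zero] at h2
        have h3 : ((ε : ℂ) * b ^ 2 + 2 * ε * b * t * Complex.I).re = ε * b ^ 2 := by
          rw [show (ε : ℂ) * b ^ 2 + 2 * ε * b * t * Complex.I =
            ((ε * b ^ 2 : ℝ) : ℂ) + ((2 * ε * b * t : ℝ) : ℂ) * Complex.I by push_cast; ring,
            re_ofReal_add_mul_I]
        rw [h3]
        gcongr) hε
  have e0 : (fun t : ℝ => Complex.exp (-ε * (t - b * Complex.I) ^ 2) * sineTransform h t ^ 2) =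
      fun t : ℝ => (Real.exp (-ε * t ^ 2) : ℂ) *
        (Complex.exp (ε * b ^ 2 + 2 * ε * b * t * Complex.I) * sineTransform h t ^ 2) := by
    ext t
    rw [← mul_assoc, Complex.ofReal_exp, ← Complex.exp_add]
    congr 2
    push_cast
    linear_combination (-(ε : ℂ) * b ^ 2) * Complex.I_sq
  rw [e0, ← RCLike.re_to_complex, ← RCLike.re_to_complex, ← integral_re hi1,
    ← integral_re hi0] at h1
  have hi2 := integrable_gaussian_mul_of_le_real
    (P := fun t : ℝ => (sineTransform h (t + b * Complex.I)).im ^ 2)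
    (by fun_prop) (A := A) (fun t => by
      rw [abs_of_nonneg (sq_nonneg _)]
      refine le_trans ?_ (hA t b le_rfl)
      rw [← sq_abs]
      gcongr
      exact Complex.abs_im_le_norm _) hε
  have e1 : ∀ t : ℝ, Real.exp (-ε * t ^ 2) * ‖sineTransform h (t + b * Complex.I)‖ ^ 2 =
      2 * (Real.exp (-ε * t ^ 2) * (sineTransform h (t + b * Complex.I)).im ^ 2) +
      RCLike.re ((Real.exp (-ε * t ^ 2) : ℂ) * sineTransform h (t + b * Complex.I) ^ 2) := by
    intro t
    rw [norm_sq_eq_re_sq_add, RCLike.re_to_complex, Complex.re_ofReal_mul]; ring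
  simp_rw [e1]
  rw [integral_add (hi2.const_mul 2) hi1.re, integral_const_mul, h1]
  congr 1
  refine integral_congr_ae (Eventually.of_forall fun t => ?_)
  have h5 : sineTransform h t = ((sineTransform h t).re : ℂ) :=
    Complex.ext rfl (im_sineTransform_ofReal t)
  simp only [RCLike.re_to_complex]
  have h6 (r : ℝ) : (Complex.exp (ε * b ^ 2 + 2 * ε * b * t * Complex.I) * (r : ℂ) ^ 2).re =
      Real.exp (ε * b ^ 2) * Real.cos (2 * ε * b * t) * r ^ 2 := by
    rw [mul_comm, ← Complex.ofReal_pow r, Complex.re_ofReal_mul,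
      show (ε : ℂ) * b ^ 2 + 2 * ε * b * t * Complex.I =
        ((ε * b ^ 2 : ℝ) : ℂ) + ((2 * ε * b * t : ℝ) : ℂ) * Complex.I by push_cast; ring,
      Complex.exp_re, re_ofReal_add_mul_I, im_ofReal_add_mul_I]
    ring
  rw [h5, Complex.re_ofReal_mul, h6, Complex.norm_real, Real.norm_eq_abs, sq_abs]
  ring

/-! ### Growth of sine transforms on the real axis -/

/-- From sin² x ≤ min(1, x²) one gets (1 + x²) sin² x ≤ 2x². With x = 2tu this dominates the
integrand by 8t²/(1 + x²), whose integral is 4π|t|. -/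
lemma integral_sq_sin_div_le (t : ℝ) :
    Integrable (fun u : ℝ => (Real.sin (2 * t * u) / u) ^ 2) ∧
      ∫ u : ℝ, (Real.sin (2 * t * u) / u) ^ 2 ≤ 4 * Real.pi * |t| := by
  have hb : ∀ u : ℝ, (Real.sin (2 * t * u) / u) ^ 2 ≤ 8 * t ^ 2 * (1 + (2 * t * u) ^ 2)⁻¹ := by
    intro u
    rcases eq_or_ne u 0 with rfl | hu
    · simp; positivity
    have hu2 : 0 < u ^ 2 := by positivity
    rw [div_pow, ← div_eq_mul_inv, div_le_div_iff₀ hu2 (by positivity)]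
    have h1 := Real.sin_sq_le_one (2 * t * u)
    have h2 : Real.sin (2 * t * u) ^ 2 ≤ (2 * t * u) ^ 2 := by
      rw [← sq_abs, ← sq_abs (2 * t * u)]
      exact pow_le_pow_left₀ (abs_nonneg _) (Real.abs_sin_le_abs) 2
    nlinarith [mul_le_mul_of_nonneg_right h1 (sq_nonneg (2 * t * u))]
  rcases eq_or_ne t 0 with rfl | ht
  · simp
  have hi : Integrable fun u : ℝ => 8 * t ^ 2 * (1 + (2 * t * u) ^ 2)⁻¹ :=
    (integrable_inv_one_add_sq.comp_mul_left' (R := 2 * t) (by positivity)).const_mul _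
  have hi' : Integrable (fun u : ℝ => (Real.sin (2 * t * u) / u) ^ 2) :=
    hi.mono' (Measurable.aestronglyMeasurable (by fun_prop)) (Eventually.of_forall fun u => by
      rw [Real.norm_of_nonneg (sq_nonneg _)]; exact hb u)
  refine ⟨hi', (integral_mono hi' hi hb).trans (le_of_eq ?_)⟩
  rw [integral_const_mul, Measure.integral_comp_mul_left (fun x => (1 + x ^ 2)⁻¹),
    integral_univ_inv_one_add_sq, smul_eq_mul, abs_inv, abs_mul, abs_two, ← sq_abs t]
  have : |t| ≠ 0 := abs_ne_zero.2 ht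
  field_simp
  norm_num

lemma sq_integral_mul_le {f g : ℝ → ℝ} {μ : Measure ℝ} (hf : MemLp f 2 μ) (hg : MemLp g 2 μ) :
    (∫ u, f u * g u ∂μ) ^ 2 ≤ (∫ u, f u ^ 2 ∂μ) * ∫ u, g u ^ 2 ∂μ := by
  have h1 := integral_mul_norm_le_Lp_mul_Lq (μ := μ) (f := f) (g := g) Real.HolderConjugate.two_two
    (by simpa using hf) (by simpa using hg)
  have h2 : |∫ u, f u * g u ∂μ| ≤ ∫ u, ‖f u‖ * ‖g u‖ ∂μ := by
    refine (abs_integral_le_integral_abs).trans (le_of_eq ?_)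
    congr 1; ext u; rw [abs_mul]; rfl
  have h3 := h2.trans h1
  have e : ∀ k : ℝ → ℝ, ∫ u, ‖k u‖ ^ (2 : ℝ) ∂μ = ∫ u, k u ^ 2 ∂μ := fun k => by
    congr 1; ext u
    rw [Real.rpow_two, Real.norm_eq_abs, sq_abs]
  rw [e, e, ← Real.sqrt_eq_rpow, ← Real.sqrt_eq_rpow] at h3
  have h4 := pow_le_pow_left₀ (abs_nonneg _) h3 2
  rwa [sq_abs, mul_pow, Real.sq_sqrt (integral_nonneg fun _ => sq_nonneg _),
    Real.sq_sqrt (integral_nonneg fun _ => sq_nonneg _)] at h4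

/-- Near u = 0 Cauchy–Schwarz pairs sin(2tu)/u, of squared norm at most 4π|t|, with u h(u), whose L²
mass on a small ball is as small as desired. Away from 0 the density is integrable and contributes a
constant. -/
lemma SuperexpDecay.exists_norm_sq_sineTransform_ofReal_le {h : ℝ → ℝ} (hh : SuperexpDecay h)
    (h2 : MemLp (fun u => u / (1 + |u|) * h u) 2) {η : ℝ} (hη : 0 < η) :
    ∃ C, 0 ≤ C ∧ ∀ t : ℝ, ‖sineTransform h t‖ ^ 2 ≤ η * |t| + C := by
  have hsq := h2.integrable_sq
  set w : ℝ → ℝ := fun u => (u / (1 + |u|) * h u) ^ 2 with hw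
  have hlim : Tendsto (fun n : ℕ => ∫ u in Metric.closedBall (0 : ℝ) (1 / ((n : ℝ) + 1)), w u)
      atTop (𝓝 (∫ u in ⋂ n : ℕ, Metric.closedBall (0 : ℝ) (1 / ((n : ℝ) + 1)), w u)) :=
    tendsto_setIntegral_of_antitone (fun n => Metric.isClosed_closedBall.measurableSet)
      (fun m n hmn => Metric.closedBall_subset_closedBall (by gcongr))
      ⟨0, hsq.integrableOn⟩
  have hinter : (⋂ n : ℕ, Metric.closedBall (0 : ℝ) (1 / ((n : ℝ) + 1))) = {0} := by
    refine Set.Subset.antisymm (fun u hu => ?_) (fun u hu => ?_)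
    · have h3 : ∀ n : ℕ, |u| ≤ 1 / ((n : ℝ) + 1) := fun n => by
        simpa using Set.mem_iInter.1 hu n
      have h4 : |u| ≤ 0 := ge_of_tendsto' tendsto_one_div_add_atTop_nhds_zero_nat h3
      exact abs_nonpos_iff.1 h4
    · rw [Set.mem_singleton_iff.1 hu]
      exact Set.mem_iInter.2 fun n => Metric.mem_closedBall_self (by positivity)
  rw [hinter, Measure.restrict_singleton, Real.volume_singleton, zero_smul,
    integral_zero_measure] at hlim
  -- The 32π is 4 · 4π · 2: (1+|u|)² ≤ 4 on |u| ≤ 1, the bound 4π|t| for the sine factor, and the 2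
  -- in (a+b)² ≤ 2a² + 2b².
  have hη' : 0 < η / (32 * Real.pi) := by positivity
  obtain ⟨n, hn⟩ := (hlim.eventually (gt_mem_nhds hη')).exists
  set ρ : ℝ := 1 / ((n : ℝ) + 1)
  have hρ : 0 < ρ := by positivity
  have hρ1 : ρ ≤ 1 := by
    rw [div_le_one (by positivity)]; linarith [(Nat.cast_nonneg n : (0:ℝ) ≤ n)]
  set U := Metric.closedBall (0 : ℝ) ρ
  have hU : MeasurableSet U := Metric.isClosed_closedBall.measurableSet
  set K := ρ⁻¹ * ∫ u, |u * h u|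
  refine ⟨2 * K ^ 2, by positivity, fun t => ?_⟩
  have hre : ‖sineTransform h t‖ ^ 2 = (∫ u : ℝ, Real.sin (2 * t * u) * h u) ^ 2 := by
    rw [norm_sq_eq_re_sq_add, im_sineTransform_ofReal, sq, Complex.mul_re,
      im_sineTransform_ofReal]
    have := hh.re_sineTransform t 0
    simp only [Complex.ofReal_zero, zero_mul, add_zero, mul_zero, Real.cosh_zero, one_mul] at this
    rw [this]; ring
  have hint : Integrable fun u : ℝ => Real.sin (2 * t * u) * h u := by
    have := (hh.integrable_sin t).re
    refine this.congr (Eventually.of_forall fun u => ?_)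
    simp only [RCLike.re_to_complex]
    rw [mul_comm, Complex.re_ofReal_mul, ← Complex.ofReal_ofNat, ← Complex.ofReal_mul,
      ← Complex.ofReal_mul, ← Complex.ofReal_sin, Complex.ofReal_re, mul_comm]
  have hnear : (∫ u in U, Real.sin (2 * t * u) * h u) ^ 2 ≤ η / 2 * |t| := by
    have hs := integral_sq_sin_div_le t
    have hm : AEStronglyMeasurable h := hh.aestronglyMeasurable
    have hbd : ∀ u ∈ U, (u * h u) ^ 2 ≤ 4 * w u := fun u hu => by
      have hu1 : |u| ≤ 1 := le_trans (by simpa [U] using hu) hρ1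
      have h0 := abs_nonneg u
      simp only [hw, div_mul_eq_mul_div, div_pow]
      rw [mul_div_assoc', le_div_iff₀ (by positivity)]
      have : (1 + |u|) ^ 2 ≤ 4 := by nlinarith
      nlinarith [sq_nonneg (u * h u)]
    have hi2 : IntegrableOn (fun u => (u * h u) ^ 2) U :=
      ((hsq.const_mul 4).integrableOn (s := U)).mono'
        ((aestronglyMeasurable_id.mul hm).pow 2).restrict (by
          filter_upwards [ae_restrict_mem hU] with u hu
          rw [Real.norm_of_nonneg (sq_nonneg _)]; exact hbd u hu)
    have h5 := sq_integral_mul_le (μ := volume.restrict U) (f := fun u => Real.sin (2 * t * u) / u)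
      (g := fun u => u * h u)
      ((memLp_two_iff_integrable_sq (Measurable.aestronglyMeasurable (by fun_prop))).2
        hs.1.integrableOn)
      ((memLp_two_iff_integrable_sq (aestronglyMeasurable_id.mul hm).restrict).2 hi2)
    have h6 : ∫ u in U, Real.sin (2 * t * u) / u * (u * h u) =
        ∫ u in U, Real.sin (2 * t * u) * h u := by
      congr 1; ext u
      rcases eq_or_ne u 0 with rfl | hu
      · simp
      · field_simp
    rw [h6] at h5
    have h7 : ∫ u in U, (u * h u) ^ 2 ≤ η / (8 * Real.pi) := by
      refine (setIntegral_mono_on hi2 ((hsq.const_mul 4).integrableOn) hU hbd).trans ?_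
      rw [integral_const_mul]
      have := hn.le
      calc _ ≤ 4 * (η / (32 * Real.pi)) := by gcongr
        _ = _ := by ring
    have h8 : ∫ u in U, (Real.sin (2 * t * u) / u) ^ 2 ≤ 4 * Real.pi * |t| :=
      (setIntegral_le_integral hs.1 (Eventually.of_forall fun _ => sq_nonneg _)).trans hs.2
    refine h5.trans ((mul_le_mul h8 h7 (integral_nonneg fun _ => sq_nonneg _)
      (by positivity)).trans (le_of_eq ?_))
    field_simp; ring
  have hfar : |∫ u in Uᶜ, Real.sin (2 * t * u) * h u| ≤ K := by
    refine (abs_integral_le_integral_abs).trans ?_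
    have hi3 := hh.integrable_mul.abs
    rw [show K = ∫ u, ρ⁻¹ * |u * h u| from (integral_const_mul _ _).symm]
    refine (setIntegral_mono_on hint.abs.integrableOn (hi3.const_mul _).integrableOn hU.compl
      fun u hu => ?_).trans
      (setIntegral_le_integral (hi3.const_mul _) (Eventually.of_forall fun u => ?_))
    · have hu1 : ρ ≤ |u| := by
        have : ¬ |u| ≤ ρ := by simpa [U] using hu
        linarith
      rw [abs_mul, abs_mul]
      have h9 := Real.abs_sin_le_one (2 * t * u)
      calc _ ≤ 1 * |h u| := by gcongr
        _ ≤ (ρ⁻¹ * |u|) * |h u| := by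
          gcongr
          rw [← div_eq_inv_mul, le_div_iff₀ hρ]; linarith
        _ = _ := by ring
    · simp only [Pi.zero_apply]; positivity
  rw [hre, ← integral_add_compl hU hint]
  have h10 := sq_le_sq' (abs_le.1 hfar).1 (abs_le.1 hfar).2
  set a := ∫ u in U, Real.sin (2 * t * u) * h u
  set b := ∫ u in Uᶜ, Real.sin (2 * t * u) * h u
  nlinarith [sq_nonneg (a - b)]

/-! ### The difference of `L²`-means of a sine transform along two horizontal lines -/

lemma abs_exp_mul_cos_sub_one_le {ε b t : ℝ} (hε : 0 < ε) (hε1 : ε ≤ 1) :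
    |Real.exp (ε * b ^ 2) * Real.cos (2 * ε * b * t) - 1| ≤
      2 * b ^ 2 * Real.exp (b ^ 2) * (ε + ε ^ 2 * t ^ 2) := by
  have h1 : Real.exp (ε * b ^ 2) ≤ Real.exp (b ^ 2) := by
    apply Real.exp_le_exp.2; nlinarith [sq_nonneg b]
  have h2 : Real.exp (ε * b ^ 2) - 1 ≤ ε * b ^ 2 * Real.exp (b ^ 2) := by
    have h3 := Real.add_one_le_exp (-(ε * b ^ 2))
    have h4 : Real.exp (ε * b ^ 2) * Real.exp (-(ε * b ^ 2)) = 1 := by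
      rw [← Real.exp_add]; simp
    have h5 : Real.exp (ε * b ^ 2) - 1 ≤ ε * b ^ 2 * Real.exp (ε * b ^ 2) := by
      nlinarith [Real.exp_pos (ε * b ^ 2)]
    exact h5.trans (by gcongr)
  have h3 : 1 ≤ Real.exp (ε * b ^ 2) := Real.one_le_exp (by positivity)
  have h4 := Real.one_sub_sq_div_two_le_cos (x := 2 * ε * b * t)
  have h5 := Real.cos_le_one (2 * ε * b * t)
  have h6 : 0 ≤ Real.exp (b ^ 2) := Real.exp_nonneg _
  have h7 : Real.exp (ε * b ^ 2) * (1 - Real.cos (2 * ε * b * t)) ≤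
      Real.exp (b ^ 2) * (2 * ε ^ 2 * b ^ 2 * t ^ 2) := by
    refine mul_le_mul h1 (by nlinarith) (by linarith) h6
  have h8 : 0 ≤ ε * b ^ 2 * Real.exp (b ^ 2) := by positivity
  have h9 : 0 ≤ Real.exp (b ^ 2) * (2 * ε ^ 2 * b ^ 2 * t ^ 2) := by positivity
  have h10 : 0 ≤ Real.exp (ε * b ^ 2) * (1 - Real.cos (2 * ε * b * t)) :=
    mul_nonneg (Real.exp_nonneg _) (by linarith)
  rw [abs_le]
  constructor <;> nlinarith

/-- The weight minus 1 is O(ε + ε²t²). After s = √ε t this is ε(1+s²), with dt = ds/√ε and |Ψ(t)|² ≤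
η|s|/√ε + C, so the error is O(η) + O(C√ε). Linear growth alone would leave an error of order one;
an arbitrarily small slope η is needed. -/
lemma SuperexpDecay.tendsto_gaussian_error {h : ℝ → ℝ} (hh : SuperexpDecay h)
    (h2 : MemLp (fun u => u / (1 + |u|) * h u) 2) (b : ℝ) :
    Tendsto (fun ε : ℝ => ∫ t : ℝ, Real.exp (-ε * t ^ 2) *
      ((Real.exp (ε * b ^ 2) * Real.cos (2 * ε * b * t) - 1) * ‖sineTransform h t‖ ^ 2))
      (𝓝[>] 0) (𝓝 0) := by
  set K := 2 * b ^ 2 * Real.exp (b ^ 2)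
  have hK : 0 ≤ K := by positivity
  have hi0 : Integrable fun s : ℝ => Real.exp (-s ^ 2) * (1 + s ^ 2) := by
    have := integrable_gaussian_mul_of_le_real (P := fun s => 1 + s ^ 2) (by fun_prop) (A := 1)
      (fun t => by rw [abs_of_nonneg (by positivity)]; linarith) one_pos
    simpa using this
  have hi1 : Integrable fun s : ℝ => Real.exp (-s ^ 2) * ((1 + s ^ 2) * |s|) := by
    have h3 : Integrable fun s : ℝ => |s ^ 3 * Real.exp (-1 * s ^ 2)| := by
      have := (integrable_rpow_mul_exp_neg_mul_sq one_pos (s := 3) (by norm_num)).abs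
      exact_mod_cast this
    have h4 := ((integrable_mul_exp_neg_mul_sq one_pos).abs.add h3)
    refine h4.congr (Eventually.of_forall fun s => ?_)
    simp only [Pi.add_apply, abs_mul, abs_of_pos (Real.exp_pos _), abs_pow]
    have : |s| ^ 2 = s ^ 2 := sq_abs s
    rw [← this, pow_succ |s| 2]; ring_nf
  set M0 := ∫ s : ℝ, Real.exp (-s ^ 2) * (1 + s ^ 2)
  set M1 := ∫ s : ℝ, Real.exp (-s ^ 2) * ((1 + s ^ 2) * |s|)
  have hM1 : 0 ≤ M1 := integral_nonneg fun s => by positivity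
  rw [Metric.tendsto_nhds]
  intro δ hδ
  -- The slope η is chosen so that the part of the error that does not shrink with ε is at most δ/2.
  obtain ⟨C, hC0, hC⟩ := hh.exists_norm_sq_sineTransform_ofReal_le h2
    (η := δ / (2 * (K * M1 + 1))) (by positivity)
  set η := δ / (2 * (K * M1 + 1))
  have hη : K * η * M1 ≤ δ / 2 := by
    have : 0 < K * M1 + 1 := by positivity
    simp only [η]
    rw [mul_div_assoc', div_mul_eq_mul_div, div_le_div_iff₀ (by positivity) two_pos]
    nlinarith [mul_nonneg hK hM1]
  have hlim : Tendsto (fun ε : ℝ => K * (C * √ε) * M0) (𝓝[>] 0) (𝓝 0) := by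
    have : Tendsto (fun ε : ℝ => K * (C * √ε) * M0) (𝓝 0) (𝓝 (K * (C * √0) * M0)) :=
      Continuous.tendsto (by fun_prop) 0
    simp only [Real.sqrt_zero, mul_zero, zero_mul] at this
    exact this.mono_left nhdsWithin_le_nhds
  filter_upwards [self_mem_nhdsWithin, hlim.eventually (gt_mem_nhds (half_pos hδ)),
    Ioo_mem_nhdsGT one_pos] with ε hε hεs hε1
  have hε0 : 0 < ε := hε
  have hs : 0 < √ε := Real.sqrt_pos.2 hε0
  have hss : √ε * √ε = ε := Real.mul_self_sqrt hε0.le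
  rw [dist_zero_right]
  set q : ℝ → ℝ := fun s => K * η * (Real.exp (-s ^ 2) * ((1 + s ^ 2) * |s|)) +
    K * (C * √ε) * (Real.exp (-s ^ 2) * (1 + s ^ 2))
  have hq : Integrable q := (hi1.const_mul _).add (hi0.const_mul _)
  have hqi : ∫ t : ℝ, √ε * q (√ε * t) = K * η * M1 + K * (C * √ε) * M0 := by
    rw [integral_const_mul, Measure.integral_comp_mul_left, smul_eq_mul, abs_of_pos (inv_pos.2 hs),
      mul_inv_cancel_left₀ hs.ne', integral_add (hi1.const_mul _) (hi0.const_mul _),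
      integral_const_mul, integral_const_mul]
  refine (norm_integral_le_of_norm_le ((hq.comp_mul_left' hs.ne').const_mul √ε)
    (Eventually.of_forall fun t => ?_)).trans_lt (by rw [hqi]; linarith)
  rw [norm_mul, norm_mul, Real.norm_of_nonneg (Real.exp_nonneg _), norm_pow, norm_norm]
  calc _ ≤ Real.exp (-ε * t ^ 2) * (K * (ε + ε ^ 2 * t ^ 2) * (η * |t| + C)) := by
        gcongr
        · exact abs_exp_mul_cos_sub_one_le hε0 hε1.2.le
        · exact hC t
    _ = _ := by
      simp only [q]
      rw [mul_pow, sq √ε, hss, abs_mul, abs_of_pos hs, neg_mul]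
      linear_combination (-(Real.exp (-(ε * t ^ 2)) * K * (1 + ε * t ^ 2) * (η * |t| + C))) * hss

/-- After the shift both lines contribute the same real-axis mean of |Ψ|², up to errors that tend to
0. These means cancel in the difference although each may diverge as ε ↓ 0. -/
lemma SuperexpDecay.tendsto_gaussian_im_sq {h : ℝ → ℝ} (hh : SuperexpDecay h)
    (h2 : MemLp (fun u => u / (1 + |u|) * h u) 2) {a b l : ℝ}
    (hl : Tendsto (fun T : ℝ => ∫ t in (-T)..T, (‖sineTransform h (t + b * Complex.I)‖ ^ 2 -
      ‖sineTransform h (t + a * Complex.I)‖ ^ 2)) atTop (𝓝 l)) :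
    Tendsto (fun ε : ℝ =>
      2 * (∫ t : ℝ, Real.exp (-ε * t ^ 2) * (sineTransform h (t + b * Complex.I)).im ^ 2) -
      2 * ∫ t : ℝ, Real.exp (-ε * t ^ 2) * (sineTransform h (t + a * Complex.I)).im ^ 2)
      (𝓝[>] 0) (𝓝 l) := by
  have hc := hh.differentiable_sineTransform.continuous
  have hbd : ∀ c : ℝ, ∃ A, 0 ≤ A ∧ ∀ t : ℝ,
      ‖sineTransform h (t + c * Complex.I)‖ ^ 2 ≤ A * (1 + t ^ 2) := fun c => by
    obtain ⟨A, hA, h3⟩ := hh.exists_norm_sq_sineTransform_le c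
    exact ⟨A, hA, fun t => h3 t c le_rfl⟩
  obtain ⟨A, hA0, hA⟩ := hbd a
  obtain ⟨B, hB0, hB⟩ := hbd b
  obtain ⟨D, hD0, hD⟩ := hbd 0
  simp only [Complex.ofReal_zero, zero_mul, add_zero] at hD
  have h3 := tendsto_gaussian_mean (P := fun t : ℝ => ‖sineTransform h (t + b * Complex.I)‖ ^ 2 -
      ‖sineTransform h (t + a * Complex.I)‖ ^ 2) (by fun_prop) (B := B + A) (fun t => by
        rw [add_mul]
        refine (abs_sub _ _).trans (add_le_add ?_ ?_)
        · rw [abs_of_nonneg (sq_nonneg _)]; exact hB t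
        · rw [abs_of_nonneg (sq_nonneg _)]; exact hA t) hl
  have h4 := (h3.sub (hh.tendsto_gaussian_error h2 b)).add (hh.tendsto_gaussian_error h2 a)
  rw [sub_zero, add_zero] at h4
  refine h4.congr' ?_
  filter_upwards [self_mem_nhdsWithin] with ε hε
  have hε0 : 0 < ε := hε
  have hi : ∀ (c : ℝ) (Q : ℝ), (∀ t : ℝ, ‖sineTransform h (t + c * Complex.I)‖ ^ 2 ≤
      Q * (1 + t ^ 2)) → Integrable fun t : ℝ =>
        Real.exp (-ε * t ^ 2) * ‖sineTransform h (t + c * Complex.I)‖ ^ 2 := fun c Q hQ =>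
    integrable_gaussian_mul_of_le_real (by fun_prop) (A := Q) (fun t => by
      rw [abs_of_nonneg (sq_nonneg _)]; exact hQ t) hε0
  have herr : ∀ c : ℝ, ∫ t : ℝ, Real.exp (-ε * t ^ 2) *
      ((Real.exp (ε * c ^ 2) * Real.cos (2 * ε * c * t) - 1) * ‖sineTransform h t‖ ^ 2) =
      (∫ t : ℝ, Real.exp (-ε * t ^ 2) * (Real.exp (ε * c ^ 2) * Real.cos (2 * ε * c * t)) *
        ‖sineTransform h t‖ ^ 2) - ∫ t : ℝ, Real.exp (-ε * t ^ 2) * ‖sineTransform h t‖ ^ 2 := by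
    intro c
    rw [← integral_sub]
    · congr 1; ext t; ring
    · have := integrable_gaussian_mul_of_le_real
        (P := fun t : ℝ => (Real.exp (ε * c ^ 2) * Real.cos (2 * ε * c * t)) *
          ‖sineTransform h t‖ ^ 2) (by fun_prop) (A := Real.exp (ε * c ^ 2) * D) (fun t => by
          rw [abs_mul, abs_mul, abs_of_pos (Real.exp_pos _), abs_of_nonneg (sq_nonneg ‖_‖),
            mul_assoc (Real.exp _) D]
          have := Real.abs_cos_le_one (2 * ε * c * t)
          calc _ ≤ Real.exp (ε * c ^ 2) * 1 * (D * (1 + t ^ 2)) := by gcongr; exact hD t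
            _ = _ := by ring) hε0
      simpa only [mul_assoc] using this
    · have := hi 0 D (by simpa using hD)
      simpa using this
  rw [herr, herr]
  have e1 := hh.integral_gaussian_mul_norm_sq a hε0
  have e2 := hh.integral_gaussian_mul_norm_sq b hε0
  have e3 : ∫ t : ℝ, Real.exp (-ε * t ^ 2) * (‖sineTransform h (t + b * Complex.I)‖ ^ 2 -
      ‖sineTransform h (t + a * Complex.I)‖ ^ 2) =
      (∫ t : ℝ, Real.exp (-ε * t ^ 2) * ‖sineTransform h (t + b * Complex.I)‖ ^ 2) -
      ∫ t : ℝ, Real.exp (-ε * t ^ 2) * ‖sineTransform h (t + a * Complex.I)‖ ^ 2 := by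
    rw [← integral_sub (hi b B hB) (hi a A hA)]
    congr 1; ext t; ring
  rw [e3, e1, e2]
  ring

/-- Fatou's lemma along ε = 1/(n+1). -/
lemma integrable_of_gaussian_bounded {f : ℝ → ℝ} (hf0 : 0 ≤ f) {l : ℝ}
    (hi : ∀ ε : ℝ, 0 < ε → Integrable fun t => Real.exp (-ε * t ^ 2) * f t)
    (hl : Tendsto (fun ε : ℝ => ∫ t, Real.exp (-ε * t ^ 2) * f t) (𝓝[>] 0) (𝓝 l)) :
    Integrable f := by
  have hu : Tendsto (fun n : ℕ => 1 / ((n : ℝ) + 1)) atTop (𝓝[>] 0) :=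
    tendsto_nhdsWithin_iff.2 ⟨tendsto_one_div_add_atTop_nhds_zero_nat,
      Eventually.of_forall fun n => by simp only [Set.mem_Ioi]; positivity⟩
  refine integrable_of_tendsto (G := fun n t => Real.exp (-(1 / ((n : ℝ) + 1)) * t ^ 2) * f t)
    (Eventually.of_forall fun t => ?_) (fun n => (hi _ (by positivity)).1) ?_
  · have h1 : Tendsto (fun ε : ℝ => Real.exp (-ε * t ^ 2) * f t) (𝓝 0)
        (𝓝 (Real.exp (-0 * t ^ 2) * f t)) := Continuous.tendsto (by fun_prop) 0
    simp only [neg_zero, zero_mul, Real.exp_zero, one_mul] at h1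
    exact (h1.mono_left nhdsWithin_le_nhds).comp hu
  · have h1 := (ENNReal.tendsto_ofReal (hl.comp hu)).liminf_eq
    have h2 : ∀ n : ℕ, ∫⁻ t, ‖Real.exp (-(1 / ((n : ℝ) + 1)) * t ^ 2) * f t‖ₑ =
        ENNReal.ofReal (∫ t, Real.exp (-(1 / ((n : ℝ) + 1)) * t ^ 2) * f t) := fun n => by
      rw [ofReal_integral_eq_lintegral_ofReal (hi _ (by positivity))
        (Eventually.of_forall fun t => mul_nonneg (Real.exp_nonneg _) (hf0 t))]
      congr 1; ext t
      exact Real.enorm_of_nonneg (mul_nonneg (Real.exp_nonneg _) (hf0 t))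
    simp_rw [h2]
    exact h1 ▸ ENNReal.ofReal_ne_top

lemma tendsto_gaussian_integral {f : ℝ → ℝ} (hf : Integrable f) :
    Tendsto (fun ε : ℝ => ∫ t, Real.exp (-ε * t ^ 2) * f t) (𝓝[>] 0) (𝓝 (∫ t, f t)) := by
  refine tendsto_integral_filter_of_dominated_convergence (fun t => ‖f t‖)
    (Eventually.of_forall fun ε => AEStronglyMeasurable.mul (by fun_prop) hf.1) ?_ hf.norm
    (Eventually.of_forall fun t => ?_)
  · filter_upwards [self_mem_nhdsWithin] with ε hε
    refine Eventually.of_forall fun t => ?_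
    have hε0 : 0 < ε := hε
    rw [norm_mul, Real.norm_of_nonneg (Real.exp_nonneg _)]
    refine mul_le_of_le_one_left (norm_nonneg _) (Real.exp_le_one_iff.2 ?_)
    nlinarith [sq_nonneg t]
  · have h1 : Tendsto (fun ε : ℝ => Real.exp (-ε * t ^ 2) * f t) (𝓝 0)
        (𝓝 (Real.exp (-0 * t ^ 2) * f t)) := Continuous.tendsto (by fun_prop) 0
    simp only [neg_zero, zero_mul, Real.exp_zero, one_mul] at h1
    exact h1.mono_left nhdsWithin_le_nhds

lemma SuperexpDecay.integrable_gaussian_im_sq {h : ℝ → ℝ} (hh : SuperexpDecay h) (b : ℝ)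
    {ε : ℝ} (hε : 0 < ε) : Integrable fun t : ℝ =>
      Real.exp (-ε * t ^ 2) * (sineTransform h (t + b * Complex.I)).im ^ 2 := by
  obtain ⟨A, hA, h3⟩ := hh.exists_norm_sq_sineTransform_le b
  have hc := hh.differentiable_sineTransform.continuous
  refine integrable_gaussian_mul_of_le_real (by fun_prop) (A := A) (fun t => ?_) hε
  rw [abs_of_nonneg (sq_nonneg _), ← sq_abs]
  refine le_trans ?_ (h3 t b le_rfl)
  gcongr
  exact Complex.abs_im_le_norm _

lemma SuperexpDecay.integral_im_sq {h : ℝ → ℝ} (hh : SuperexpDecay h) (hodd : ∀ u, h (-u) = -h u)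
    {b : ℝ} (hb : MemLp (fun u => Real.sinh (2 * b * u) * h u) 2) :
    Integrable (fun t : ℝ => (sineTransform h (t + b * Complex.I)).im ^ 2) ∧
      ∫ t : ℝ, (sineTransform h (t + b * Complex.I)).im ^ 2 =
        Real.pi * ∫ u, (Real.sinh (2 * b * u) * h u) ^ 2 := by
  have heven : ∀ u, Real.sinh (2 * b * -u) * h (-u) = Real.sinh (2 * b * u) * h u := fun u => by
    rw [hodd, mul_neg (2 * b), Real.sinh_neg, neg_mul_neg]
  simp_rw [hh.im_sineTransform]
  refine ⟨?_, integral_sq_cos_transform (hh.integrable_sinh _) heven hb⟩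
  exact ((memLp_two_cos_iff (hh.integrable_sinh (2 * b)) heven).2 hb).integrable_sq

/-- Comparison is with the real axis, where Im Ψ = 0: the limit then bounds the Gaussian means of
(Im Ψ(t+ib))². Fatou makes this function integrable, and Plancherel in the reverse direction carries
square-integrability back to the density. -/
lemma SuperexpDecay.memLp_two_sinh_mul {h : ℝ → ℝ} (hh : SuperexpDecay h)
    (hodd : ∀ u, h (-u) = -h u) (h2 : MemLp (fun u => u / (1 + |u|) * h u) 2) {b l : ℝ}
    (hl : Tendsto (fun T : ℝ => ∫ t in (-T)..T, (‖sineTransform h (t + b * Complex.I)‖ ^ 2 -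
      ‖sineTransform h t‖ ^ 2)) atTop (𝓝 l)) :
    MemLp (fun u => Real.sinh (2 * b * u) * h u) 2 := by
  have heven : ∀ u, Real.sinh (2 * b * -u) * h (-u) = Real.sinh (2 * b * u) * h u := fun u => by
    rw [hodd, mul_neg (2 * b), Real.sinh_neg, neg_mul_neg]
  have h3 := hh.tendsto_gaussian_im_sq h2 (a := 0) (b := b) (l := l) (by simpa using hl)
  have hc := hh.differentiable_sineTransform.continuous
  simp only [Complex.ofReal_zero, zero_mul, add_zero, im_sineTransform_ofReal, ne_eq,
    OfNat.ofNat_ne_zero, not_false_eq_true, zero_pow, mul_zero, integral_zero, sub_zero] at h3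
  have h4 := integrable_of_gaussian_bounded
    (f := fun t : ℝ => (sineTransform h (t + b * Complex.I)).im ^ 2)
    (fun t => sq_nonneg _) (fun ε hε => hh.integrable_gaussian_im_sq b hε)
    (l := l / 2) (by
      have := h3.div_const 2
      simpa only [mul_div_cancel_left₀ _ (two_ne_zero' ℝ)] using this)
  rw [← memLp_two_cos_iff (hh.integrable_sinh (2 * b)) heven]
  simp_rw [← hh.im_sineTransform]
  exact (memLp_two_iff_integrable_sq (Continuous.aestronglyMeasurable (by fun_prop))).2 h4

lemma sinh_sq_sub_sinh_sq (a b : ℝ) :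
    Real.sinh b ^ 2 - Real.sinh a ^ 2 = Real.sinh (b + a) * Real.sinh (b - a) := by
  rw [Real.sinh_add, Real.sinh_sub]
  have h1 := Real.cosh_sq a
  have h2 := Real.cosh_sq b
  linear_combination Real.sinh a ^ 2 * h2 - Real.sinh b ^ 2 * h1

/-- With both imaginary parts in L², the limit is 2π times the difference of the norms ∫ sinh²(2bu)
h² and ∫ sinh²(2au) h², and the difference of squares factorizes. -/
lemma SuperexpDecay.limit_eq {h : ℝ → ℝ} (hh : SuperexpDecay h) (hodd : ∀ u, h (-u) = -h u)
    (h2 : MemLp (fun u => u / (1 + |u|) * h u) 2) {a b l : ℝ}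
    (ha : MemLp (fun u => Real.sinh (2 * a * u) * h u) 2)
    (hb : MemLp (fun u => Real.sinh (2 * b * u) * h u) 2)
    (hl : Tendsto (fun T : ℝ => ∫ t in (-T)..T, (‖sineTransform h (t + b * Complex.I)‖ ^ 2 -
      ‖sineTransform h (t + a * Complex.I)‖ ^ 2)) atTop (𝓝 l)) :
    l = 2 * Real.pi *
      ∫ u, Real.sinh (2 * (b + a) * u) * Real.sinh (2 * (b - a) * u) * h u ^ 2 := by
  obtain ⟨ia, ea⟩ := hh.integral_im_sq hodd ha
  obtain ⟨ib, eb⟩ := hh.integral_im_sq hodd hb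
  have h3 := tendsto_nhds_unique (hh.tendsto_gaussian_im_sq h2 hl)
    (((tendsto_gaussian_integral ib).const_mul 2).sub ((tendsto_gaussian_integral ia).const_mul 2))
  rw [h3, ea, eb, ← mul_assoc, ← mul_assoc, ← mul_sub,
    ← integral_sub hb.integrable_sq ha.integrable_sq]
  congr 2; ext u
  have := sinh_sq_sub_sinh_sq (2 * a * u) (2 * b * u)
  rw [show 2 * (b + a) * u = 2 * b * u + 2 * a * u by ring,
    show 2 * (b - a) * u = 2 * b * u - 2 * a * u by ring, ← this]
  ring

/-! ### The mass-one equation in terms of the spectral density -/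

/-- `|Ψ(t + i(y+v))|² - |Ψ(t + i(y-v))|²` for the sine transform `Ψ` of `h`. -/
def lineDiff (h : ℝ → ℝ) (y v t : ℝ) : ℝ :=
  ‖sineTransform h (t + (y + v : ℝ) * Complex.I)‖ ^ 2 -
    ‖sineTransform h (t + (y - v : ℝ) * Complex.I)‖ ^ 2

lemma norm_sineTransform_neg_add (h : ℝ → ℝ) (t a : ℝ) :
    ‖sineTransform h (-t + a * Complex.I)‖ = ‖sineTransform h (t + a * Complex.I)‖ := by
  have h1 : -(t : ℂ) + a * Complex.I = -conj (t + a * Complex.I) := by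
    simp; ring
  rw [h1, sineTransform_neg, sineTransform_conj, norm_neg, RCLike.norm_conj]

lemma lineDiff_neg (h : ℝ → ℝ) (y v t : ℝ) : lineDiff h y v (-t) = lineDiff h y v t := by
  rw [lineDiff, lineDiff, Complex.ofReal_neg, norm_sineTransform_neg_add,
    norm_sineTransform_neg_add]

/-- For real h, Ψ(z̄) is the conjugate of Ψ(z), so the two products in the Berezin kernel are
|Ψ(z-w)|² and |Ψ(z-w̄)|². By oddness the modulus is unchanged under t ↦ -t, which allows t = Re w -
Re z. -/
lemma berezin_sineTransform (h : ℝ → ℝ) {z : ℂ} (hz : z.im ≠ 0) (w : ℂ) :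
    berezin (translationKernel (sineTransform h)) z w =
      ((2 * w.im * Real.exp (-4 * w.im ^ 2) / sinhTransform h z.im *
        lineDiff h z.im w.im (w.re - z.re) : ℝ) : ℂ) := by
  rw [berezin_translationKernel (sineTransform_neg h) hz, sineTransform_I_mul]
  have h1 : conj z - conj w = conj (z - w) := (map_sub _ _ _).symm
  have h2 : conj z - w = conj (z - conj w) := by rw [map_sub, Complex.conj_conj]
  have h3 : z - w = -((w.re - z.re : ℝ) : ℂ) + (z.im - w.im : ℝ) * Complex.I := by
    apply Complex.ext <;> simp
  have h4 : z - conj w = -((w.re - z.re : ℝ) : ℂ) + (z.im + w.im : ℝ) * Complex.I := by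
    apply Complex.ext <;> simp
  have h5 : ∀ ζ : ℂ, sineTransform h ζ * sineTransform h (conj ζ) =
      ((‖sineTransform h ζ‖ ^ 2 : ℝ) : ℂ) := fun ζ => by
    rw [sineTransform_conj, Complex.mul_conj, Complex.normSq_eq_norm_sq]
  rw [h1, h2, h5, h5, h3, h4, norm_sineTransform_neg_add, norm_sineTransform_neg_add, lineDiff]
  have h6 : -2 * Complex.I * (w.im : ℂ) * Complex.exp (-4 * (w.im : ℂ) ^ 2) /
      (Complex.I * (sinhTransform h z.im : ℂ)) =
      -(2 * (w.im : ℂ) * Complex.exp (-4 * (w.im : ℂ) ^ 2) / (sinhTransform h z.im : ℂ)) := by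
    rw [← mul_div_mul_left _ (sinhTransform h z.im : ℂ) Complex.I_ne_zero]
    ring
  rw [h6]
  push_cast
  ring

lemma onePoint_sineTransform (h : ℝ → ℝ) (z : ℂ) :
    onePoint (translationKernel (sineTransform h)) z =
      ((2 * z.im * Real.exp (-4 * z.im ^ 2) * sinhTransform h z.im : ℝ) : ℂ) := by
  rw [onePoint_translationKernel (sineTransform_neg h), sineTransform_I_mul]
  push_cast
  linear_combination (-2 * (z.im : ℂ) * Complex.exp (-4 * (z.im : ℂ) ^ 2) *
    sinhTransform h z.im) * Complex.I_sq

lemma sinhTransform_neg (h : ℝ → ℝ) (y : ℝ) : sinhTransform h (-y) = -sinhTransform h y := by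
  rw [sinhTransform, sinhTransform, ← integral_neg]
  congr 1; ext u
  rw [mul_neg, neg_mul, Real.sinh_neg, neg_mul]

lemma gaussian_exp_linear (k : ℝ) :
    Integrable (fun v : ℝ => v * Real.exp (-4 * v ^ 2 + 2 * k * v)) ∧
      ∫ v : ℝ, v * Real.exp (-4 * v ^ 2 + 2 * k * v) =
        √Real.pi / 8 * (k * Real.exp (k ^ 2 / 4)) := by
  have e : ∀ v : ℝ, v * Real.exp (-4 * v ^ 2 + 2 * k * v) = Real.exp (k ^ 2 / 4) *
      ((v - k / 4) * Real.exp (-4 * (v - k / 4) ^ 2) +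
        k / 4 * Real.exp (-4 * (v - k / 4) ^ 2)) := fun v => by
    rw [← add_mul, sub_add_cancel, mul_left_comm, ← Real.exp_add]
    congr 2; ring
  have i1 : Integrable fun v : ℝ => v * Real.exp (-4 * v ^ 2) :=
    integrable_mul_exp_neg_mul_sq (by norm_num)
  have i2 : Integrable fun v : ℝ => k / 4 * Real.exp (-4 * v ^ 2) :=
    (integrable_exp_neg_mul_sq (by norm_num)).const_mul _
  simp_rw [e]
  refine ⟨((i1.add i2).comp_sub_right (k / 4)).const_mul _, ?_⟩
  rw [integral_const_mul, integral_sub_right_eq_self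
    (fun v => v * Real.exp (-4 * v ^ 2) + k / 4 * Real.exp (-4 * v ^ 2)) (k / 4),
    integral_add i1 i2, integral_const_mul, integral_gaussian]
  have h1 : ∫ v : ℝ, v * Real.exp (-4 * v ^ 2) = 0 := by
    have h2 : ∫ v : ℝ, v * Real.exp (-4 * v ^ 2) = -∫ v : ℝ, v * Real.exp (-4 * v ^ 2) := by
      rw [← integral_neg, ← integral_neg_eq_self]
      congr 1; ext v; rw [neg_sq]; ring
    linarith
  have h2 : √(Real.pi / 4) = √Real.pi / 2 := by
    rw [Real.sqrt_div Real.pi_pos.le, show (4 : ℝ) = 2 ^ 2 by norm_num, Real.sqrt_sq two_pos.le]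
  rw [h1, h2]; ring

lemma gaussian_sinh (k : ℝ) :
    Integrable (fun v : ℝ => v * Real.exp (-4 * v ^ 2) * Real.sinh (2 * k * v)) ∧
      ∫ v : ℝ, v * Real.exp (-4 * v ^ 2) * Real.sinh (2 * k * v) =
        √Real.pi / 8 * (k * Real.exp (k ^ 2 / 4)) := by
  obtain ⟨i1, e1⟩ := gaussian_exp_linear k
  obtain ⟨i2, e2⟩ := gaussian_exp_linear (-k)
  have e : ∀ v : ℝ, v * Real.exp (-4 * v ^ 2) * Real.sinh (2 * k * v) =
      (v * Real.exp (-4 * v ^ 2 + 2 * k * v) - v * Real.exp (-4 * v ^ 2 + 2 * -k * v)) / 2 :=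
    fun v => by
      rw [Real.sinh_eq, Real.exp_add, Real.exp_add, mul_neg, neg_mul]; ring_nf
  simp_rw [e]
  refine ⟨(i1.sub i2).div_const 2, ?_⟩
  rw [integral_div, integral_sub i1 i2, e1, e2, neg_sq]; ring

section MassOne

variable {h : ℝ → ℝ}

/-- What the mass-one equation says about the limits of the means of `lineDiff`. -/
lemma exists_limits_of_massOne (hm : MassOneEquation (translationKernel (sineTransform h)))
    {y : ℝ} (hy : 0 < y) :
    sinhTransform h y ≠ 0 ∧ ∃ l : ℝ → ℝ,
      (∀ v : ℝ, v ≠ 0 → Tendsto (fun T : ℝ => ∫ t in (-T)..T, lineDiff h y v t) atTop (𝓝 (l v))) ∧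
      Integrable (fun v => v * Real.exp (-4 * v ^ 2) * l v) ∧
      sinhTransform h y = 2 / Real.pi * ∫ v, v * Real.exp (-4 * v ^ 2) * l v := by
  have hz : (⟨0, y⟩ : ℂ).im ≠ 0 := hy.ne'
  obtain ⟨hR, b, hb, hbi, hb1⟩ := hm ⟨0, y⟩ hz
  have hS : sinhTransform h y ≠ 0 := fun h0 => hR (by rw [onePoint_sineTransform]; simp [h0])
  set S := sinhTransform h y with hSdef
  have hb' : ∀ v : ℝ, Tendsto (fun T : ℝ => 2 * v * Real.exp (-4 * v ^ 2) / S *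
      ∫ t in (-T)..T, lineDiff h y v t) atTop (𝓝 (b v).re) ∧ (b v).im = 0 := fun v => by
    have h1 : ∀ T : ℝ, ∫ x in (-T)..T, berezin (translationKernel (sineTransform h)) ⟨0, y⟩ ⟨x, v⟩ =
        ((2 * v * Real.exp (-4 * v ^ 2) / S * ∫ t in (-T)..T, lineDiff h y v t : ℝ) : ℂ) := by
      intro T
      rw [← intervalIntegral.integral_const_mul, ← intervalIntegral.integral_ofReal]
      refine intervalIntegral.integral_congr fun x _ => ?_
      rw [berezin_sineTransform h hz, sub_zero]
    have h2 := hb v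
    simp_rw [h1] at h2
    refine ⟨?_, ?_⟩
    · have := (Complex.continuous_re.tendsto _).comp h2
      simpa only [Function.comp_def, Complex.ofReal_re] using this
    · have := (Complex.continuous_im.tendsto _).comp h2
      simp only [Function.comp_def, Complex.ofReal_im] at this
      exact (tendsto_const_nhds_iff.1 this).symm
  -- At v = 0 the prefactor vanishes and the equation carries no information about the limit, hence
  -- the exclusion of v = 0, a null set.
  refine ⟨hS, fun v => (b v).re / (2 * v * Real.exp (-4 * v ^ 2) / S), fun v hv => ?_, ?_⟩
  · have hc : 2 * v * Real.exp (-4 * v ^ 2) / S ≠ 0 := by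
      have := Real.exp_ne_zero (-4 * v ^ 2)
      positivity
    have := (hb' v).1.div_const (2 * v * Real.exp (-4 * v ^ 2) / S)
    simpa only [mul_div_cancel_left₀ _ hc] using this
  · have e : (fun v => v * Real.exp (-4 * v ^ 2) *
        ((b v).re / (2 * v * Real.exp (-4 * v ^ 2) / S))) =ᵐ[volume] fun v => S / 2 * (b v).re := by
      filter_upwards [compl_mem_ae_iff.2 (measure_singleton (0 : ℝ))] with v hv
      have hv0 : v ≠ 0 := hv
      have := Real.exp_ne_zero (-4 * v ^ 2)
      field_simp
    refine ⟨(hbi.re.const_mul (S / 2)).congr e.symm, ?_⟩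
    rw [integral_congr_ae e, integral_const_mul]
    have h3 : (∫ v, b v) = Real.pi := by
      have := Complex.ofReal_ne_zero.2 Real.pi_ne_zero
      field_simp at hb1
      exact hb1
    have h4 : ∫ v, (b v).re = Real.pi := by
      have := integral_re hbi
      rw [h3] at this
      simpa using this
    rw [h4]
    have := Real.pi_ne_zero
    field_simp

lemma SuperexpDecay.memLp_two_sinh_of_massOne (hh : SuperexpDecay h) (hodd : ∀ u, h (-u) = -h u)
    (h2 : MemLp (fun u => u / (1 + |u|) * h u) 2)
    (hm : MassOneEquation (translationKernel (sineTransform h))) (b : ℝ) :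
    MemLp (fun u => Real.sinh (2 * b * u) * h u) 2 := by
  have hpos : ∀ b : ℝ, 0 < b → MemLp (fun u => Real.sinh (2 * b * u) * h u) 2 := fun b hb => by
    -- Taking y = v = b/2 compares the line at height y + v = b with the real axis y - v = 0.
    obtain ⟨_, l, hl, _⟩ := exists_limits_of_massOne hm (half_pos hb)
    refine hh.memLp_two_sinh_mul hodd h2 (l := l (b / 2)) ?_
    simpa [lineDiff] using hl (b / 2) (half_pos hb).ne'
  rcases lt_trichotomy b 0 with hb | rfl | hb
  · refine (hpos (-b) (by linarith)).neg.congr_norm ?_ (Eventually.of_forall fun u => ?_)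
    · exact AEStronglyMeasurable.mul (by fun_prop) hh.aestronglyMeasurable
    · simp [Real.sinh_neg]
  · simp
  · exact hpos b hb

/-- Insert the limits 2π ∫ sinh(4yu) sinh(4vu) h² du into the mass-one equation and integrate over v
first: ∫ v e^{-4v²} sinh(4uv) dv = (√π/4) u e^{u²}. -/
lemma SuperexpDecay.sinhTransform_eq_of_massOne (hh : SuperexpDecay h)
    (hodd : ∀ u, h (-u) = -h u) (h2 : MemLp (fun u => u / (1 + |u|) * h u) 2)
    (hm : MassOneEquation (translationKernel (sineTransform h))) {y : ℝ} (hy : 0 < y) :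
    Integrable (fun u => Real.sinh (4 * y * u) * (√Real.pi * u * Real.exp (u ^ 2) * h u ^ 2)) ∧
      sinhTransform h y =
        ∫ u, Real.sinh (4 * y * u) * (√Real.pi * u * Real.exp (u ^ 2) * h u ^ 2) := by
  have hL := hh.memLp_two_sinh_of_massOne hodd h2 hm
  obtain ⟨hS, l, hl, hli, hl1⟩ := exists_limits_of_massOne hm hy
  have hmeas := hh.aestronglyMeasurable
  set g : ℝ → ℝ → ℝ := fun v u =>
    v * Real.exp (-4 * v ^ 2) * Real.sinh (2 * (2 * u) * v) * (Real.sinh (4 * y * u) * h u ^ 2)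
  have hint : ∀ v : ℝ,
      Integrable fun u => Real.sinh (4 * y * u) * Real.sinh (4 * v * u) * h u ^ 2 := fun v => by
    refine ((hL (y + v)).integrable_sq.sub (hL (y - v)).integrable_sq).congr
      (Eventually.of_forall fun u => ?_)
    have := sinh_sq_sub_sinh_sq (2 * (y - v) * u) (2 * (y + v) * u)
    rw [show 2 * (y + v) * u + 2 * (y - v) * u = 4 * y * u by ring,
      show 2 * (y + v) * u - 2 * (y - v) * u = 4 * v * u by ring] at this
    simp only [Pi.sub_apply]
    rw [← this]; ring
  have hlv : ∀ v : ℝ, v ≠ 0 → l v = 2 * Real.pi *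
      ∫ u, Real.sinh (4 * y * u) * Real.sinh (4 * v * u) * h u ^ 2 := fun v hv => by
    have := hh.limit_eq hodd h2 (hL (y - v)) (hL (y + v)) (hl v hv)
    rw [this]
    congr 2; ext u
    ring_nf
  have hgv : ∀ v, Integrable (g v) ∧ ∫ u, g v u = v * Real.exp (-4 * v ^ 2) *
      ∫ u, Real.sinh (4 * y * u) * Real.sinh (4 * v * u) * h u ^ 2 := fun v => by
    have e : g v = fun u => v * Real.exp (-4 * v ^ 2) *
        (Real.sinh (4 * y * u) * Real.sinh (4 * v * u) * h u ^ 2) := by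
      ext u
      simp only [g]
      rw [show 2 * (2 * u) * v = 4 * v * u by ring]; ring
    rw [e]
    exact ⟨(hint v).const_mul _, integral_const_mul _ _⟩
  -- For y > 0 both v sinh(4uv) and sinh(4yu) have the sign of u, so the integrand is nonnegative.
  -- Integrability on the product space then follows from that of the iterated integral given by the
  -- mass-one equation.
  have hg0 : ∀ v u, 0 ≤ g v u := fun v u => by
    have h3 : g v u = Real.exp (-4 * v ^ 2) * h u ^ 2 *
        ((v * Real.sinh (2 * (2 * u) * v)) * Real.sinh (4 * y * u)) := by
      simp only [g]; ring
    rw [h3]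
    refine mul_nonneg (by positivity) ?_
    rcases le_total 0 u with hu | hu
    · refine mul_nonneg ?_ (Real.sinh_nonneg_iff.2 (by positivity))
      rcases le_total 0 v with hv | hv
      · exact mul_nonneg hv (Real.sinh_nonneg_iff.2 (by positivity))
      · refine mul_nonneg_of_nonpos_of_nonpos hv (Real.sinh_nonpos_iff.2 ?_)
        exact mul_nonpos_of_nonneg_of_nonpos (by positivity) hv
    · refine mul_nonneg_of_nonpos_of_nonpos ?_ (Real.sinh_nonpos_iff.2 ?_)
      · rcases le_total 0 v with hv | hv
        · refine mul_nonpos_of_nonneg_of_nonpos hv (Real.sinh_nonpos_iff.2 ?_)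
          nlinarith
        · refine mul_nonpos_of_nonpos_of_nonneg hv (Real.sinh_nonneg_iff.2 ?_)
          nlinarith
      · nlinarith
  have hli' : (fun v => v * Real.exp (-4 * v ^ 2) * l v) =ᵐ[volume]
      fun v => 2 * Real.pi * ∫ u, g v u := by
    filter_upwards [compl_mem_ae_iff.2 (measure_singleton (0 : ℝ))] with v hv
    rw [hlv v hv, (hgv v).2]; ring
  have hi1 : Integrable fun v => ∫ u, g v u := by
    have := (hli.congr hli').const_mul (2 * Real.pi)⁻¹
    refine this.congr (Eventually.of_forall fun v => ?_)
    exact inv_mul_cancel_left₀ (by positivity) _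
  have hprod : Integrable (Function.uncurry g) (volume.prod volume) := by
    refine (integrable_prod_iff ?_).2 ⟨Eventually.of_forall fun v => (hgv v).1, ?_⟩
    · exact AEStronglyMeasurable.mul (by fun_prop)
        (((by fun_prop : Continuous fun u : ℝ => Real.sinh (4 * y * u)).aestronglyMeasurable.mul
          (hmeas.pow 2)).comp_snd)
    · refine hi1.congr (Eventually.of_forall fun v => ?_)
      refine integral_congr_ae (Eventually.of_forall fun u => ?_)
      exact (Real.norm_of_nonneg (hg0 v u)).symm
  have hinner : ∀ u, ∫ v, g v u = 1 / 4 *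
      (Real.sinh (4 * y * u) * (√Real.pi * u * Real.exp (u ^ 2) * h u ^ 2)) := fun u => by
    simp only [g]
    rw [integral_mul_const, (gaussian_sinh (2 * u)).2, show (2 * u) ^ 2 / 4 = u ^ 2 by ring]
    ring
  have hi2 := hprod.integral_prod_right
  simp only [Function.uncurry_apply_pair, hinner] at hi2
  refine ⟨(hi2.const_mul 4).congr (Eventually.of_forall fun u => ?_), ?_⟩
  · simp only; ring
  · rw [hl1, integral_congr_ae hli', integral_const_mul, integral_integral_swap hprod]
    simp_rw [hinner]
    rw [integral_const_mul]
    have key : ∀ X : ℝ, 2 / Real.pi * (2 * Real.pi * (1 / 4 * X)) = X := fun X => by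
      have := Real.pi_ne_zero
      field_simp
      norm_num
    exact key _

/-- The odd function d = h - √π u e^{u²} h² has vanishing sinh transform, hence is zero almost
everywhere; the two alternatives are the roots of this quadratic equation. -/
lemma SuperexpDecay.eq_of_massOne (hh : SuperexpDecay h)
    (hodd : ∀ u, h (-u) = -h u) (h2 : MemLp (fun u => u / (1 + |u|) * h u) 2)
    (hm : MassOneEquation (translationKernel (sineTransform h))) :
    ∀ᵐ u, h u = 0 ∨ h u = Real.exp (-u ^ 2) / (√Real.pi * u) := by
  set d : ℝ → ℝ := fun u => h u - √Real.pi * u * Real.exp (u ^ 2) * h u ^ 2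
  have hmeas := hh.aestronglyMeasurable
  have hdodd : ∀ u, d (-u) = -d u := fun u => by
    simp only [d, hodd, neg_sq]; ring
  have hdm : AEStronglyMeasurable d :=
    hmeas.sub (AEStronglyMeasurable.mul (by fun_prop) (hmeas.pow 2))
  have hipos : ∀ b : ℝ, 0 < b → Integrable fun u => Real.sinh (b * u) * d u := fun b hb => by
    have h3 := (hh.sinhTransform_eq_of_massOne hodd h2 hm (y := b / 4) (by positivity)).1
    rw [mul_div_cancel₀ b (four_ne_zero)] at h3
    refine ((hh.integrable_sinh b).sub h3).congr (Eventually.of_forall fun u => ?_)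
    simp only [Pi.sub_apply, d]; ring
  have hi : ∀ b : ℝ, Integrable fun u => Real.sinh (b * u) * d u := fun b => by
    rcases lt_trichotomy b 0 with hb | rfl | hb
    · refine (hipos (-b) (by linarith)).neg.congr (Eventually.of_forall fun u => ?_)
      simp [Real.sinh_neg]
    · simp
    · exact hipos b hb
  have hd := superexpDecay_of_integrable_sinh hdm hi
  have h0pos : ∀ y : ℝ, 0 < y → sinhTransform d y = 0 := fun y hy => by
    obtain ⟨h3, h4⟩ := hh.sinhTransform_eq_of_massOne hodd h2 hm hy
    have h5 : sinhTransform d y = sinhTransform h y -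
        ∫ u, Real.sinh (4 * y * u) * (√Real.pi * u * Real.exp (u ^ 2) * h u ^ 2) := by
      rw [sinhTransform, sinhTransform, ← integral_sub (hh.integrable_sinh _) h3]
      congr 1; ext u; simp only [d]; ring
    rw [h5, ← h4, sub_self]
  have h0 := hd.ae_eq_zero_of_sinhTransform_eq_zero hdodd fun y => by
    rcases lt_trichotomy y 0 with hy | rfl | hy
    · rw [← neg_neg y, sinhTransform_neg, h0pos (-y) (by linarith), neg_zero]
    · simp [sinhTransform]
    · exact h0pos y hy
  filter_upwards [h0, compl_mem_ae_iff.2 (measure_singleton (0 : ℝ))] with u hu hu0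
  have hu0' : u ≠ 0 := hu0
  have h3 : h u * (1 - √Real.pi * u * Real.exp (u ^ 2) * h u) = 0 := by
    have : d u = 0 := hu
    simp only [d] at this
    linear_combination this
  rcases mul_eq_zero.1 h3 with h4 | h4
  · exact Or.inl h4
  · right
    have h5 : √Real.pi ≠ 0 := (Real.sqrt_pos.2 Real.pi_pos).ne'
    have h6 := Real.exp_ne_zero (u ^ 2)
    rw [Real.exp_neg]
    field_simp
    linarith

end MassOne

/-! ### The Poisson kernel -/

lemma integrableOn_Iio_of_comp_neg {E : Type*} [NormedAddCommGroup E] {f : ℝ → E}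
    (h : IntegrableOn (fun x => f (-x)) (Set.Ioi 0)) : IntegrableOn f (Set.Iio 0) := by
  have := (Measure.measurePreserving_neg (volume : Measure ℝ)).integrableOn_comp_preimage
    (Homeomorph.neg ℝ).measurableEmbedding (f := f) (s := Set.Iio 0)
  rw [← this]
  simpa [Function.comp_def] using h

lemma integrable_of_even {E : Type*} [NormedAddCommGroup E] {f : ℝ → E} (he : ∀ x, f (-x) = f x)
    (h : IntegrableOn f (Set.Ioi 0)) : Integrable f := by
  have h1 : IntegrableOn f (Set.Iio 0) := integrableOn_Iio_of_comp_neg (by simpa only [he] using h)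
  rw [← integrableOn_univ, ← Set.Iic_union_Ioi (a := (0 : ℝ))]
  exact ((integrableOn_Iic_iff_integrableOn_Iio).2 h1).union h

lemma integrable_poisson (a : ℝ) : Integrable fun t : ℝ => a / (t ^ 2 + a ^ 2) := by
  rcases eq_or_ne a 0 with rfl | ha
  · simp
  have h1 := (integrable_inv_one_add_sq.comp_div ha).const_mul a⁻¹
  refine h1.congr (Eventually.of_forall fun t => ?_)
  simp only
  have : t ^ 2 + a ^ 2 ≠ 0 := by positivity
  field_simp
  ring

open FourierTransform in
lemma fourier_exp_neg_abs {a : ℝ} (ha : 0 < a) (ξ : ℝ) :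
    𝓕 (fun x : ℝ => (Real.exp (-(a * |x|)) : ℂ)) ξ =
      ((2 * a / ((2 * Real.pi * ξ) ^ 2 + a ^ 2) : ℝ) : ℂ) := by
  rw [Real.fourier_real_eq_integral_exp_smul]
  set s : ℝ := 2 * Real.pi * ξ with hs
  have hc : ∀ s : ℝ, IntegrableOn (fun x : ℝ => Complex.exp (-(a + s * Complex.I) * x)) (Set.Ioi 0) ∧
      ∫ x in Set.Ioi (0 : ℝ), Complex.exp (-(a + s * Complex.I) * x) = 1 / (a + s * Complex.I) := by
    intro s
    have hre : (-((a : ℂ) + s * Complex.I)).re < 0 := by simpa using ha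
    refine ⟨integrableOn_exp_mul_complex_Ioi hre 0, ?_⟩
    rw [integral_exp_mul_complex_Ioi hre]
    simp only [Complex.ofReal_zero, mul_zero, Complex.exp_zero]
    rw [div_neg, neg_div, neg_neg]
  set f : ℝ → ℂ := fun x => Complex.exp (↑(-2 * Real.pi * x * ξ) * Complex.I) •
    (Real.exp (-(a * |x|)) : ℂ)
  have hf1 : Set.EqOn f (fun x => Complex.exp (-(a + s * Complex.I) * x)) (Set.Ioi 0) := by
    intro x hx
    have hx0 : 0 < x := hx
    simp only [f, smul_eq_mul]
    rw [Complex.ofReal_exp, ← Complex.exp_add, abs_of_pos hx0, hs]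
    congr 1; push_cast; ring
  have hf2 : Set.EqOn (fun x => f (-x)) (fun x => Complex.exp (-(a + (-s : ℝ) * Complex.I) * x))
      (Set.Ioi 0) := by
    intro x hx
    have hx0 : 0 < x := hx
    simp only [f, smul_eq_mul]
    rw [Complex.ofReal_exp, ← Complex.exp_add, abs_neg, abs_of_pos hx0, hs]
    congr 1; push_cast; ring
  have hi1 : IntegrableOn f (Set.Ioi 0) := (hc s).1.congr_fun hf1.symm measurableSet_Ioi
  have hi2 : IntegrableOn (fun x => f (-x)) (Set.Ioi 0) :=
    (hc (-s)).1.congr_fun hf2.symm measurableSet_Ioi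
  have hi3 : IntegrableOn f (Set.Iic 0) := by
    rw [integrableOn_Iic_iff_integrableOn_Iio]
    exact integrableOn_Iio_of_comp_neg hi2
  have h1 := intervalIntegral.integral_Iic_add_Ioi hi3 hi1
  have h2 := integral_comp_neg_Ioi 0 f
  rw [neg_zero] at h2
  rw [← h1, ← h2, setIntegral_congr_fun measurableSet_Ioi hf1,
    setIntegral_congr_fun measurableSet_Ioi hf2, (hc s).2, (hc (-s)).2]
  have h3 : (a : ℂ) + s * Complex.I ≠ 0 := fun h => ha.ne' (by simpa using congrArg Complex.re h)
  have h4 : (a : ℂ) + (-s : ℝ) * Complex.I ≠ 0 := fun h =>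
    ha.ne' (by simpa using congrArg Complex.re h)
  have h5 : ((s : ℂ) ^ 2 + (a : ℂ) ^ 2) ≠ 0 := by
    have : s ^ 2 + a ^ 2 ≠ 0 := by positivity
    exact_mod_cast this
  rw [div_add_div _ _ h4 h3]
  push_cast at h4 ⊢
  rw [div_eq_div_iff (mul_ne_zero h4 h3) h5]
  linear_combination (2 * a * s ^ 2 : ℂ) * Complex.I_sq

open FourierTransform in
-- Fourier inversion for e^{-a|x|}, whose transform is the Poisson kernel up to the scaling by 2π;
-- taking real parts leaves the cosine.
lemma integral_cos_mul_poisson {a : ℝ} (ha : 0 < a) (s : ℝ) :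
    ∫ t : ℝ, Real.cos (s * t) * (a / (t ^ 2 + a ^ 2)) = Real.pi * Real.exp (-(a * |s|)) := by
  set f : ℝ → ℂ := fun x => (Real.exp (-(a * |x|)) : ℂ)
  have hf : Continuous f := by fun_prop
  have hfi : Integrable f := by
    have h1 : IntegrableOn (fun x : ℝ => Real.exp (-a * x)) (Set.Ioi 0) :=
      exp_neg_integrableOn_Ioi 0 ha
    have h2 : Integrable fun x : ℝ => Real.exp (-a * |x|) :=
      integrable_of_even (fun x => by rw [abs_neg]) (h1.congr_fun (fun x hx => by
        simp only [abs_of_pos (Set.mem_Ioi.1 hx)]) measurableSet_Ioi)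
    simpa [f] using h2.ofReal (𝕜 := ℂ)
  have hF : 𝓕 f = fun ξ => ((2 * a / ((2 * Real.pi * ξ) ^ 2 + a ^ 2) : ℝ) : ℂ) :=
    funext (fourier_exp_neg_abs ha)
  have hFi : Integrable (𝓕 f) := by
    rw [hF]
    refine Integrable.ofReal ?_
    have := ((integrable_poisson a).comp_mul_left' (R := 2 * Real.pi) (by positivity)).const_mul 2
    refine this.congr (Eventually.of_forall fun t => ?_)
    exact (mul_div_assoc _ _ _).symm
  have h1 := congrFun (hf.fourierInv_fourier_eq hfi hFi) s
  rw [Real.fourierInv_eq', hF] at h1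
  have h2 := Measure.integral_comp_mul_left (fun t : ℝ => Complex.exp ((s * t : ℝ) * Complex.I) *
    ((2 * (a / (t ^ 2 + a ^ 2)) : ℝ) : ℂ)) (2 * Real.pi)
  have h3 : ∫ t : ℝ, Complex.exp ((s * (2 * Real.pi * t) : ℝ) * Complex.I) *
      ((2 * (a / ((2 * Real.pi * t) ^ 2 + a ^ 2)) : ℝ) : ℂ) = f s := by
    rw [← h1]
    refine integral_congr_ae (Eventually.of_forall fun t => ?_)
    simp only [RCLike.inner_apply, conj_trivial, smul_eq_mul]
    rw [mul_div_assoc]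
    congr 3
    push_cast; ring
  rw [h2] at h3
  have hi : Integrable fun t : ℝ => Complex.exp ((s * t : ℝ) * Complex.I) *
      ((2 * (a / (t ^ 2 + a ^ 2)) : ℝ) : ℂ) := by
    refine (((integrable_poisson a).const_mul 2).ofReal (𝕜 := ℂ)).bdd_mul (c := 1) (by fun_prop)
      (Eventually.of_forall fun t => ?_)
    rw [Complex.norm_exp_ofReal_mul_I]
  have h4 := congrArg Complex.re h3
  rw [Complex.real_smul, Complex.re_ofReal_mul, ← RCLike.re_to_complex, ← integral_re hi] at h4
  have h5 : ∀ t : ℝ, RCLike.re (Complex.exp ((s * t : ℝ) * Complex.I) *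
      ((2 * (a / (t ^ 2 + a ^ 2)) : ℝ) : ℂ)) = 2 * (Real.cos (s * t) * (a / (t ^ 2 + a ^ 2))) := by
    intro t
    rw [RCLike.re_to_complex, mul_comm, Complex.re_ofReal_mul, Complex.exp_ofReal_mul_I_re]; ring
  simp_rw [h5] at h4
  rw [integral_const_mul, abs_of_pos (by positivity)] at h4
  have h6 : RCLike.re (f s) = Real.exp (-(a * |s|)) := Complex.ofReal_re _
  rw [RCLike.re_to_complex] at h6
  rw [← h6, ← h4]
  have key : ∀ X : ℝ, X = Real.pi * ((2 * Real.pi)⁻¹ * (2 * X)) := fun X => by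
    have := Real.pi_ne_zero
    field_simp
  exact key _

lemma integral_cos_mul_poisson_sign (a s : ℝ) :
    ∫ t : ℝ, Real.cos (s * t) * (a / (t ^ 2 + a ^ 2)) =
      Real.pi * (Real.sign a * Real.exp (-(|a| * |s|))) := by
  rcases lt_trichotomy a 0 with ha | rfl | ha
  · have h := integral_cos_mul_poisson (neg_pos.2 ha) s
    rw [Real.sign_of_neg ha, abs_of_neg ha]
    rw [show (∫ t : ℝ, Real.cos (s * t) * (a / (t ^ 2 + a ^ 2))) =
      -∫ t : ℝ, Real.cos (s * t) * (-a / (t ^ 2 + (-a) ^ 2)) by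
        rw [← integral_neg]; congr 1; ext t; rw [neg_sq]; ring, h]
    ring
  · simp
  · rw [integral_cos_mul_poisson ha, Real.sign_of_pos ha, abs_of_pos ha, one_mul]

/-! ### The pair integrals behind the Cauchy transform -/

/-- The contribution of a pair of frequencies to `lineDiff`. -/
def lineKernel (y v u u' t : ℝ) : ℝ :=
  Real.cos (2 * (u - u') * t) * (Real.sinh (2 * y * (u + u')) * Real.sinh (2 * v * (u + u'))) -
    Real.cos (2 * (u + u') * t) * (Real.sinh (2 * y * (u - u')) * Real.sinh (2 * v * (u - u')))

/-- The integral of `lineKernel` against the kernel `(y - v) / (t² + (y - v)²)`, divided by `π`. -/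
def lineKernelPoisson (y v u u' : ℝ) : ℝ :=
  Real.sign (y - v) * Real.exp (-(|y - v| * |2 * (u - u')|)) *
      (Real.sinh (2 * y * (u + u')) * Real.sinh (2 * v * (u + u'))) -
    Real.sign (y - v) * Real.exp (-(|y - v| * |2 * (u + u')|)) *
      (Real.sinh (2 * y * (u - u')) * Real.sinh (2 * v * (u - u')))

lemma integral_poisson_mul_lineKernel (y v u u' : ℝ) :
    ∫ t : ℝ, (y - v) / (t ^ 2 + (y - v) ^ 2) * lineKernel y v u u' t =
      Real.pi * lineKernelPoisson y v u u' := by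
  have hi : ∀ s : ℝ, Integrable fun t : ℝ => Real.cos (s * t) * ((y - v) / (t ^ 2 + (y - v) ^ 2)) :=
    fun s => (integrable_poisson (y - v)).bdd_mul (c := 1) (by fun_prop)
      (Eventually.of_forall fun t => Real.abs_cos_le_one _)
  have e : ∀ t : ℝ, (y - v) / (t ^ 2 + (y - v) ^ 2) * lineKernel y v u u' t =
      Real.cos (2 * (u - u') * t) * ((y - v) / (t ^ 2 + (y - v) ^ 2)) *
        (Real.sinh (2 * y * (u + u')) * Real.sinh (2 * v * (u + u'))) -
      Real.cos (2 * (u + u') * t) * ((y - v) / (t ^ 2 + (y - v) ^ 2)) *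
        (Real.sinh (2 * y * (u - u')) * Real.sinh (2 * v * (u - u'))) := fun t => by
    rw [lineKernel]; ring
  simp_rw [e]
  rw [integral_sub ((hi _).mul_const _) ((hi _).mul_const _), integral_mul_const,
    integral_mul_const, integral_cos_mul_poisson_sign, integral_cos_mul_poisson_sign,
    lineKernelPoisson]
  ring

lemma lineKernelPoisson_comm (y v u u' : ℝ) :
    lineKernelPoisson y v u u' = lineKernelPoisson y v u' u := by
  have h1 : |2 * (u - u')| = |2 * (u' - u)| := by
    rw [← abs_neg]; congr 1; ring
  have h2 : Real.sinh (2 * y * (u - u')) * Real.sinh (2 * v * (u - u')) =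
      Real.sinh (2 * y * (u' - u)) * Real.sinh (2 * v * (u' - u)) := by
    rw [show 2 * y * (u - u') = -(2 * y * (u' - u)) by ring,
      show 2 * v * (u - u') = -(2 * v * (u' - u)) by ring, Real.sinh_neg, Real.sinh_neg]
    ring
  rw [lineKernelPoisson, lineKernelPoisson, h1, h2, add_comm u u']

/-- Applied with x = y - v, this separates a function analytic in v from a jump supported on v < y.
The jump produces the integral from 0 to y in the Cauchy transform. -/
lemma sign_mul_exp_neg {x d : ℝ} (hx : x ≠ 0) (hd : 0 ≤ d) :
    Real.sign x * Real.exp (-(|x| * |2 * d|)) =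
      (if 0 < x then 2 * Real.cosh (2 * d * x) else 0) - Real.exp (2 * d * x) := by
  rw [abs_of_nonneg (by positivity : 0 ≤ 2 * d)]
  rcases lt_or_gt_of_ne hx with h | h
  · rw [Real.sign_of_neg h, abs_of_neg h, if_neg h.not_gt]
    ring_nf
  · rw [Real.sign_of_pos h, abs_of_pos h, if_pos h, Real.cosh_eq]
    ring_nf

/-- The jump parts of the two terms of the kernel combine into products in which u and u' are
separated, so the double integral over frequencies factorizes. -/
lemma cosh_mul_sinh_identity (y v u u' : ℝ) :
    2 * Real.cosh (2 * (u - u') * (y - v)) *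
        (Real.sinh (2 * y * (u + u')) * Real.sinh (2 * v * (u + u'))) -
      2 * Real.cosh (2 * (u + u') * (y - v)) *
        (Real.sinh (2 * y * (u - u')) * Real.sinh (2 * v * (u - u'))) =
      Real.sinh (4 * y * u) * Real.sinh (4 * u' * v) +
        Real.sinh (4 * y * u') * Real.sinh (4 * u * v) := by
  simp only [Real.cosh_eq, Real.sinh_eq]
  have e2 : ∀ a b : ℝ, Real.exp a * Real.exp b = Real.exp (a + b) := fun a b => by
    rw [← Real.exp_add]
  ring_nf
  simp only [e2]
  ring_nf

lemma setIntegral_Iio_of_even {f : ℝ → ℝ} (hf : Integrable f) (he : ∀ v, f (-v) = f v) (y : ℝ) :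
    ∫ v in Set.Iio y, f v = (∫ v, f v) / 2 + ∫ v in (0 : ℝ)..y, f v := by
  have h1 := intervalIntegral.integral_Iic_sub_Iic (μ := volume) (hf.integrableOn (s := Set.Iic 0))
    (hf.integrableOn (s := Set.Iic y))
  have h2 := intervalIntegral.integral_Iic_add_Ioi (μ := volume) (hf.integrableOn (s := Set.Iic 0))
    (hf.integrableOn (s := Set.Ioi 0))
  have h3 := integral_comp_neg_Ioi 0 f
  simp only [he, neg_zero] at h3
  rw [← integral_Iic_eq_integral_Iio, ← h1, ← h2, h3]
  ring

/-- The Gaussian weight `∫ v` of `lineKernelPoisson`, up to the part which factorizes. -/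
lemma integral_lineKernelPoisson_of_le {y u u' : ℝ} (hu' : 0 < u') (huu : u' ≤ u) :
    ∫ v : ℝ, v * Real.exp (-4 * v ^ 2) * lineKernelPoisson y v u u' =
      (∫ v in (0 : ℝ)..y, v * Real.exp (-4 * v ^ 2) *
        (Real.sinh (4 * y * u) * Real.sinh (4 * u' * v) +
          Real.sinh (4 * y * u') * Real.sinh (4 * u * v))) -
      √Real.pi / 8 * (u' * Real.exp (u' ^ 2)) *
        (Real.cosh (4 * y * u) - Real.cosh (4 * y * u')) := by
  set f : ℝ → ℝ := fun v => v * Real.exp (-4 * v ^ 2) *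
    (Real.sinh (4 * y * u) * Real.sinh (4 * u' * v) +
      Real.sinh (4 * y * u') * Real.sinh (4 * u * v))
  have hg : ∀ k : ℝ, Integrable (fun v : ℝ => v * Real.exp (-4 * v ^ 2) * Real.sinh (4 * k * v)) ∧
      ∫ v : ℝ, v * Real.exp (-4 * v ^ 2) * Real.sinh (4 * k * v) =
        √Real.pi / 4 * (k * Real.exp (k ^ 2)) := fun k => by
    have := gaussian_sinh (2 * k)
    rw [show 2 * (2 * k) = 4 * k by ring, show (2 * k) ^ 2 / 4 = k ^ 2 by ring] at this
    refine ⟨this.1, this.2.trans (by ring)⟩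
  have ef : f = fun v => Real.sinh (4 * y * u) * (v * Real.exp (-4 * v ^ 2) * Real.sinh (4 * u' * v)) +
      Real.sinh (4 * y * u') * (v * Real.exp (-4 * v ^ 2) * Real.sinh (4 * u * v)) := by
    ext v; simp only [f]; ring
  have hf : Integrable f := by
    rw [ef]; exact ((hg u').1.const_mul _).add ((hg u).1.const_mul _)
  have hfe : ∀ v, f (-v) = f v := fun v => by
    simp only [f, neg_sq, mul_neg, Real.sinh_neg]; ring
  have hfi : ∫ v, f v = √Real.pi / 4 * (Real.sinh (4 * y * u) * (u' * Real.exp (u' ^ 2)) +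
      Real.sinh (4 * y * u') * (u * Real.exp (u ^ 2))) := by
    rw [ef, integral_add ((hg u').1.const_mul _) ((hg u).1.const_mul _), integral_const_mul,
      integral_const_mul, (hg u').2, (hg u).2]
    ring
  set E : ℝ → ℝ := fun k => Real.exp (2 * k * y)
  have hl : ∀ k s : ℝ, Integrable (fun v : ℝ => v * Real.exp (-4 * v ^ 2) *
        (Real.exp (2 * k * (y - v)) * Real.sinh (2 * v * s))) ∧
      ∫ v : ℝ, v * Real.exp (-4 * v ^ 2) *
        (Real.exp (2 * k * (y - v)) * Real.sinh (2 * v * s)) = Real.exp (2 * k * y) *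
        (√Real.pi / 16 * ((s - k) * Real.exp ((s - k) ^ 2 / 4) +
          (s + k) * Real.exp ((s + k) ^ 2 / 4))) := fun k s => by
    obtain ⟨i1, e1⟩ := gaussian_exp_linear (s - k)
    obtain ⟨i2, e2⟩ := gaussian_exp_linear (-(s + k))
    have e : ∀ v : ℝ, v * Real.exp (-4 * v ^ 2) *
        (Real.exp (2 * k * (y - v)) * Real.sinh (2 * v * s)) = Real.exp (2 * k * y) / 2 *
        (v * Real.exp (-4 * v ^ 2 + 2 * (s - k) * v) -
          v * Real.exp (-4 * v ^ 2 + 2 * -(s + k) * v)) := fun v => by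
      rw [Real.sinh_eq, show 2 * k * (y - v) = 2 * k * y + -(2 * k * v) by ring, Real.exp_add,
        Real.exp_add, Real.exp_add, show 2 * (s - k) * v = 2 * v * s + -(2 * k * v) by ring,
        show 2 * -(s + k) * v = -(2 * v * s) + -(2 * k * v) by ring, Real.exp_add, Real.exp_add]
      ring
    simp_rw [e]
    refine ⟨(i1.sub i2).const_mul _, ?_⟩
    rw [integral_const_mul, integral_sub i1 i2, e1, e2, neg_sq]
    ring
  -- The analytic part, integrated over the whole line by completing the square; f is the jump part,
  -- which only counts for v < y.
  set r : ℝ → ℝ := fun v =>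
    v * Real.exp (-4 * v ^ 2) * (Real.exp (2 * (u - u') * (y - v)) * Real.sinh (2 * v * (u + u'))) *
      Real.sinh (2 * y * (u + u')) -
    v * Real.exp (-4 * v ^ 2) * (Real.exp (2 * (u + u') * (y - v)) * Real.sinh (2 * v * (u - u'))) *
      Real.sinh (2 * y * (u - u'))
  have hr : Integrable r := ((hl (u - u') (u + u')).1.mul_const _).sub
    ((hl (u + u') (u - u')).1.mul_const _)
  have hri : ∫ v, r v = √Real.pi / 8 * (Real.exp (2 * (u - u') * y) *
        (u' * Real.exp (u' ^ 2) + u * Real.exp (u ^ 2)) * Real.sinh (2 * y * (u + u')) -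
      Real.exp (2 * (u + u') * y) * (u * Real.exp (u ^ 2) - u' * Real.exp (u' ^ 2)) *
        Real.sinh (2 * y * (u - u'))) := by
    simp only [r]
    rw [integral_sub ((hl (u - u') (u + u')).1.mul_const _) ((hl (u + u') (u - u')).1.mul_const _),
      integral_mul_const, integral_mul_const, (hl _ _).2, (hl _ _).2,
      show u + u' - (u - u') = 2 * u' by ring, show u + u' + (u - u') = 2 * u by ring,
      show u - u' - (u + u') = -(2 * u') by ring, show u - u' + (u + u') = 2 * u by ring, neg_sq,
      show (2 * u') ^ 2 / 4 = u' ^ 2 by ring, show (2 * u) ^ 2 / 4 = u ^ 2 by ring]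
    ring
  have hae : (fun v => v * Real.exp (-4 * v ^ 2) * lineKernelPoisson y v u u') =ᵐ[volume]
      fun v => (Set.Iio y).indicator f v - r v := by
    filter_upwards [compl_mem_ae_iff.2 (measure_singleton y)] with v hv
    have hv0 : y - v ≠ 0 := sub_ne_zero.2 (Ne.symm hv)
    -- Here the order u' ≤ u matters: it makes both u - u' and u + u' nonnegative.
    rw [lineKernelPoisson, sign_mul_exp_neg hv0 (by linarith), sign_mul_exp_neg hv0 (by linarith)]
    by_cases hvy : v < y
    · rw [if_pos (sub_pos.2 hvy), if_pos (sub_pos.2 hvy),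
        Set.indicator_of_mem (show v ∈ Set.Iio y from hvy)]
      simp only [f, r]
      rw [← cosh_mul_sinh_identity]
      ring
    · rw [if_neg (by linarith), if_neg (by linarith),
        Set.indicator_of_notMem (show v ∉ Set.Iio y from hvy)]
      simp only [r]
      ring
  rw [integral_congr_ae hae, integral_sub (hf.indicator measurableSet_Iio) hr,
    integral_indicator measurableSet_Iio, setIntegral_Iio_of_even hf hfe, hfi, hri]
  -- The half of the even integral of f over ℝ nearly cancels the analytic part; writing everything
  -- in e^{±4yu} and e^{±4yu'} leaves only the multiple of cosh 4yu - cosh 4yu'.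
  have h1 : Real.exp (2 * (u - u') * y) * Real.sinh (2 * y * (u + u')) =
      (Real.exp (4 * y * u) - Real.exp (-(4 * y * u'))) / 2 := by
    rw [Real.sinh_eq, mul_div_assoc', mul_sub, ← Real.exp_add, ← Real.exp_add]
    ring_nf
  have h2 : Real.exp (2 * (u + u') * y) * Real.sinh (2 * y * (u - u')) =
      (Real.exp (4 * y * u) - Real.exp (4 * y * u')) / 2 := by
    rw [Real.sinh_eq, mul_div_assoc', mul_sub, ← Real.exp_add, ← Real.exp_add]
    ring_nf
  have h3 := Real.sinh_eq (4 * y * u')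
  have h4 := Real.cosh_eq (4 * y * u')
  have h5 := Real.cosh_add_sinh (4 * y * u)
  linear_combination (-(√Real.pi / 8) * (u' * Real.exp (u' ^ 2) + u * Real.exp (u ^ 2))) * h1 +
    (√Real.pi / 8 * (u * Real.exp (u ^ 2) - u' * Real.exp (u' ^ 2))) * h2 +
    (√Real.pi / 8 * (u * Real.exp (u ^ 2))) * h3 +
    (√Real.pi / 8 * (u' * Real.exp (u' ^ 2))) * h5 -
    (√Real.pi / 8 * (u' * Real.exp (u' ^ 2))) * h4

/-! ### Absolute convergence of the fourfold integral -/

/-- Interpolates between the bounds |w| and 1. The exponent 1/4 keeps |u|^{1/4}/u integrable at 0,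
while a product of two sines grows like |t|^{1/2}, which is still integrable against the Poisson
kernel. -/
lemma norm_sin_le_rpow (w : ℂ) : ‖Complex.sin w‖ ≤ ‖w‖ ^ (1 / 4 : ℝ) * Real.exp |w.im| := by
  rcases le_total ‖w‖ 1 with h | h
  · refine (norm_sin_le_norm_mul_exp w).trans ?_
    gcongr
    exact Real.self_le_rpow_of_le_one (norm_nonneg _) h (by norm_num)
  · refine (norm_sin_le_exp w).trans ?_
    exact le_mul_of_one_le_left (Real.exp_nonneg _) (Real.one_le_rpow h (by norm_num))

lemma re_sin_mul_conj_sin (t b u u' : ℝ) :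
    (Complex.sin (2 * (t + b * Complex.I) * u) *
      conj (Complex.sin (2 * (t + b * Complex.I) * u'))).re =
    (Real.cos (2 * (u - u') * t) * Real.cosh (2 * b * (u + u')) -
      Real.cos (2 * (u + u') * t) * Real.cosh (2 * b * (u - u'))) / 2 := by
  rw [sin_two_mul_add_I, sin_two_mul_add_I,
    show 2 * (u - u') * t = 2 * t * u - 2 * t * u' by ring,
    show 2 * (u + u') * t = 2 * t * u + 2 * t * u' by ring,
    show 2 * b * (u + u') = 2 * b * u + 2 * b * u' by ring,
    show 2 * b * (u - u') = 2 * b * u - 2 * b * u' by ring,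
    Real.cos_sub, Real.cos_add, Real.cosh_add, Real.cosh_sub]
  simp only [map_add, map_mul, Complex.conj_ofReal, Complex.conj_I, Complex.mul_re, Complex.add_re,
    Complex.add_im, Complex.mul_im, Complex.ofReal_re, Complex.ofReal_im, Complex.I_re,
    Complex.I_im, Complex.neg_re, Complex.neg_im]
  ring

lemma lineKernel_eq (y v u u' t : ℝ) :
    lineKernel y v u u' t =
      (Complex.sin (2 * (t + (y + v : ℝ) * Complex.I) * u) *
        conj (Complex.sin (2 * (t + (y + v : ℝ) * Complex.I) * u'))).re -
      (Complex.sin (2 * (t + (y - v : ℝ) * Complex.I) * u) *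
        conj (Complex.sin (2 * (t + (y - v : ℝ) * Complex.I) * u'))).re := by
  have h : ∀ s : ℝ, Real.cosh (2 * (y + v) * s) - Real.cosh (2 * (y - v) * s) =
      2 * (Real.sinh (2 * y * s) * Real.sinh (2 * v * s)) := fun s => by
    rw [show 2 * (y + v) * s = 2 * y * s + 2 * v * s by ring,
      show 2 * (y - v) * s = 2 * y * s - 2 * v * s by ring, Real.cosh_add, Real.cosh_sub]
    ring
  rw [re_sin_mul_conj_sin, re_sin_mul_conj_sin, lineKernel]
  linear_combination (-Real.cos (2 * (u - u') * t) / 2) * h (u + u') +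
    (Real.cos (2 * (u + u') * t) / 2) * h (u - u')

lemma SuperexpDecay.norm_sq_sineTransform {h : ℝ → ℝ} (hh : SuperexpDecay h) (z : ℂ) :
    Integrable (fun p : ℝ × ℝ => h p.1 * h p.2 *
      (Complex.sin (2 * z * p.1) * conj (Complex.sin (2 * z * p.2))).re) ∧
    ‖sineTransform h z‖ ^ 2 = ∫ p : ℝ × ℝ, h p.1 * h p.2 *
      (Complex.sin (2 * z * p.1) * conj (Complex.sin (2 * z * p.2))).re := by
  have i1 := hh.integrable_sin z
  have i2 : Integrable fun u : ℝ => conj (Complex.sin (2 * z * u) * h u) :=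
    (Complex.conjLIE.integrable_comp_iff (φ := fun u : ℝ => Complex.sin (2 * z * u) * h u)).2 i1
  have i3 := i1.mul_prod i2
  have e : ∀ p : ℝ × ℝ, h p.1 * h p.2 *
      (Complex.sin (2 * z * p.1) * conj (Complex.sin (2 * z * p.2))).re =
      RCLike.re ((Complex.sin (2 * z * p.1) * h p.1) * conj (Complex.sin (2 * z * p.2) * h p.2)) :=
    fun p => by
      simp only [map_mul, Complex.conj_ofReal, RCLike.re_to_complex, Complex.mul_re,
        Complex.mul_im, Complex.ofReal_re, Complex.ofReal_im]
      ring
  simp_rw [e]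
  refine ⟨i3.re, ?_⟩
  rw [← Measure.volume_eq_prod] at i3
  rw [integral_re i3, Measure.volume_eq_prod, integral_prod_mul
    (fun u : ℝ => Complex.sin (2 * z * u) * h u)
    (fun u : ℝ => conj (Complex.sin (2 * z * u) * h u)), integral_conj]
  change _ = (sineTransform h z * conj (sineTransform h z)).re
  rw [Complex.mul_conj, Complex.normSq_eq_norm_sq, Complex.ofReal_re]

lemma SuperexpDecay.lineDiff_eq {h : ℝ → ℝ} (hh : SuperexpDecay h) (y v t : ℝ) :
    lineDiff h y v t = ∫ p : ℝ × ℝ, h p.1 * h p.2 * lineKernel y v p.1 p.2 t := by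
  have h1 := hh.norm_sq_sineTransform (t + (y + v : ℝ) * Complex.I)
  have h2 := hh.norm_sq_sineTransform (t + (y - v : ℝ) * Complex.I)
  rw [lineDiff, h1.2, h2.2, ← integral_sub h1.1 h2.1]
  congr 1; ext p
  rw [lineKernel_eq]; ring

/-- The growth in `u` of the bound `abs_lineKernel_le`. -/
def frequencyWeight (y u : ℝ) : ℝ :=
  |u| ^ (1 / 4 : ℝ) * Real.exp (2 * |y| * |u| + 2 / 3 * u ^ 2)

lemma frequencyWeight_nonneg (y u : ℝ) : 0 ≤ frequencyWeight y u := by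
  rw [frequencyWeight]; positivity

/-- The mixed term is split as 2|v||u| ≤ (3/2)v² + (2/3)u². For a pair of frequencies this costs
e^{3v²}, beaten by e^{-4v²}, and e^{2u²/3} in each frequency, beaten by the e^{-u²} of the density.
-/
lemma norm_sin_two_mul_le_frequencyWeight {y v s : ℝ} (hs : |s| ≤ |y| + |v|) (u t : ℝ) :
    ‖Complex.sin (2 * (t + s * Complex.I) * u)‖ ≤
      (4 * (1 + |y| + |v|) ^ 2 * (1 + t ^ 2) ^ (1 / 2 : ℝ)) ^ (1 / 4 : ℝ) *
        Real.exp (3 / 2 * v ^ 2) * frequencyWeight y u := by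
  have hn : ‖2 * (t + s * Complex.I) * (u : ℂ)‖ ≤
      4 * (1 + |y| + |v|) ^ 2 * (1 + t ^ 2) ^ (1 / 2 : ℝ) * |u| := by
    rw [norm_mul, norm_mul, Complex.norm_real, Complex.norm_ofNat, Real.norm_eq_abs]
    refine mul_le_mul_of_nonneg_right ?_ (abs_nonneg u)
    have h1 : ‖(t : ℂ) + s * Complex.I‖ ≤ |t| + |s| := by
      refine (norm_add_le _ _).trans (le_of_eq ?_)
      simp
    have h2 : |t| ≤ (1 + t ^ 2) ^ (1 / 2 : ℝ) := by
      rw [← Real.sqrt_eq_rpow]; exact Real.abs_le_sqrt (by linarith)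
    have h3 : 1 ≤ (1 + t ^ 2) ^ (1 / 2 : ℝ) :=
      Real.one_le_rpow (by nlinarith) (by norm_num)
    set X := (1 + t ^ 2) ^ (1 / 2 : ℝ)
    have h4 : 0 ≤ |y| + |v| := by positivity
    set q := |y| + |v|
    rw [show 1 + |y| + |v| = 1 + q by ring]
    nlinarith [mul_nonneg h4 (by linarith : 0 ≤ X - 1), mul_nonneg (mul_nonneg h4 h4) (by linarith : 0 ≤ X)]
  have him : |(2 * (t + s * Complex.I) * (u : ℂ)).im| ≤
      3 / 2 * v ^ 2 + (2 * |y| * |u| + 2 / 3 * u ^ 2) := by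
    have : (2 * (t + s * Complex.I) * (u : ℂ)).im = 2 * s * u := by simp
    rw [this, abs_mul, abs_mul, abs_two]
    have h5 : 2 * |s| * |u| ≤ 2 * (|y| + |v|) * |u| := by gcongr
    have h6 : 2 * |v| * |u| ≤ 3 / 2 * v ^ 2 + 2 / 3 * u ^ 2 := by
      rw [← sq_abs v, ← sq_abs u]
      nlinarith [sq_nonneg (3 * |v| - 2 * |u|)]
    linarith
  refine (norm_sin_le_rpow _).trans ?_
  calc _ ≤ (4 * (1 + |y| + |v|) ^ 2 * (1 + t ^ 2) ^ (1 / 2 : ℝ) * |u|) ^ (1 / 4 : ℝ) *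
        Real.exp (3 / 2 * v ^ 2 + (2 * |y| * |u| + 2 / 3 * u ^ 2)) := by gcongr
    _ = _ := by
      rw [Real.mul_rpow (by positivity) (abs_nonneg _), Real.exp_add, frequencyWeight]; ring

lemma abs_lineKernel_le (y v u u' t : ℝ) :
    |lineKernel y v u u' t| ≤ 4 * (1 + |y| + |v|) * Real.exp (3 * v ^ 2) *
      (1 + t ^ 2) ^ (1 / 4 : ℝ) * (frequencyWeight y u * frequencyWeight y u') := by
  set X := 4 * (1 + |y| + |v|) ^ 2 * (1 + t ^ 2) ^ (1 / 2 : ℝ) with hX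
  have hX0 : 0 ≤ X := by positivity
  have hb : ∀ s : ℝ, |s| ≤ |y| + |v| →
      |(Complex.sin (2 * (t + s * Complex.I) * u) *
        conj (Complex.sin (2 * (t + s * Complex.I) * u'))).re| ≤
      (X ^ (1 / 4 : ℝ) * X ^ (1 / 4 : ℝ)) * Real.exp (3 * v ^ 2) *
        (frequencyWeight y u * frequencyWeight y u') := fun s hs => by
    refine (Complex.abs_re_le_norm _).trans ?_
    rw [norm_mul, RCLike.norm_conj]
    refine (mul_le_mul (norm_sin_two_mul_le_frequencyWeight hs u t)
      (norm_sin_two_mul_le_frequencyWeight hs u' t) (norm_nonneg _) ?_).trans (le_of_eq ?_)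
    · have := frequencyWeight_nonneg y u
      positivity
    · rw [← hX, show 3 * v ^ 2 = 3 / 2 * v ^ 2 + 3 / 2 * v ^ 2 by ring, Real.exp_add]
      ring
  have h1 := hb (y + v) (abs_add_le _ _)
  have h2 := hb (y - v) (abs_sub _ _)
  have h3 : X ^ (1 / 4 : ℝ) * X ^ (1 / 4 : ℝ) = 2 * (1 + |y| + |v|) * (1 + t ^ 2) ^ (1 / 4 : ℝ) := by
    rw [← Real.rpow_add_of_nonneg hX0 (by norm_num) (by norm_num),
      show (1 / 4 + 1 / 4 : ℝ) = 1 / 2 by norm_num, hX,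
      Real.mul_rpow (by positivity) (by positivity), ← Real.rpow_mul (by positivity),
      show (1 / 2 * (1 / 2) : ℝ) = 1 / 4 by norm_num, ← Real.sqrt_eq_rpow,
      show 4 * (1 + |y| + |v|) ^ 2 = (2 * (1 + |y| + |v|)) ^ 2 by ring,
      Real.sqrt_sq (by positivity)]
  rw [h3] at h1 h2
  rw [lineKernel_eq]
  refine (abs_sub _ _).trans ((add_le_add h1 h2).trans (le_of_eq ?_))
  ring

lemma integrable_quarter_rpow_mul_poisson (a : ℝ) :
    Integrable (fun t : ℝ => (1 + t ^ 2) ^ (1 / 4 : ℝ) * (|a| / (t ^ 2 + a ^ 2))) ∧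
    ∫ t : ℝ, (1 + t ^ 2) ^ (1 / 4 : ℝ) * (|a| / (t ^ 2 + a ^ 2)) ≤
      Real.pi + |a| * ∫ t : ℝ, (1 + t ^ 2) ^ (-(3 / 2 : ℝ) / 2) := by
  have i1 : Integrable fun t : ℝ => (1 + t ^ 2) ^ (-(3 / 2 : ℝ) / 2) := by
    simpa using integrable_rpow_neg_one_add_norm_sq (E := ℝ) (μ := volume) (r := 3 / 2) (by norm_num)
  have i2 : Integrable fun t : ℝ => |a| / (t ^ 2 + a ^ 2) := by
    simpa using integrable_poisson |a|
  have hb : ∀ t : ℝ, (1 + t ^ 2) ^ (1 / 4 : ℝ) * (|a| / (t ^ 2 + a ^ 2)) ≤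
      |a| / (t ^ 2 + a ^ 2) + |a| * (1 + t ^ 2) ^ (-(3 / 2 : ℝ) / 2) := fun t => by
    -- Writing the weight as (1+t²)(1+t²)^{-3/4}, the summand 1 is absorbed by the Poisson kernel
    -- and the summand t² cancels its decay, leaving the integrable (1+t²)^{-3/4}.
    have e : (1 + t ^ 2) ^ (1 / 4 : ℝ) = (1 + t ^ 2) * (1 + t ^ 2) ^ (-(3 / 2 : ℝ) / 2) := by
      nth_rewrite 2 [← Real.rpow_one (1 + t ^ 2)]
      rw [← Real.rpow_add (by positivity)]; norm_num
    have h1 : (1 + t ^ 2) ^ (-(3 / 2 : ℝ) / 2) ≤ 1 :=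
      Real.rpow_le_one_of_one_le_of_nonpos (by nlinarith) (by norm_num)
    have h0 : 0 ≤ (1 + t ^ 2) ^ (-(3 / 2 : ℝ) / 2) := by positivity
    have h2 : t ^ 2 * (|a| / (t ^ 2 + a ^ 2)) ≤ |a| := by
      rw [← mul_div_assoc]
      refine div_le_of_le_mul₀ (by positivity) (by positivity) ?_
      nlinarith [abs_nonneg a, mul_nonneg (abs_nonneg a) (sq_nonneg a)]
    rw [e]
    set P := |a| / (t ^ 2 + a ^ 2)
    have hP : 0 ≤ P := by positivity
    nlinarith [mul_le_mul_of_nonneg_left h2 h0, mul_le_mul_of_nonneg_left h1 hP]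
  have i3 : Integrable (fun t : ℝ => (1 + t ^ 2) ^ (1 / 4 : ℝ) * (|a| / (t ^ 2 + a ^ 2))) := by
    refine (i2.add (i1.const_mul |a|)).mono' (by measurability) (Eventually.of_forall fun t => ?_)
    rw [Real.norm_of_nonneg (by positivity)]
    exact hb t
  refine ⟨i3, (integral_mono i3 (i2.add (i1.const_mul |a|)) hb).trans ?_⟩
  simp only [Pi.add_apply]
  rw [integral_add i2 (i1.const_mul _), integral_const_mul]
  gcongr
  have := integral_cos_mul_poisson_sign |a| 0
  simp only [zero_mul, Real.cos_zero, one_mul, sq_abs, abs_zero, mul_zero, neg_zero, Real.exp_zero,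
    mul_one] at this
  rw [this]
  have hs : Real.sign |a| ≤ 1 := by
    rcases Real.sign_apply_eq |a| with h | h | h <;> rw [h] <;> norm_num
  nlinarith [Real.pi_pos]

/-- The (v,t)-factor of the majorant for the fourfold integral. The t-integral is at most linear in
|v|, so the remaining Gaussian in v suffices. -/
lemma integrable_planeWeight (y : ℝ) :
    Integrable fun p : ℝ × ℝ => (1 + |y| + |p.1|) * |p.1| * Real.exp (-p.1 ^ 2) *
      ((1 + p.2 ^ 2) ^ (1 / 4 : ℝ) * (|y - p.1| / (p.2 ^ 2 + (y - p.1) ^ 2))) := by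
  rw [Measure.volume_eq_prod]
  have hm : AEStronglyMeasurable (fun p : ℝ × ℝ => (1 + |y| + |p.1|) * |p.1| * Real.exp (-p.1 ^ 2) *
      ((1 + p.2 ^ 2) ^ (1 / 4 : ℝ) * (|y - p.1| / (p.2 ^ 2 + (y - p.1) ^ 2))))
      (volume.prod volume) := by
    apply Measurable.aestronglyMeasurable
    fun_prop
  refine (integrable_prod_iff hm).2 ⟨Eventually.of_forall fun v =>
    (integrable_quarter_rpow_mul_poisson (y - v)).1.const_mul
      ((1 + |y| + |v|) * |v| * Real.exp (-v ^ 2)), ?_⟩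
  set c := ∫ t : ℝ, (1 + t ^ 2) ^ (-(3 / 2 : ℝ) / 2)
  have hg : ∀ k : ℕ, Integrable fun v : ℝ => |v| ^ k * Real.exp (-v ^ 2) := fun k => by
    have := (integrable_rpow_mul_exp_neg_mul_sq (b := 1) one_pos (s := k)
      (by have : (0 : ℝ) ≤ k := by positivity
          linarith)).norm
    refine this.congr (Eventually.of_forall fun v => ?_)
    simp [Real.rpow_natCast]
  have hmaj : Integrable fun v : ℝ => (1 + |y| + |v|) * |v| * Real.exp (-v ^ 2) *
      (Real.pi + (|y| + |v|) * c) := by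
    refine ((((hg 1).const_mul ((1 + |y|) * (Real.pi + |y| * c))).add
      ((hg 2).const_mul ((1 + |y|) * c + (Real.pi + |y| * c)))).add ((hg 3).const_mul c)).congr
      (Eventually.of_forall fun v => ?_)
    simp only [Pi.add_apply]; ring
  refine hmaj.mono' (hm.norm.integral_prod_right') (Eventually.of_forall fun v => ?_)
  have hn : ∀ t : ℝ, ‖(1 + |y| + |v|) * |v| * Real.exp (-v ^ 2) *
      ((1 + t ^ 2) ^ (1 / 4 : ℝ) * (|y - v| / (t ^ 2 + (y - v) ^ 2)))‖ =
      (1 + |y| + |v|) * |v| * Real.exp (-v ^ 2) *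
      ((1 + t ^ 2) ^ (1 / 4 : ℝ) * (|y - v| / (t ^ 2 + (y - v) ^ 2))) := fun t =>
    Real.norm_of_nonneg (by positivity)
  have hc : 0 ≤ c := integral_nonneg fun t => by positivity
  simp_rw [hn]
  rw [integral_const_mul, Real.norm_of_nonneg
    (mul_nonneg (by positivity) (integral_nonneg fun t => by positivity))]
  gcongr
  refine (integrable_quarter_rpow_mul_poisson (y - v)).2.trans ?_
  gcongr
  exact abs_sub _ _

/-! ### The Cauchy transform as an integral over pairs of frequencies -/

/-- The integrand of the fourfold integral behind the Cauchy transform, `q = (v, t)`. -/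
def fourfoldIntegrand (h : ℝ → ℝ) (y : ℝ) (q p : ℝ × ℝ) : ℝ :=
  q.1 * Real.exp (-4 * q.1 ^ 2) * ((y - q.1) / (q.2 ^ 2 + (y - q.1) ^ 2)) *
    (h p.1 * h p.2 * lineKernel y q.1 p.1 p.2 q.2)

lemma integrable_fourfoldIntegrand {h : ℝ → ℝ} (hh : SuperexpDecay h) (y : ℝ)
    (hW : Integrable fun u => frequencyWeight y u * h u) :
    Integrable (Function.uncurry (fourfoldIntegrand h y)) (volume.prod volume) := by
  have hW2 : Integrable (fun p : ℝ × ℝ => ‖frequencyWeight y p.1 * h p.1‖ *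
      ‖frequencyWeight y p.2 * h p.2‖) := by
    rw [Measure.volume_eq_prod]; exact hW.norm.mul_prod hW.norm
  have hdom := ((integrable_planeWeight y).const_mul 4).mul_prod hW2
  refine hdom.mono' ?_ (Eventually.of_forall fun r => ?_)
  · have hm := hh.aestronglyMeasurable
    have h1 : AEStronglyMeasurable (fun p : ℝ × ℝ => h p.1 * h p.2) volume := by
      rw [Measure.volume_eq_prod]; exact hm.comp_fst.mul hm.comp_snd
    have h2 : AEStronglyMeasurable (fun r : (ℝ × ℝ) × (ℝ × ℝ) =>
        r.1.1 * Real.exp (-4 * r.1.1 ^ 2) * ((y - r.1.1) / (r.1.2 ^ 2 + (y - r.1.1) ^ 2)) *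
          lineKernel y r.1.1 r.2.1 r.2.2 r.1.2) (volume.prod volume) := by
      apply Measurable.aestronglyMeasurable
      unfold lineKernel
      fun_prop
    refine (h1.comp_snd.mul h2).congr (Eventually.of_forall fun r => ?_)
    simp only [Pi.mul_apply, Function.uncurry, fourfoldIntegrand]
    ring
  · obtain ⟨⟨v, t⟩, ⟨u, u'⟩⟩ := r
    simp only [Function.uncurry, fourfoldIntegrand, norm_mul, Real.norm_eq_abs, abs_div, Real.abs_exp,
      abs_of_nonneg (frequencyWeight_nonneg _ _)]
    rw [abs_of_nonneg (by positivity : 0 ≤ t ^ 2 + (y - v) ^ 2)]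
    have h4 : Real.exp (-4 * v ^ 2) * Real.exp (3 * v ^ 2) = Real.exp (-v ^ 2) := by
      rw [← Real.exp_add]; ring_nf
    calc |v| * Real.exp (-4 * v ^ 2) * (|y - v| / (t ^ 2 + (y - v) ^ 2)) *
          (|h u| * |h u'| * |lineKernel y v u u' t|)
        ≤ |v| * Real.exp (-4 * v ^ 2) * (|y - v| / (t ^ 2 + (y - v) ^ 2)) *
          (|h u| * |h u'| * (4 * (1 + |y| + |v|) * Real.exp (3 * v ^ 2) *
            (1 + t ^ 2) ^ (1 / 4 : ℝ) * (frequencyWeight y u * frequencyWeight y u'))) := by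
          gcongr
          exact abs_lineKernel_le y v u u' t
      _ = _ := by rw [← h4]; ring

/-- Averaging over t ↦ -t replaces the Cauchy kernel by the Poisson kernel: 1/(-t+ia) + 1/(t+ia) =
-2ia/(t²+a²). -/
lemma integral_even_div {f : ℝ → ℝ} (hf : ∀ t, f (-t) = f t) (a : ℝ)
    (hi : Integrable fun t : ℝ => (f t : ℂ) / (-t + a * Complex.I)) :
    ∫ t : ℝ, (f t : ℂ) / (-t + a * Complex.I) =
      -Complex.I * ((∫ t : ℝ, a / (t ^ 2 + a ^ 2) * f t : ℝ) : ℂ) := by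
  have e : ∀ t : ℝ, (f t : ℂ) / (-t + a * Complex.I) + (f (-t) : ℂ) / (-(-t : ℝ) + a * Complex.I) =
      2 * (-Complex.I * ((a / (t ^ 2 + a ^ 2) * f t : ℝ) : ℂ)) := fun t => by
    rw [hf]
    push_cast
    rw [neg_neg]
    rcases eq_or_ne a 0 with rfl | ha
    · simp [div_neg]
    · have h1 : (-t + a * Complex.I : ℂ) ≠ 0 := fun h => ha (by simpa using congrArg Complex.im h)
      have h2 : (t + a * Complex.I : ℂ) ≠ 0 := fun h => ha (by simpa using congrArg Complex.im h)
      have h3 : (t ^ 2 + a ^ 2 : ℂ) = -((-t + a * Complex.I) * (t + a * Complex.I)) := by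
        linear_combination (a ^ 2 : ℂ) * Complex.I_sq
      rw [h3]
      field_simp
      ring
  have h1 : ∫ t : ℝ, ((f t : ℂ) / (-t + a * Complex.I) +
      (f (-t) : ℂ) / (-(-t : ℝ) + a * Complex.I)) =
      2 * ∫ t : ℝ, (f t : ℂ) / (-t + a * Complex.I) := by
    rw [integral_add hi hi.comp_neg,
      integral_neg_eq_self (fun t : ℝ => (f t : ℂ) / (-t + a * Complex.I))]
    ring
  simp_rw [e] at h1
  rw [integral_const_mul, integral_const_mul, integral_complex_ofReal] at h1
  exact (mul_left_cancel₀ two_ne_zero h1).symm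

lemma integral_complex_eq_iterated {F : ℂ → ℂ} (hF : Integrable F) (x : ℝ) :
    Integrable (fun q : ℝ × ℝ => F ⟨x + q.2, q.1⟩) ∧
      ∫ w, F w = ∫ v : ℝ, ∫ t : ℝ, F ⟨x + t, v⟩ := by
  have h1 : Integrable fun w : ℂ => F (w + x) := hF.comp_add_right (x : ℂ)
  have hmp := Complex.volume_preserving_equiv_real_prod.symm
  have h2 : Integrable fun p : ℝ × ℝ => F (⟨p.1, p.2⟩ + x) :=
    (hmp.integrable_comp_emb (MeasurableEquiv.measurableEmbedding _)).2 h1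
  have e : ∀ s v : ℝ, ((⟨s, v⟩ : ℂ) + x) = ⟨x + s, v⟩ := fun s v => by
    apply Complex.ext <;> simp [add_comm]
  simp_rw [e] at h2
  refine ⟨?_, ?_⟩
  · rw [Measure.volume_eq_prod] at h2 ⊢
    exact h2.swap
  · rw [← integral_add_right_eq_self F (x : ℂ), ← hmp.integral_comp
      (MeasurableEquiv.measurableEmbedding _) (fun w : ℂ => F (w + x))]
    have e2 : ∀ p : ℝ × ℝ, F (Complex.measurableEquivRealProd.symm p + x) = F ⟨x + p.1, p.2⟩ :=
      fun p => congrArg F (e p.1 p.2)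
    simp_rw [e2]
    rw [Measure.volume_eq_prod] at h2 ⊢
    exact integral_prod_symm _ h2

/-- Absolute convergence of the fourfold integral allows the frequencies to be integrated last; the
innermost t-integral is then the Poisson integral of cosines. -/
lemma SuperexpDecay.cauchyTransform_eq {h : ℝ → ℝ} (hh : SuperexpDecay h) {z : ℂ} (hz : z.im ≠ 0)
    (hW : Integrable fun u => frequencyWeight z.im u * h u)
    (hi : Integrable fun w : ℂ => berezin (translationKernel (sineTransform h)) z w / (z - w)) :
    cauchyTransform (translationKernel (sineTransform h)) z =
      -Complex.I * ((2 / sinhTransform h z.im * ∫ p : ℝ × ℝ, h p.1 * h p.2 *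
        ∫ v : ℝ, v * Real.exp (-4 * v ^ 2) * lineKernelPoisson z.im v p.1 p.2 : ℝ) : ℂ) := by
  set y := z.im
  set b : ℝ → ℝ := fun v => 2 * v * Real.exp (-4 * v ^ 2) / sinhTransform h y with hb
  obtain ⟨h1, h2⟩ := integral_complex_eq_iterated hi z.re
  have e1 : ∀ v t : ℝ, berezin (translationKernel (sineTransform h)) z ⟨z.re + t, v⟩ /
      (z - ⟨z.re + t, v⟩) = ((b v * lineDiff h y v t : ℝ) : ℂ) / (-t + (y - v : ℝ) * Complex.I) :=
    fun v t => by
      rw [berezin_sineTransform h hz]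
      congr 1
      · simp only [hb, add_sub_cancel_left, y]
      · apply Complex.ext <;> simp [y]
  simp_rw [e1] at h1 h2
  rw [Measure.volume_eq_prod] at h1
  have e2 : ∀ᵐ v : ℝ, ∫ t : ℝ, ((b v * lineDiff h y v t : ℝ) : ℂ) / (-t + (y - v : ℝ) * Complex.I) =
      -Complex.I * ((2 / sinhTransform h y * ∫ t : ℝ, ∫ p, fourfoldIntegrand h y (v, t) p : ℝ) : ℂ) := by
    filter_upwards [h1.prod_right_ae] with v hv
    rw [integral_even_div (f := fun t => b v * lineDiff h y v t)
      (fun t => by rw [lineDiff_neg]) (y - v) hv, ← integral_const_mul]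
    congr 3; ext t
    rw [hh.lineDiff_eq]
    simp only [fourfoldIntegrand]
    rw [integral_const_mul, hb]
    ring
  have hF := integrable_fourfoldIntegrand hh y hW
  have hF1 := hF.integral_prod_left
  rw [Measure.volume_eq_prod] at hF1
  rw [cauchyTransform, h2, integral_congr_ae e2, integral_const_mul, integral_complex_ofReal,
    integral_const_mul]
  have h3 : ∫ v : ℝ, ∫ t : ℝ, ∫ p, fourfoldIntegrand h y (v, t) p =
      ∫ q : ℝ × ℝ, ∫ p, fourfoldIntegrand h y q p := by
    conv_rhs => rw [Measure.volume_eq_prod]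
    exact (integral_prod _ hF1).symm
  have h4 : ∫ q : ℝ × ℝ, ∫ p, fourfoldIntegrand h y q p = Real.pi * ∫ p : ℝ × ℝ, h p.1 * h p.2 *
        ∫ v : ℝ, v * Real.exp (-4 * v ^ 2) * lineKernelPoisson y v p.1 p.2 := by
    rw [integral_integral_swap hF, ← integral_const_mul]
    refine integral_congr_ae ?_
    filter_upwards [hF.prod_left_ae] with p hp
    simp only [Function.uncurry] at hp
    rw [Measure.volume_eq_prod] at hp
    conv_lhs => rw [Measure.volume_eq_prod]
    rw [integral_prod _ hp, ← integral_const_mul, ← integral_const_mul]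
    congr 1; ext v
    have e3 : ∀ t : ℝ, fourfoldIntegrand h y (v, t) p = v * Real.exp (-4 * v ^ 2) * (h p.1 * h p.2) *
        ((y - v) / (t ^ 2 + (y - v) ^ 2) * lineKernel y v p.1 p.2 t) := fun t => by
      simp only [fourfoldIntegrand]; ring
    simp_rw [e3]
    rw [integral_const_mul, integral_poisson_mul_lineKernel]
    ring
  rw [h3, h4]
  generalize ∫ p : ℝ × ℝ, h p.1 * h p.2 *
    ∫ v : ℝ, v * Real.exp (-4 * v ^ 2) * lineKernelPoisson y v p.1 p.2 = X
  have := Complex.ofReal_ne_zero.2 Real.pi_ne_zero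
  push_cast
  field_simp

/-! ### Truncated densities -/

/-- The density `(2/√π) e^{-u²}/u` on `S`. -/
def truncatedDensity (S : Set ℝ) (u : ℝ) : ℝ :=
  S.indicator (fun u => 2 / √Real.pi * (Real.exp (-u ^ 2) / u)) u

/-- `∫ (cosh 4yu - cosh 4yu') du'` over `u' ∈ T ∩ (0, u]`. -/
def coshGap (T : Set ℝ) (y u : ℝ) : ℝ :=
  ∫ u', (Set.Ioc 0 u ∩ T).indicator (fun u' => Real.cosh (4 * y * u) - Real.cosh (4 * y * u')) u'

section Truncated

variable {S : Set ℝ}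

lemma measurable_truncatedDensity (hS : MeasurableSet S) : Measurable (truncatedDensity S) :=
  Measurable.indicator (by fun_prop) hS

lemma truncatedDensity_of_nonpos (hpos : S ⊆ Set.Ioi 0) {u : ℝ} (hu : u ≤ 0) :
    truncatedDensity S u = 0 :=
  Set.indicator_of_notMem (fun h => (hpos h).not_ge hu) _

lemma truncatedDensity_nonneg (hpos : S ⊆ Set.Ioi 0) (u : ℝ) : 0 ≤ truncatedDensity S u := by
  refine Set.indicator_nonneg (fun v hv => ?_) u
  have : 0 < v := hpos hv
  positivity

lemma abs_mul_truncatedDensity_le (u : ℝ) :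
    |u * truncatedDensity S u| ≤ 2 / √Real.pi * Real.exp (-u ^ 2) := by
  by_cases hu : u ∈ S
  · rw [truncatedDensity, Set.indicator_of_mem hu]
    rcases eq_or_ne u 0 with rfl | h0
    · simp; positivity
    · rw [show u * (2 / √Real.pi * (Real.exp (-u ^ 2) / u)) = 2 / √Real.pi * Real.exp (-u ^ 2) by
        field_simp, abs_of_nonneg (by positivity)]
  · rw [truncatedDensity, Set.indicator_of_notMem hu, mul_zero, abs_zero]
    positivity

lemma superexpDecay_truncatedDensity (hS : MeasurableSet S) : SuperexpDecay (truncatedDensity S) := by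
  intro c
  have h1 : Integrable fun u : ℝ => Real.exp (c ^ 2 / 2) * (2 / √Real.pi) *
      Real.exp (-(1 / 2) * u ^ 2) := (integrable_exp_neg_mul_sq (by norm_num)).const_mul _
  have hm := measurable_truncatedDensity hS
  refine h1.mono' (Measurable.aestronglyMeasurable (by fun_prop)) (Eventually.of_forall fun u => ?_)
  rw [norm_mul, Real.norm_of_nonneg (Real.exp_nonneg _), Real.norm_eq_abs]
  calc _ ≤ Real.exp (c ^ 2 / 2 + u ^ 2 / 2) * (2 / √Real.pi * Real.exp (-u ^ 2)) := by
        gcongr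
        · rw [← sq_abs u]; nlinarith [sq_nonneg (c - |u|)]
        · exact abs_mul_truncatedDensity_le u
    _ = _ := by
      have h2 : Real.exp (-(1 / 2) * u ^ 2) = Real.exp (u ^ 2 / 2) * Real.exp (-u ^ 2) := by
        rw [← Real.exp_add]; ring_nf
      rw [h2, Real.exp_add]; ring

/-- At 0 the singularity is u^{1/4-1} = u^{-3/4}. At infinity the exponent is 2|y|u - u²/3, and
2|y|u ≤ 6y² + u²/6 leaves -u²/6. -/
lemma integrable_frequencyWeight_mul (hS : MeasurableSet S) (hpos : S ⊆ Set.Ioi 0) (y : ℝ) :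
    Integrable fun u => frequencyWeight y u * truncatedDensity S u := by
  have h1 : IntegrableOn (fun u : ℝ => u ^ (-(3 / 4) : ℝ) * Real.exp (-(1 / 6) * u ^ 2))
      (Set.Ioi 0) := integrableOn_rpow_mul_exp_neg_mul_sq (by norm_num) (by norm_num)
  have h2 := ((integrable_indicator_iff measurableSet_Ioi).2 h1).const_mul
    (2 / √Real.pi * Real.exp (6 * y ^ 2))
  have hm := measurable_truncatedDensity hS
  refine h2.mono' (Measurable.aestronglyMeasurable ?_) (Eventually.of_forall fun u => ?_)
  · unfold frequencyWeight; fun_prop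
  · by_cases hu : u ∈ S
    · have hu0 : 0 < u := hpos hu
      rw [Set.indicator_of_mem (Set.mem_Ioi.2 hu0), truncatedDensity, Set.indicator_of_mem hu,
        frequencyWeight, abs_of_pos hu0, Real.norm_of_nonneg (by positivity)]
      have e1 : u ^ (1 / 4 : ℝ) = u ^ (-(3 / 4) : ℝ) * u := by
        nth_rewrite 3 [← Real.rpow_one u]
        rw [← Real.rpow_add hu0]; norm_num
      have e2 : Real.exp (2 * |y| * u + 2 / 3 * u ^ 2) * Real.exp (-u ^ 2) ≤
          Real.exp (6 * y ^ 2) * Real.exp (-(1 / 6) * u ^ 2) := by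
        rw [← Real.exp_add, ← Real.exp_add]
        refine Real.exp_le_exp.2 ?_
        rw [← sq_abs y]
        nlinarith [sq_nonneg (6 * |y| - u)]
      calc u ^ (1 / 4 : ℝ) * Real.exp (2 * |y| * u + 2 / 3 * u ^ 2) *
            (2 / √Real.pi * (Real.exp (-u ^ 2) / u))
          = 2 / √Real.pi * u ^ (-(3 / 4) : ℝ) *
            (Real.exp (2 * |y| * u + 2 / 3 * u ^ 2) * Real.exp (-u ^ 2)) := by
            rw [e1]; field_simp
        _ ≤ 2 / √Real.pi * u ^ (-(3 / 4) : ℝ) *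
            (Real.exp (6 * y ^ 2) * Real.exp (-(1 / 6) * u ^ 2)) := by gcongr
        _ = _ := by ring
    · rw [truncatedDensity, Set.indicator_of_notMem hu, mul_zero, norm_zero]
      refine mul_nonneg (by positivity) (Set.indicator_nonneg (fun v hv => ?_) u)
      have : 0 < v := hv
      positivity

lemma cosh_sub_one (x : ℝ) : Real.cosh (2 * x) - 1 = 2 * Real.sinh x ^ 2 := by
  rw [Real.cosh_two_mul, Real.cosh_sq]; ring

lemma coshGap_integrand_bounds (T : Set ℝ) (y u u' : ℝ) :
    0 ≤ (Set.Ioc 0 u ∩ T).indicator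
      (fun u' => Real.cosh (4 * y * u) - Real.cosh (4 * y * u')) u' ∧
    (Set.Ioc 0 u ∩ T).indicator (fun u' => Real.cosh (4 * y * u) - Real.cosh (4 * y * u')) u' ≤
      2 * Real.sinh (2 * y * u) ^ 2 * (1 + u ^ 2) * (1 + u' ^ 2)⁻¹ := by
  by_cases hu : u' ∈ Set.Ioc 0 u ∩ T
  · rw [Set.indicator_of_mem hu]
    obtain ⟨⟨h0, h1⟩, _⟩ := hu
    refine ⟨sub_nonneg.2 (Real.cosh_le_cosh.2 ?_), ?_⟩
    · rw [abs_mul, abs_mul _ u, abs_of_pos h0, abs_of_pos (h0.trans_le h1)]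
      gcongr
    · have h2 := cosh_sub_one (2 * y * u)
      rw [show 2 * (2 * y * u) = 4 * y * u by ring] at h2
      have h3 := Real.one_le_cosh (4 * y * u')
      -- On u' ≤ u this harmless factor makes the bound a product of a function of u and the
      -- integrable function (1+u'²)^{-1}.
      have h4 : 1 ≤ (1 + u ^ 2) * (1 + u' ^ 2)⁻¹ := by
        rw [← div_eq_mul_inv, one_le_div (by positivity)]
        nlinarith
      rw [mul_assoc (2 * Real.sinh (2 * y * u) ^ 2)]
      refine le_trans ?_ (le_mul_of_one_le_right (by positivity) h4)
      linarith
  · rw [Set.indicator_of_notMem hu]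
    exact ⟨le_rfl, by positivity⟩

lemma sinh_sq_mul_le (y u : ℝ) : 2 * Real.sinh (2 * y * u) ^ 2 * (1 + u ^ 2) ≤
    16 * y ^ 2 * (Real.exp ((4 * |y| + 2) * |u|) * |u|) := by
  have h1 := abs_sinh_mul_le (2 * y) u
  have h2 : 1 + u ^ 2 ≤ 2 * Real.exp |u| := by
    have := Real.quadratic_le_exp_of_nonneg (abs_nonneg u)
    rw [sq_abs] at this
    linarith [abs_nonneg u]
  have h3 : |u| ≤ Real.exp |u| := by linarith [Real.add_one_le_exp |u|]
  have h4 : Real.sinh (2 * y * u) ^ 2 ≤ (|2 * y| * (Real.exp (|2 * y| * |u|) * |u|)) ^ 2 := by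
    rw [← sq_abs (Real.sinh _)]
    gcongr
  calc 2 * Real.sinh (2 * y * u) ^ 2 * (1 + u ^ 2)
      ≤ 2 * (|2 * y| * (Real.exp (|2 * y| * |u|) * |u|)) ^ 2 * (2 * Real.exp |u|) := by gcongr
    _ = 16 * y ^ 2 * (Real.exp (4 * |y| * |u|) * Real.exp |u| * |u|) * |u| := by
      rw [abs_mul, abs_two, ← sq_abs y, show 4 * |y| * |u| = 2 * |y| * |u| + 2 * |y| * |u| by ring,
        Real.exp_add]
      ring
    _ ≤ 16 * y ^ 2 * (Real.exp (4 * |y| * |u|) * Real.exp |u| * |u|) * Real.exp |u| := by gcongr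
    _ = _ := by
      rw [show (4 * |y| + 2) * |u| = 4 * |y| * |u| + |u| + |u| by ring, Real.exp_add, Real.exp_add]
      ring

lemma SuperexpDecay.integrable_coshGap {h : ℝ → ℝ} (hh : SuperexpDecay h) {T : Set ℝ}
    (hT : MeasurableSet T) (y : ℝ) :
    Integrable (fun p : ℝ × ℝ => h p.1 * (Set.Ioc 0 p.1 ∩ T).indicator
      (fun u' => Real.cosh (4 * y * p.1) - Real.cosh (4 * y * u')) p.2) (volume.prod volume) := by
  have h1 : Integrable fun u : ℝ => 2 * Real.sinh (2 * y * u) ^ 2 * (1 + u ^ 2) * h u :=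
    hh.integrable_of_bound_real (by fun_prop) (A := 16 * y ^ 2) (c := 4 * |y| + 2) fun u => by
      rw [abs_of_nonneg (by positivity)]; exact sinh_sq_mul_le y u
  refine (h1.norm.mul_prod integrable_inv_one_add_sq).mono' ?_ (Eventually.of_forall fun p => ?_)
  · refine hh.aestronglyMeasurable.comp_fst.mul (Measurable.aestronglyMeasurable ?_)
    have e : (fun p : ℝ × ℝ => (Set.Ioc 0 p.1 ∩ T).indicator
        (fun u' => Real.cosh (4 * y * p.1) - Real.cosh (4 * y * u')) p.2) =
        ({p : ℝ × ℝ | 0 < p.2} ∩ {p : ℝ × ℝ | p.2 ≤ p.1} ∩ Prod.snd ⁻¹' T).indicator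
          (fun p => Real.cosh (4 * y * p.1) - Real.cosh (4 * y * p.2)) := by
      ext p
      rfl
    rw [e]
    refine Measurable.indicator ?_ (((measurableSet_lt measurable_const measurable_snd).inter
      (measurableSet_le measurable_snd measurable_fst)).inter (measurable_snd hT))
    exact (Real.measurable_cosh.comp (by fun_prop)).sub (Real.measurable_cosh.comp (by fun_prop))
  · obtain ⟨h2, h3⟩ := coshGap_integrand_bounds T y p.1 p.2
    rw [norm_mul, Real.norm_of_nonneg h2, norm_mul, Real.norm_of_nonneg
      (by positivity : 0 ≤ 2 * Real.sinh (2 * y * p.1) ^ 2 * (1 + p.1 ^ 2))]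
    calc _ ≤ ‖h p.1‖ * (2 * Real.sinh (2 * y * p.1) ^ 2 * (1 + p.1 ^ 2) * (1 + p.2 ^ 2)⁻¹) :=
          mul_le_mul_of_nonneg_left h3 (norm_nonneg _)
      _ = _ := by ring

lemma SuperexpDecay.integral_coshGap {h : ℝ → ℝ} (hh : SuperexpDecay h) {T : Set ℝ}
    (hT : MeasurableSet T) (y : ℝ) :
    Integrable (fun u => h u * coshGap T y u) ∧
    ∫ p : ℝ × ℝ, h p.1 * (Set.Ioc 0 p.1 ∩ T).indicator
      (fun u' => Real.cosh (4 * y * p.1) - Real.cosh (4 * y * u')) p.2 =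
      ∫ u, h u * coshGap T y u := by
  have h1 := hh.integrable_coshGap hT y
  refine ⟨?_, ?_⟩
  · refine h1.integral_prod_left.congr (Eventually.of_forall fun u => ?_)
    exact integral_const_mul (h u) _
  · rw [Measure.volume_eq_prod, integral_prod _ h1]
    simp only [integral_const_mul]
    rfl

lemma coshGap_add_compl {T : Set ℝ} (hT : MeasurableSet T) {y : ℝ} (hy : y ≠ 0) {u : ℝ}
    (hu : 0 < u) : coshGap T y u + coshGap Tᶜ y u =
      u * Real.cosh (4 * y * u) - Real.sinh (4 * y * u) / (4 * y) := by
  set f : ℝ → ℝ := fun u' => Real.cosh (4 * y * u) - Real.cosh (4 * y * u')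
  have hf : IntegrableOn f (Set.Ioc 0 u) := (by fun_prop : Continuous f).integrableOn_Ioc
  have h1 : ∀ x, HasDerivAt (fun x : ℝ => Real.sinh (4 * y * x) / (4 * y))
      (Real.cosh (4 * y * x)) x := fun x => by
    have h2 : HasDerivAt (fun x : ℝ => 4 * y * x) (4 * y) x := by
      simpa using (hasDerivAt_id x).const_mul (4 * y)
    refine (h2.sinh.div_const (4 * y)).congr_deriv ?_
    field_simp
  rw [coshGap, coshGap, integral_indicator (measurableSet_Ioc.inter hT),
    integral_indicator (measurableSet_Ioc.inter hT.compl), ← Set.sdiff_eq,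
    integral_inter_add_sdiff hT hf, ← intervalIntegral.integral_of_le hu.le,
    intervalIntegral.integral_sub intervalIntegrable_const (Continuous.intervalIntegrable (by fun_prop) _ _),
    intervalIntegral.integral_eq_sub_of_hasDerivAt (fun x _ => h1 x)
      (Continuous.intervalIntegrable (by fun_prop) _ _)]
  simp

lemma SuperexpDecay.integral_mul_intervalIntegral {h : ℝ → ℝ} (hh : SuperexpDecay h) (y : ℝ) :
    Integrable (fun u => h u * ∫ v in (0 : ℝ)..y, v * Real.exp (-4 * v ^ 2) * Real.sinh (4 * u * v)) ∧
    ∫ u, h u * ∫ v in (0 : ℝ)..y, v * Real.exp (-4 * v ^ 2) * Real.sinh (4 * u * v) =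
      ∫ v in (0 : ℝ)..y, v * Real.exp (-4 * v ^ 2) * sinhTransform h v := by
  set g : ℝ → ℝ → ℝ := fun v u => v * Real.exp (-4 * v ^ 2) * (Real.sinh (4 * v * u) * h u)
  have hc : Integrable (fun _ : ℝ => |y|) (volume.restrict (Set.uIoc 0 y)) := by
    simp [isFiniteMeasure_restrict]
  have hg : Integrable (Function.uncurry g) ((volume.restrict (Set.uIoc 0 y)).prod volume) := by
    have h1 := hc.mul_prod ((hh (4 * |y|)).norm.const_mul (4 * |y|))
    refine h1.mono' ?_ ?_
    · refine ((Continuous.aestronglyMeasurable (f := fun p : ℝ × ℝ => p.1 *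
        Real.exp (-4 * p.1 ^ 2) * Real.sinh (4 * p.1 * p.2)) (by fun_prop)).mul
        (hh.aestronglyMeasurable.comp_snd)).congr (Eventually.of_forall fun p => ?_)
      simp only [Pi.mul_apply, Function.uncurry, g]; ring
    · rw [Measure.restrict_prod_eq_prod_univ]
      filter_upwards [ae_restrict_mem (measurableSet_uIoc.prod MeasurableSet.univ)] with p hp
      have hv : |p.1| ≤ |y| := by
        simpa using Set.abs_sub_left_of_mem_uIcc (Set.uIoc_subset_uIcc hp.1)
      have h2 : Real.exp (-4 * p.1 ^ 2) ≤ 1 := Real.exp_le_one_iff.2 (by nlinarith [sq_nonneg p.1])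
      have h3 := abs_sinh_mul_le (4 * p.1) p.2
      simp only [Function.uncurry, g, norm_mul, Real.norm_eq_abs, Real.abs_exp]
      rw [abs_mul, abs_of_pos (four_pos : (0 : ℝ) < 4)] at h3
      calc |p.1| * Real.exp (-4 * p.1 ^ 2) * (|Real.sinh (4 * p.1 * p.2)| * |h p.2|)
          ≤ |y| * 1 * (4 * |y| * (Real.exp (4 * |y| * |p.2|) * |p.2|) * |h p.2|) := by
            gcongr
            refine h3.trans ?_
            gcongr
        _ = _ := by ring
  have e : ∀ u, h u * ∫ v in (0 : ℝ)..y, v * Real.exp (-4 * v ^ 2) * Real.sinh (4 * u * v) =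
      ∫ v in (0 : ℝ)..y, g v u := fun u => by
    rw [← intervalIntegral.integral_const_mul]
    refine intervalIntegral.integral_congr fun v _ => ?_
    simp only [g]
    rw [show 4 * v * u = 4 * u * v by ring]; ring
  simp_rw [e]
  refine ⟨?_, ?_⟩
  · have h1 := hg.integral_prod_right
    rcases le_total 0 y with hy | hy
    · simp_rw [intervalIntegral.integral_of_le hy]
      rw [Set.uIoc_of_le hy] at h1
      exact h1
    · simp_rw [intervalIntegral.integral_of_ge hy]
      rw [Set.uIoc_of_ge hy] at h1
      exact h1.neg
  · rw [← intervalIntegral_integral_swap hg]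
    refine intervalIntegral.integral_congr fun v _ => ?_
    simp only [g]
    rw [integral_const_mul, sinhTransform]

lemma cosh_le_exp_abs (x : ℝ) : Real.cosh x ≤ Real.exp |x| := by
  have h1 := Real.exp_le_exp.2 (neg_le_abs x)
  have h2 := Real.exp_le_exp.2 (le_abs_self x)
  rw [Real.cosh_eq]; linarith

lemma SuperexpDecay.hasDerivAt_sinhTransform {h : ℝ → ℝ} (hh : SuperexpDecay h) (y : ℝ) :
    Integrable (fun u => 4 * (u * Real.cosh (4 * y * u)) * h u) ∧
    HasDerivAt (sinhTransform h) (∫ u, 4 * (u * Real.cosh (4 * y * u)) * h u) y := by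
  refine hasDerivAt_integral_of_dominated_loc_of_deriv_le
    (bound := fun u => 4 * ‖Real.exp (4 * (|y| + 1) * |u|) * (u * h u)‖)
    (F := fun y (u : ℝ) => Real.sinh (4 * y * u) * h u)
    (F' := fun y (u : ℝ) => 4 * (u * Real.cosh (4 * y * u)) * h u)
    (Metric.ball_mem_nhds y one_pos) (Eventually.of_forall fun w => (hh.integrable_sinh _).1)
    (hh.integrable_sinh _) ?_ (Eventually.of_forall fun u w hw => ?_)
    ((hh _).norm.const_mul 4) (Eventually.of_forall fun u w _ => ?_)
  · exact AEStronglyMeasurable.mul (by fun_prop) hh.aestronglyMeasurable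
  · have h1 : |w| ≤ |y| + 1 := by
      have h2 := (mem_ball_iff_norm.1 hw).le
      have h3 := abs_add_le y (w - y)
      rw [Real.norm_eq_abs] at h2
      rw [add_sub_cancel] at h3
      linarith
    have h2 : Real.cosh (4 * w * u) ≤ Real.exp (4 * (|y| + 1) * |u|) := by
      refine (cosh_le_exp_abs _).trans (Real.exp_le_exp.2 ?_)
      rw [abs_mul, abs_mul, abs_of_pos (four_pos : (0 : ℝ) < 4)]
      gcongr
    rw [norm_mul, norm_mul, norm_mul, norm_mul, norm_mul, Real.norm_of_nonneg (Real.exp_nonneg _),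
      Real.norm_of_nonneg (Real.cosh_pos _).le, Real.norm_of_nonneg (four_pos : (0 : ℝ) < 4).le]
    calc _ ≤ 4 * (‖u‖ * Real.exp (4 * (|y| + 1) * |u|)) * ‖h u‖ := by gcongr
      _ = _ := by ring
  · have h1 : HasDerivAt (fun w : ℝ => 4 * w * u) (4 * u) w := by
      simpa using ((hasDerivAt_id w).const_mul 4).mul_const u
    refine (h1.sinh.mul_const _).congr_deriv ?_
    ring

end Truncated

/-! ### The Cauchy transform for a truncated density. -/

section Truncated

variable {S : Set ℝ}

/-- The special form of the density enters here: at u' in S it cancels the Gaussian factor (√π/8) u'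
e^{u'²} to the constant 1/4. The formula for u' ≤ u is made symmetric by adding the term with the
roles of the frequencies exchanged. -/
lemma truncatedDensity_mul_lineKernelPoisson (hpos : S ⊆ Set.Ioi 0) (y u u' : ℝ) :
    truncatedDensity S u * truncatedDensity S u' *
      (∫ v : ℝ, v * Real.exp (-4 * v ^ 2) * lineKernelPoisson y v u u') =
    truncatedDensity S u * truncatedDensity S u' *
      (Real.sinh (4 * y * u) *
          (∫ v in (0 : ℝ)..y, v * Real.exp (-4 * v ^ 2) * Real.sinh (4 * u' * v)) +
        Real.sinh (4 * y * u') *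
          ∫ v in (0 : ℝ)..y, v * Real.exp (-4 * v ^ 2) * Real.sinh (4 * u * v)) -
    1 / 4 * (truncatedDensity S u * (Set.Ioc 0 u ∩ S).indicator
        (fun u' => Real.cosh (4 * y * u) - Real.cosh (4 * y * u')) u' +
      truncatedDensity S u' * (Set.Ioc 0 u' ∩ S).indicator
        (fun u => Real.cosh (4 * y * u') - Real.cosh (4 * y * u)) u) := by
  by_cases hu : u ∈ S
  swap
  · simp [truncatedDensity, hu]
  by_cases hu' : u' ∈ S
  swap
  · simp [truncatedDensity, hu']
  wlog huu : u' ≤ u generalizing u u'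
  · have := this u' u hu' hu (le_of_not_ge huu)
    simp_rw [lineKernelPoisson_comm y _ u u']
    linear_combination this
  have h0 : 0 < u' := hpos hu'
  rw [integral_lineKernelPoisson_of_le h0 huu]
  have e1 : ∀ v : ℝ, v * Real.exp (-4 * v ^ 2) *
      (Real.sinh (4 * y * u) * Real.sinh (4 * u' * v) +
        Real.sinh (4 * y * u') * Real.sinh (4 * u * v)) =
      Real.sinh (4 * y * u) * (v * Real.exp (-4 * v ^ 2) * Real.sinh (4 * u' * v)) +
        Real.sinh (4 * y * u') * (v * Real.exp (-4 * v ^ 2) * Real.sinh (4 * u * v)) :=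
    fun v => by ring
  simp_rw [e1]
  rw [intervalIntegral.integral_add (Continuous.intervalIntegrable (by fun_prop) _ _)
    (Continuous.intervalIntegrable (by fun_prop) _ _), intervalIntegral.integral_const_mul,
    intervalIntegral.integral_const_mul]
  -- When u' ≤ u the exchanged term can only be present on the diagonal u = u', and there it is
  -- zero.
  have e2 : (Set.Ioc 0 u' ∩ S).indicator
      (fun u => Real.cosh (4 * y * u') - Real.cosh (4 * y * u)) u = 0 := by
    by_cases h : u ∈ Set.Ioc 0 u' ∩ S
    · rw [Set.indicator_of_mem h, le_antisymm h.1.2 huu, sub_self]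
    · exact Set.indicator_of_notMem h _
  have e3 : truncatedDensity S u' * (√Real.pi / 8 * (u' * Real.exp (u' ^ 2))) = 1 / 4 := by
    rw [truncatedDensity, Set.indicator_of_mem hu', Real.exp_neg]
    have := (Real.sqrt_pos.2 Real.pi_pos).ne'
    field_simp
    norm_num
  rw [e2, Set.indicator_of_mem (show u' ∈ Set.Ioc 0 u ∩ S from ⟨⟨h0, huu⟩, hu'⟩)]
  linear_combination (-truncatedDensity S u *
    (Real.cosh (4 * y * u) - Real.cosh (4 * y * u'))) * e3

/-- The defect of the Cauchy transform that comes from the complement of `S`. -/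
def gapTransform (S : Set ℝ) (y : ℝ) : ℝ := ∫ u, truncatedDensity S u * coshGap Sᶜ y u

/-- Integrating over all of (0,u] instead of its part in S gives u cosh 4yu - sinh(4yu)/(4y), and
hence Φ'/4 - Φ/(4y). What is missing comes from the complement of S. -/
lemma integral_coshGap_truncatedDensity (hS : MeasurableSet S) (hpos : S ⊆ Set.Ioi 0) {y : ℝ}
    (hy : y ≠ 0) : ∫ u, truncatedDensity S u * coshGap S y u =
      deriv (sinhTransform (truncatedDensity S)) y / 4 -
        sinhTransform (truncatedDensity S) y / (4 * y) - gapTransform S y := by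
  have hh := superexpDecay_truncatedDensity hS
  have i1 := (hh.integral_coshGap hS y).1
  have i2 := (hh.integral_coshGap hS.compl y).1
  obtain ⟨i3, h3⟩ := hh.hasDerivAt_sinhTransform y
  rw [eq_sub_iff_add_eq, gapTransform, ← integral_add i1 i2, h3.deriv, sinhTransform,
    ← integral_div, ← integral_div, ← integral_sub (i3.div_const 4)
      ((hh.integrable_sinh _).div_const _)]
  congr 1; ext u
  rcases le_or_gt u 0 with hu | hu
  · simp [truncatedDensity_of_nonpos hpos hu]
  · rw [← mul_add, coshGap_add_compl hS hy hu]
    ring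

lemma integral_add_sub_symm {f g k : ℝ × ℝ → ℝ} (hf : Integrable f) (hg : Integrable g)
    (hk : Integrable k) : ∫ p, (f p + g p - 1 / 4 * (k p + k p.swap)) =
      (∫ p, f p) + (∫ p, g p) - 1 / 2 * ∫ p, k p := by
  have hk' : Integrable fun p : ℝ × ℝ => k p.swap := by
    rw [Measure.volume_eq_prod] at hk ⊢; exact hk.swap
  have e : ∫ p : ℝ × ℝ, k p.swap = ∫ p, k p := by
    rw [Measure.volume_eq_prod]; exact integral_prod_swap k
  have hkk : Integrable fun p : ℝ × ℝ => 1 / 4 * (k p + k p.swap) := (hk.add hk').const_mul _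
  have hfg : Integrable fun p : ℝ × ℝ => f p + g p := hf.add hg
  rw [integral_sub hfg hkk, integral_add hf hg, integral_const_mul, integral_add hk hk', e]
  ring

lemma integral_pair_truncatedDensity (hS : MeasurableSet S) (hpos : S ⊆ Set.Ioi 0) (y : ℝ) :
    ∫ p : ℝ × ℝ, truncatedDensity S p.1 * truncatedDensity S p.2 *
      (∫ v : ℝ, v * Real.exp (-4 * v ^ 2) * lineKernelPoisson y v p.1 p.2) =
    2 * sinhTransform (truncatedDensity S) y *
      (∫ v in (0 : ℝ)..y, v * Real.exp (-4 * v ^ 2) * sinhTransform (truncatedDensity S) v) -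
    1 / 2 * ∫ u, truncatedDensity S u * coshGap S y u := by
  have hh := superexpDecay_truncatedDensity hS
  simp_rw [truncatedDensity_mul_lineKernelPoisson hpos]
  obtain ⟨ia, ea⟩ := hh.integral_mul_intervalIntegral y
  set h := truncatedDensity S
  set a : ℝ → ℝ := fun u => ∫ v in (0 : ℝ)..y, v * Real.exp (-4 * v ^ 2) * Real.sinh (4 * u * v)
  have is := hh.integrable_sinh (4 * y)
  have e1 : ∀ p : ℝ × ℝ, h p.1 * h p.2 * (Real.sinh (4 * y * p.1) * a p.2 +
      Real.sinh (4 * y * p.2) * a p.1) =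
      (Real.sinh (4 * y * p.1) * h p.1) * (h p.2 * a p.2) +
        (h p.1 * a p.1) * (Real.sinh (4 * y * p.2) * h p.2) := fun p => by ring
  simp only [a] at e1
  simp_rw [e1]
  have i1 := is.mul_prod ia
  have i2 := ia.mul_prod is
  have i3 := hh.integrable_coshGap hS y
  rw [← Measure.volume_eq_prod] at i1 i2 i3
  refine (integral_add_sub_symm i1 i2 i3).trans ?_
  rw [(hh.integral_coshGap hS y).2, Measure.volume_eq_prod,
    integral_prod_mul (fun u => Real.sinh (4 * y * u) * h u) (fun u => h u * a u),
    integral_prod_mul (fun u => h u * a u) (fun u => Real.sinh (4 * y * u) * h u), ea, sinhTransform]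
  ring

/-- After multiplication by 2/Φ, the factorized part of the frequency integral gives 4 ∫₀^y v
e^{-4v²} Φ(v) dv, and the cosh part gives the logarithmic derivative of Φ together with the gap
defect. -/
lemma cauchyTransform_truncatedDensity (hS : MeasurableSet S) (hpos : S ⊆ Set.Ioi 0) {z : ℂ}
    (hz : z.im ≠ 0) (h0 : sinhTransform (truncatedDensity S) z.im ≠ 0)
    (hi : Integrable fun w : ℂ =>
      berezin (translationKernel (sineTransform (truncatedDensity S))) z w / (z - w)) :
    cauchyTransform (translationKernel (sineTransform (truncatedDensity S))) z =
      Complex.I * ((-4 * (∫ v in (0 : ℝ)..z.im, v * Real.exp (-4 * v ^ 2) *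
          sinhTransform (truncatedDensity S) v) +
        (deriv (sinhTransform (truncatedDensity S)) z.im /
            (4 * sinhTransform (truncatedDensity S) z.im) - 1 / (4 * z.im) -
          gapTransform S z.im / sinhTransform (truncatedDensity S) z.im) : ℝ) : ℂ) := by
  rw [(superexpDecay_truncatedDensity hS).cauchyTransform_eq hz
    (integrable_frequencyWeight_mul hS hpos _) hi, integral_pair_truncatedDensity hS hpos,
    integral_coshGap_truncatedDensity hS hpos hz]
  rw [neg_mul, ← mul_neg, ← Complex.ofReal_neg]
  congr 2
  field_simp
  ring_nf

end Truncated

/-! ### Ward's equation for kernels that depend only on the imaginary part -/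

section ImaginaryPart

variable {f : ℂ → ℂ} {g : ℝ → ℝ} {c : ℂ} {z : ℂ} {g' : ℝ}

lemma hasFDerivAt_of_im (hf : f =ᶠ[𝓝 z] fun ζ => c * (g ζ.im : ℂ)) (hg : HasDerivAt g g' z.im) :
    HasFDerivAt f ((c * (g' : ℂ)) • (Complex.ofRealCLM ∘L Complex.imCLM)) z := by
  have h1 : HasFDerivAt (fun ζ : ℂ => g ζ.im) (g' • Complex.imCLM) z :=
    hg.comp_hasFDerivAt z Complex.imCLM.hasFDerivAt
  have h2 := (Complex.ofRealCLM.hasFDerivAt.comp z h1).const_mul c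
  refine (h2.congr_of_eventuallyEq hf).congr_fderiv ?_
  ext ζ
  simp
  ring

lemma wirtingerBar_of_im (hf : f =ᶠ[𝓝 z] fun ζ => c * (g ζ.im : ℂ)) (hg : HasDerivAt g g' z.im) :
    wirtingerBar f z = Complex.I / 2 * c * g' := by
  rw [wirtingerBar, (hasFDerivAt_of_im hf hg).fderiv]
  simp
  ring

lemma wirtinger_of_im (hf : f =ᶠ[𝓝 z] fun ζ => c * (g ζ.im : ℂ)) (hg : HasDerivAt g g' z.im) :
    wirtinger f z = -(Complex.I / 2 * c * g') := by
  rw [wirtinger, (hasFDerivAt_of_im hf hg).fderiv]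
  simp
  ring

lemma quarterLaplacian_of_im {g₁ : ℝ → ℝ} {g₂ : ℝ} (hf : f =ᶠ[𝓝 z] fun ζ => (g ζ.im : ℂ))
    (hg : ∀ᶠ y in 𝓝 z.im, HasDerivAt g (g₁ y) y) (hg₁ : HasDerivAt g₁ g₂ z.im) :
    quarterLaplacian f z = ((g₂ / 4 : ℝ) : ℂ) := by
  have h1 : wirtingerBar f =ᶠ[𝓝 z] fun ζ => Complex.I / 2 * (g₁ ζ.im : ℂ) := by
    filter_upwards [hf.eventually_nhds, Complex.continuous_im.continuousAt.eventually hg]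
      with ζ hζ1 hζ2
    rw [wirtingerBar_of_im (c := 1) (g := g) (hζ1.mono fun x hx => by simpa using hx) hζ2, mul_one]
  rw [quarterLaplacian, wirtinger_of_im h1 hg₁]
  push_cast
  linear_combination (-(g₂ : ℂ) / 4) * Complex.I_sq

end ImaginaryPart

/-! ### The right-hand side of Ward's equation for a sine transform. -/

lemma SuperexpDecay.contDiff_sinhTransform {h : ℝ → ℝ} (hh : SuperexpDecay h) :
    ContDiff ℝ 2 (sinhTransform h) := by
  have h1 : ContDiff ℝ 2 (sineTransform h) := hh.differentiable_sineTransform.contDiff.restrict_scalars ℝ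
  have h2 : ContDiff ℝ 2 fun y : ℝ => 2 * Complex.I * (y : ℂ) :=
    contDiff_const.mul Complex.ofRealCLM.contDiff
  have h3 := Complex.imCLM.contDiff.comp (h1.comp h2)
  have e : (⇑Complex.imCLM ∘ sineTransform h ∘ fun y : ℝ => 2 * Complex.I * (y : ℂ)) =
      sinhTransform h := by
    ext y
    simp [sineTransform_I_mul]
  rwa [e] at h3

lemma SuperexpDecay.differentiable_sinhTransform {h : ℝ → ℝ} (hh : SuperexpDecay h) :
    Differentiable ℝ (sinhTransform h) := hh.contDiff_sinhTransform.differentiable (by norm_num)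

lemma SuperexpDecay.differentiable_deriv_sinhTransform {h : ℝ → ℝ} (hh : SuperexpDecay h) :
    Differentiable ℝ (deriv (sinhTransform h)) :=
  (((contDiff_succ_iff_deriv (n := 1)).1 hh.contDiff_sinhTransform).2.2).differentiable (by norm_num)

/-- The derivative of the logarithmic derivative of `sinhTransform h`. -/
lemma SuperexpDecay.hasDerivAt_logDeriv {h : ℝ → ℝ} (hh : SuperexpDecay h) {y : ℝ}
    (h0 : sinhTransform h y ≠ 0) :
    HasDerivAt (fun s => deriv (sinhTransform h) s / sinhTransform h s)
      (deriv (fun s => deriv (sinhTransform h) s / sinhTransform h s) y) y :=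
  ((hh.differentiable_deriv_sinhTransform y).div (hh.differentiable_sinhTransform y) h0).hasDerivAt

/-- Up to a constant, log R = log y - 4y² + log Φ near z when y > 0, with the real logarithm
ignoring signs otherwise. The Laplacian acts as one quarter of the second y-derivative: the Gaussian
cancels the -1, and 1/(8y²) joins 1/(z - z̄)² = -1/(4y²). -/
lemma SuperexpDecay.ward_rhs_eq {h : ℝ → ℝ} (hh : SuperexpDecay h) {z : ℂ} (hz : z.im ≠ 0)
    (h0 : sinhTransform h z.im ≠ 0) :
    onePoint (translationKernel (sineTransform h)) z - 1 - 1 / 2 * quarterLaplacian (fun ζ =>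
        (Real.log (onePoint (translationKernel (sineTransform h)) ζ).re : ℂ)) z +
        1 / (z - conj z) ^ 2 =
      ((2 * z.im * Real.exp (-4 * z.im ^ 2) * sinhTransform h z.im - 1 / (8 * z.im ^ 2) -
        deriv (fun s => deriv (sinhTransform h) s / sinhTransform h s) z.im / 8 : ℝ) : ℂ) := by
  set Φ := sinhTransform h
  have hlog : quarterLaplacian (fun ζ =>
      (Real.log (onePoint (translationKernel (sineTransform h)) ζ).re : ℂ)) z =
      (((-1 / z.im ^ 2 - 8 + deriv (fun s => deriv Φ s / Φ s) z.im) / 4 : ℝ) : ℂ) := by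
    refine quarterLaplacian_of_im (g := fun y => Real.log (2 * y * Real.exp (-4 * y ^ 2) * Φ y))
      (g₁ := fun y => 1 / y - 8 * y + deriv Φ y / Φ y) (Eventually.of_forall fun ζ => ?_) ?_ ?_
    · simp only [onePoint_sineTransform, Complex.ofReal_re]
      rfl
    · have hΦ : ∀ᶠ y in 𝓝 z.im, Φ y ≠ 0 :=
        (hh.differentiable_sinhTransform.continuous.continuousAt).eventually_ne h0
      have hy : ∀ᶠ y in 𝓝 z.im, y ≠ 0 := eventually_ne_nhds hz
      filter_upwards [hΦ, hy] with y hy1 hy2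
      have d1 : HasDerivAt (fun y : ℝ => Real.exp (-4 * y ^ 2)) (Real.exp (-4 * y ^ 2) * (-8 * y)) y := by
        refine (((hasDerivAt_pow 2 y).const_mul (-4)).exp).congr_deriv ?_
        simp; ring
      have d2 : HasDerivAt (fun y : ℝ => 2 * y) 2 y := by
        simpa using (hasDerivAt_id y).const_mul 2
      have d3 := ((d2.mul d1).mul (hh.differentiable_sinhTransform y).hasDerivAt).log
        (by simp only [Pi.mul_apply]
            have := Real.exp_ne_zero (-4 * y ^ 2)
            positivity)
      refine d3.congr_deriv ?_
      simp only [Pi.mul_apply]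
      have := Real.exp_ne_zero (-4 * y ^ 2)
      change (_ : ℝ) / (2 * y * Real.exp (-4 * y ^ 2) * Φ y) = _
      change ((2 * Real.exp (-4 * y ^ 2) + 2 * y * (Real.exp (-4 * y ^ 2) * (-8 * y))) * Φ y +
        2 * y * Real.exp (-4 * y ^ 2) * deriv Φ y) / (2 * y * Real.exp (-4 * y ^ 2) * Φ y) = _
      generalize Real.exp (-4 * y ^ 2) = E at *
      field_simp
      ring
    · have d1 : HasDerivAt (fun y : ℝ => 1 / y) (-1 / z.im ^ 2) z.im := by
        simpa [neg_div] using hasDerivAt_inv hz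
      have d2 : HasDerivAt (fun y : ℝ => 8 * y) 8 z.im := by
        simpa using (hasDerivAt_id z.im).const_mul 8
      exact (d1.sub d2).add (hh.hasDerivAt_logDeriv h0)
  have hc : z - conj z = 2 * (z.im : ℂ) * Complex.I := by
    apply Complex.ext <;> simp
    ring
  have h2 : (z.im : ℂ) ≠ 0 := by exact_mod_cast hz
  have h3 : (2 * (z.im : ℂ) * Complex.I) ^ 2 = -4 * (z.im : ℂ) ^ 2 := by
    linear_combination (4 * (z.im : ℂ) ^ 2) * Complex.I_sq
  rw [hlog, onePoint_sineTransform, hc, h3]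
  push_cast
  field_simp
  ring

/-! ### Ward's equation for a truncated density as a condition on the gap defect. -/

section Truncated

variable {S : Set ℝ}

/-- The imaginary part of the Cauchy transform, apart from the contribution of the gaps of `S`. -/
lemma hasDerivAt_cauchy_main (hS : MeasurableSet S) {y : ℝ} (hy : y ≠ 0)
    (h0 : sinhTransform (truncatedDensity S) y ≠ 0) :
    HasDerivAt (fun s => -4 * (∫ v in (0 : ℝ)..s, v * Real.exp (-4 * v ^ 2) *
          sinhTransform (truncatedDensity S) v) +
        (deriv (sinhTransform (truncatedDensity S)) s /
            (4 * sinhTransform (truncatedDensity S) s) - 1 / (4 * s)))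
      (-4 * (y * Real.exp (-4 * y ^ 2) * sinhTransform (truncatedDensity S) y) +
        (deriv (fun s => deriv (sinhTransform (truncatedDensity S)) s /
          sinhTransform (truncatedDensity S) s) y / 4 + 1 / (4 * y ^ 2))) y := by
  have hh := superexpDecay_truncatedDensity hS
  have hc := hh.differentiable_sinhTransform.continuous
  have d1 := intervalIntegral.integral_hasDerivAt_right (a := (0 : ℝ)) (b := y)
    (f := fun v => v * Real.exp (-4 * v ^ 2) * sinhTransform (truncatedDensity S) v)
    (Continuous.intervalIntegrable (by fun_prop) _ _)
    (Continuous.stronglyMeasurableAtFilter (by fun_prop) _ _)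
    (Continuous.continuousAt (by fun_prop))
  have d2 : HasDerivAt (fun s : ℝ => 1 / (4 * s)) (-(1 / (4 * y ^ 2))) y := by
    have := (hasDerivAt_inv hy).div_const 4
    refine (this.congr_of_eventuallyEq (Eventually.of_forall fun s => ?_)).congr_deriv ?_
    · simp only [one_div, mul_inv]; ring
    · field_simp
  have d3 := (hh.hasDerivAt_logDeriv h0).div_const 4
  refine ((d1.const_mul (-4)).add ((d3.sub d2).congr_of_eventuallyEq
    (Eventually.of_forall fun s => ?_))).congr_deriv ?_
  · simp only [Pi.sub_apply]
    rw [div_div, mul_comm (sinhTransform _ s) 4]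
  · ring

/-- Under Ward's equation the gap defect is proportional to the one-point function. -/
lemma hasDerivAt_gapTransform_of_ward (hS : MeasurableSet S) (hpos : S ⊆ Set.Ioi 0)
    (hw : WardEquation (translationKernel (sineTransform (truncatedDensity S)))) {y : ℝ}
    (hy : 0 < y) : 0 < sinhTransform (truncatedDensity S) y ∧
      HasDerivAt (fun s => gapTransform S s / sinhTransform (truncatedDensity S) s) 0 y := by
  have hh := superexpDecay_truncatedDensity hS
  set K := translationKernel (sineTransform (truncatedDensity S)) with hK
  set Φ := sinhTransform (truncatedDensity S) with hΦ
  have hΦpos : ∀ s : ℝ, 0 < s → 0 < Φ s := fun s hs => by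
    have h1 := (hw.1 ⟨0, s⟩ hs.ne').1.2
    rw [hK, onePoint_sineTransform, Complex.ofReal_re] at h1
    exact pos_of_mul_pos_right h1 (by positivity)
  refine ⟨hΦpos y hy, ?_⟩
  set m : ℝ → ℝ := fun s => -4 * (∫ v in (0 : ℝ)..s, v * Real.exp (-4 * v ^ 2) * Φ v) +
    (deriv Φ s / (4 * Φ s) - 1 / (4 * s))
  have hC : ∀ ζ : ℂ, 0 < ζ.im → cauchyTransform K ζ =
      Complex.I * ((m ζ.im - gapTransform S ζ.im / Φ ζ.im : ℝ) : ℂ) := fun ζ hζ => by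
    rw [hK, cauchyTransform_truncatedDensity hS hpos hζ.ne' (hΦpos _ hζ).ne' (hw.1 ζ hζ.ne').2]
    congr 2
    simp only [m]
    ring
  obtain ⟨hd, he⟩ := hw.2 ⟨0, y⟩ hy.ne'
  have hdm := hasDerivAt_cauchy_main hS hy.ne' (hΦpos y hy).ne'
  have hev : ∀ᶠ s : ℝ in 𝓝 y, 0 < s := eventually_gt_nhds hy
  -- Differentiability of the gap quotient is not available directly; it is inherited from that of
  -- C, restricted to the imaginary axis.
  have hdc : DifferentiableAt ℝ (fun s => m s - gapTransform S s / Φ s) y := by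
    have d1 : DifferentiableAt ℝ (fun s : ℝ => Complex.I * (s : ℂ)) y :=
      (Complex.ofRealCLM.differentiableAt).const_mul _
    have e0 : Complex.I * (y : ℂ) = ⟨0, y⟩ := by apply Complex.ext <;> simp
    have hd' : DifferentiableAt ℝ (cauchyTransform K) ((fun s : ℝ => Complex.I * (s : ℂ)) y) := by
      simpa only [e0] using hd
    have d2 : DifferentiableAt ℝ (fun s : ℝ => cauchyTransform K (Complex.I * (s : ℂ))) y :=
      DifferentiableAt.comp (g := cauchyTransform K) (f := fun s : ℝ => Complex.I * (s : ℂ)) y hd' d1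
    have d3 : DifferentiableAt ℝ (fun s : ℝ => (cauchyTransform K (Complex.I * (s : ℂ))).im) y :=
      Complex.imCLM.differentiableAt.comp y d2
    refine d3.congr_of_eventuallyEq ?_
    filter_upwards [hev] with s hs
    rw [hC _ (by simpa using hs)]
    simp
  have hCev : cauchyTransform K =ᶠ[𝓝 (⟨0, y⟩ : ℂ)] fun ζ =>
      Complex.I * ((m ζ.im - gapTransform S ζ.im / Φ ζ.im : ℝ) : ℂ) := by
    have : ∀ᶠ ζ in 𝓝 (⟨0, y⟩ : ℂ), 0 < ζ.im :=
      Complex.continuous_im.continuousAt.eventually hev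
    filter_upwards [this] with ζ hζ using hC ζ hζ
  have hbar := wirtingerBar_of_im (z := ⟨0, y⟩) (g := fun s => m s - gapTransform S s / Φ s)
    hCev hdc.hasDerivAt
  rw [hbar, hh.ward_rhs_eq hy.ne' (hΦpos y hy).ne'] at he
  have he2 : (-(1 / 2 * deriv (fun s => m s - gapTransform S s / Φ s) y) : ℝ) =
      2 * y * Real.exp (-4 * y ^ 2) * Φ y - 1 / (8 * y ^ 2) -
        deriv (fun s => deriv Φ s / Φ s) y / 8 := by
    have : Complex.I / 2 * Complex.I *
        ((deriv (fun s => m s - gapTransform S s / Φ s) y : ℝ) : ℂ) =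
        ((-(1 / 2 * deriv (fun s => m s - gapTransform S s / Φ s) y) : ℝ) : ℂ) := by
      push_cast
      linear_combination (1 / 2 * ((deriv (fun s => m s - gapTransform S s / Φ s) y : ℝ) : ℂ)) *
        Complex.I_sq
    rw [this] at he
    exact_mod_cast he
  -- The quotient is m - (m - quotient). The derivative of m is explicit, and that of the second
  -- term is prescribed by Ward's equation; the two agree.
  have hgap := hdm.sub hdc.hasDerivAt
  refine (hgap.congr_of_eventuallyEq (Eventually.of_forall fun s => ?_)).congr_deriv ?_
  · simp only [Pi.sub_apply]
    change _ = m s - (m s - _)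
    ring
  · have h8 : 1 / (8 * y ^ 2) = 1 / (4 * y ^ 2) / 2 := by field_simp; norm_num
    rw [h8] at he2
    linarith

lemma wardEquation_of_gapTransform_eq_zero (hS : MeasurableSet S) (hpos : S ⊆ Set.Ioi 0)
    (hΦ : ∀ y, y ≠ 0 → 0 < y * sinhTransform (truncatedDensity S) y)
    (hi : ∀ z : ℂ, z.im ≠ 0 → Integrable fun w : ℂ =>
      berezin (translationKernel (sineTransform (truncatedDensity S))) z w / (z - w))
    (h0 : ∀ y, gapTransform S y = 0) :
    WardEquation (translationKernel (sineTransform (truncatedDensity S))) := by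
  have hh := superexpDecay_truncatedDensity hS
  have hΦ0 : ∀ y, y ≠ 0 → sinhTransform (truncatedDensity S) y ≠ 0 := fun y hy h => by
    have := hΦ y hy
    rw [h, mul_zero] at this
    exact lt_irrefl _ this
  refine ⟨fun z hz => ⟨?_, hi z hz⟩, fun z hz => ?_⟩
  · rw [onePoint_sineTransform, Complex.ofReal_im, Complex.ofReal_re]
    refine ⟨rfl, ?_⟩
    have := hΦ z.im hz
    have h2 := Real.exp_pos (-4 * z.im ^ 2)
    calc (0 : ℝ) < 2 * Real.exp (-4 * z.im ^ 2) * (z.im * sinhTransform (truncatedDensity S) z.im) := by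
          positivity
      _ = _ := by ring
  · have hC : cauchyTransform (translationKernel (sineTransform (truncatedDensity S))) =ᶠ[𝓝 z]
        fun ζ => Complex.I * ((-4 * (∫ v in (0 : ℝ)..ζ.im, v * Real.exp (-4 * v ^ 2) *
          sinhTransform (truncatedDensity S) v) +
        (deriv (sinhTransform (truncatedDensity S)) ζ.im /
            (4 * sinhTransform (truncatedDensity S) ζ.im) - 1 / (4 * ζ.im)) : ℝ) : ℂ) := by
      have : ∀ᶠ ζ in 𝓝 z, ζ.im ≠ 0 := Complex.continuous_im.continuousAt.eventually_ne hz
      filter_upwards [this] with ζ hζ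
      rw [cauchyTransform_truncatedDensity hS hpos hζ (hΦ0 _ hζ) (hi ζ hζ), h0, zero_div, sub_zero]
    have hd := hasDerivAt_cauchy_main hS hz (hΦ0 _ hz)
    refine ⟨(hasFDerivAt_of_im (g := fun s => -4 * (∫ v in (0 : ℝ)..s, v * Real.exp (-4 * v ^ 2) *
          sinhTransform (truncatedDensity S) v) +
        (deriv (sinhTransform (truncatedDensity S)) s /
            (4 * sinhTransform (truncatedDensity S) s) - 1 / (4 * s))) hC hd).differentiableAt, ?_⟩
    rw [hh.ward_rhs_eq hz (hΦ0 _ hz), wirtingerBar_of_im (g := fun s => -4 * (∫ v in (0 : ℝ)..s,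
        v * Real.exp (-4 * v ^ 2) * sinhTransform (truncatedDensity S) v) +
        (deriv (sinhTransform (truncatedDensity S)) s /
            (4 * sinhTransform (truncatedDensity S) s) - 1 / (4 * s))) hC hd]
    have h2 : (z.im : ℂ) ≠ 0 := by exact_mod_cast hz
    rw [show Complex.I / 2 * Complex.I = -(1 / 2) by linear_combination (1 / 2) * Complex.I_sq]
    push_cast
    field_simp
    ring

end Truncated

/-! ### Sets without gaps -/

section Truncated

variable {S : Set ℝ}

lemma coshGap_nonneg (T : Set ℝ) (y u : ℝ) : 0 ≤ coshGap T y u :=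
  integral_nonneg fun u' => (coshGap_integrand_bounds T y u u').1

lemma integrable_coshGap_integrand {T : Set ℝ} (hT : MeasurableSet T) (y u : ℝ) :
    Integrable fun u' => (Set.Ioc 0 u ∩ T).indicator
      (fun u' => Real.cosh (4 * y * u) - Real.cosh (4 * y * u')) u' := by
  refine (integrable_indicator_iff (measurableSet_Ioc.inter hT)).2 ?_
  exact (Continuous.integrableOn_Ioc (by fun_prop)).mono_set Set.inter_subset_left

lemma coshGap_le {T : Set ℝ} (hT : MeasurableSet T) (y u : ℝ) :
    coshGap T y u ≤ 16 * Real.pi * y ^ 2 * (Real.exp ((4 * |y| + 2) * |u|) * |u|) := by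
  refine (integral_mono (integrable_coshGap_integrand hT y u)
    (integrable_inv_one_add_sq.const_mul _) fun u' => (coshGap_integrand_bounds T y u u').2).trans ?_
  rw [integral_const_mul, integral_univ_inv_one_add_sq]
  have := mul_le_mul_of_nonneg_right (sinh_sq_mul_le y u) Real.pi_pos.le
  linarith

lemma gapTransform_nonneg (hpos : S ⊆ Set.Ioi 0) (y : ℝ) : 0 ≤ gapTransform S y :=
  integral_nonneg fun u => mul_nonneg (truncatedDensity_nonneg hpos u) (coshGap_nonneg _ _ _)

/-- Differences of cosh are quadratic in y near 0, whereas Φ is bounded below by a multiple of y;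
this forces the gap quotient to tend to 0. -/
lemma exists_gapTransform_le (hS : MeasurableSet S) (hpos : S ⊆ Set.Ioi 0) :
    ∃ M, 0 ≤ M ∧ ∀ y, 0 < y → y ≤ 1 → gapTransform S y ≤ M * y ^ 2 := by
  have hh := superexpDecay_truncatedDensity hS
  refine ⟨∫ u, 16 * Real.pi * ‖Real.exp (6 * |u|) * (u * truncatedDensity S u)‖,
    integral_nonneg fun u => by positivity, fun y hy hy1 => ?_⟩
  rw [← integral_mul_const]
  refine integral_mono (hh.integral_coshGap hS.compl y).1
    (((hh 6).norm.const_mul _).mul_const _) fun u => ?_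
  have h0 := truncatedDensity_nonneg hpos u
  simp only [norm_mul, Real.norm_eq_abs, Real.abs_exp, abs_of_nonneg h0]
  calc truncatedDensity S u * coshGap Sᶜ y u
      ≤ truncatedDensity S u *
        (16 * Real.pi * y ^ 2 * (Real.exp ((4 * |y| + 2) * |u|) * |u|)) := by
        gcongr; exact coshGap_le hS.compl y u
    _ ≤ truncatedDensity S u * (16 * Real.pi * y ^ 2 * (Real.exp (6 * |u|) * |u|)) := by
        gcongr
        rw [abs_of_pos hy]; linarith
    _ = _ := by ring

lemma integral_mul_truncatedDensity_pos (hS : MeasurableSet S) (hpos : S ⊆ Set.Ioi 0)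
    (h1 : 0 < sinhTransform (truncatedDensity S) 1) : 0 < ∫ u, u * truncatedDensity S u := by
  have hh := superexpDecay_truncatedDensity hS
  have h0 : ∀ u, 0 ≤ u * truncatedDensity S u := fun u => by
    rcases le_or_gt u 0 with hu | hu
    · simp [truncatedDensity_of_nonpos hpos hu]
    · exact mul_nonneg hu.le (truncatedDensity_nonneg hpos u)
  refine (integral_nonneg h0).lt_of_ne fun h => ?_
  have h2 := (integral_eq_zero_iff_of_nonneg h0 hh.integrable_mul).1 h.symm
  have h3 : sinhTransform (truncatedDensity S) 1 = 0 := by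
    rw [sinhTransform]
    refine integral_eq_zero_of_ae ?_
    filter_upwards [h2] with u hu
    rcases mul_eq_zero.1 hu with hu | hu <;> simp [hu]
  exact h1.ne' h3

lemma le_sinhTransform_truncatedDensity (hS : MeasurableSet S) (hpos : S ⊆ Set.Ioi 0) {y : ℝ}
    (hy : 0 < y) : 4 * y * ∫ u, u * truncatedDensity S u ≤ sinhTransform (truncatedDensity S) y := by
  have hh := superexpDecay_truncatedDensity hS
  rw [← integral_const_mul]
  refine integral_mono (hh.integrable_mul.const_mul _) (hh.integrable_sinh _) fun u => ?_
  rcases le_or_gt u 0 with hu | hu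
  · simp [truncatedDensity_of_nonpos hpos hu]
  · have h1 : 4 * y * u ≤ Real.sinh (4 * y * u) := Real.self_le_sinh_iff.2 (by positivity)
    have := mul_le_mul_of_nonneg_right h1 (truncatedDensity_nonneg hpos u)
    simp only
    linarith

/-- A gap defect that is proportional to `sinhTransform` vanishes. -/
lemma gapTransform_eq_zero (hS : MeasurableSet S) (hpos : S ⊆ Set.Ioi 0)
    (h : ∀ y : ℝ, 0 < y → 0 < sinhTransform (truncatedDensity S) y ∧
      HasDerivAt (fun s => gapTransform S s / sinhTransform (truncatedDensity S) s) 0 y) {y : ℝ}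
    (hy : 0 < y) : gapTransform S y = 0 := by
  set Φ := sinhTransform (truncatedDensity S)
  obtain ⟨M, hM0, hM⟩ := exists_gapTransform_le hS hpos
  set c := ∫ u, u * truncatedDensity S u
  have hc : 0 < c := integral_mul_truncatedDensity_pos hS hpos (h 1 one_pos).1
  have hconst : ∀ s, 0 < s → gapTransform S s / Φ s = gapTransform S y / Φ y := fun s hs =>
    isOpen_Ioi.is_const_of_deriv_eq_zero (s := Set.Ioi (0 : ℝ)) isPreconnected_Ioi
      (fun x hx => (h x hx).2.differentiableAt.differentiableWithinAt)
      (fun x hx => (h x hx).2.deriv) hs hy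
  -- The quotient is constant in s, but is at most Ms²/(4cs) for small s, so its value is at most
  -- the limit 0.
  have hle : ∀ s : ℝ, 0 < s → s ≤ 1 → gapTransform S y / Φ y ≤ M / (4 * c) * s := fun s hs hs1 => by
    rw [← hconst s hs, div_le_iff₀ (h s hs).1]
    refine (hM s hs hs1).trans ?_
    have := le_sinhTransform_truncatedDensity hS hpos hs
    calc M * s ^ 2 = M / (4 * c) * s * (4 * s * c) := by field_simp
      _ ≤ _ := by gcongr
  have h0 : gapTransform S y / Φ y ≤ 0 := by
    have ht : Tendsto (fun s : ℝ => M / (4 * c) * s) (𝓝[>] 0) (𝓝 0) := by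
      have : Tendsto (fun s : ℝ => M / (4 * c) * s) (𝓝 0) (𝓝 (M / (4 * c) * 0)) :=
        (continuous_const.mul continuous_id).tendsto 0
      rw [mul_zero] at this
      exact this.mono_left nhdsWithin_le_nhds
    refine ge_of_tendsto ht ?_
    filter_upwards [Ioc_mem_nhdsGT one_pos] with s hs using hle s hs.1 hs.2
  have h1 := gapTransform_nonneg hpos y
  have h2 := (div_le_iff₀ (h y hy).1).1 h0
  rw [zero_mul] at h2
  exact le_antisymm h2 h1

/-- The integrand is nonnegative, and strictly positive at gap points u' < u because cosh is
strictly increasing on (0,∞) and y ≠ 0. -/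
lemma volume_gap_eq_zero_of_coshGap_eq_zero (hS : MeasurableSet S) {y u : ℝ} (hy : y ≠ 0)
    (h : coshGap Sᶜ y u = 0) : volume (Set.Ioc 0 u \ S) = 0 := by
  have h1 := (integral_eq_zero_iff_of_nonneg
    (fun u' => (coshGap_integrand_bounds Sᶜ y u u').1)
    (integrable_coshGap_integrand hS.compl y u)).1 h
  have h2 : ∀ᵐ u', u' ∉ Set.Ioc 0 u \ S := by
    filter_upwards [h1, compl_mem_ae_iff.2 (measure_singleton u)] with u' h3 h4 h5
    have h6 : u' ∈ Set.Ioc 0 u ∩ Sᶜ := h5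
    rw [Set.indicator_of_mem h6] at h3
    have h7 : u' < u := lt_of_le_of_ne h5.1.2 h4
    have h8 : Real.cosh (4 * y * u') < Real.cosh (4 * y * u) := by
      rw [Real.cosh_lt_cosh, abs_mul, abs_mul _ u, abs_of_pos h5.1.1,
        abs_of_pos (h5.1.1.trans h7)]
      gcongr
    simp only [Pi.zero_apply] at h3
    linarith
  exact measure_eq_zero_iff_ae_notMem.2 h2

/-- A set of positive measure without gaps is an initial interval up to a null set. -/
lemma ae_eq_interval_of_volume_gap (hpos : S ⊆ Set.Ioi 0) (h0 : volume S ≠ 0)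
    (h : ∀ᵐ u, u ∈ S → volume (Set.Ioc 0 u \ S) = 0) :
    ∃ a : EReal, 0 < a ∧ S =ᵐ[volume] {u : ℝ | 0 < u ∧ (u : EReal) < a} := by
  set G : Set ℝ := {u | u ∈ S ∧ volume (Set.Ioc 0 u \ S) = 0}
  have hG : ∀ᵐ u, u ∈ S → u ∈ G := by
    filter_upwards [h] with u hu hS using ⟨hS, hu hS⟩
  have hne : G.Nonempty := by
    by_contra hempty
    rw [Set.not_nonempty_iff_eq_empty] at hempty
    refine h0 (measure_eq_zero_iff_ae_notMem.2 ?_)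
    filter_upwards [hG] with u hu hS
    have := hu hS
    rw [hempty] at this
    exact this
  obtain ⟨g, hg⟩ := hne
  -- The right endpoint is the supremum of the points of S below which there is no gap, taken in the
  -- extended reals so that it may be infinite.
  refine ⟨sSup ((fun u : ℝ => (u : EReal)) '' G), ?_, ?_⟩
  · have h1 : (0 : EReal) < (g : EReal) := by exact_mod_cast hpos hg.1
    exact h1.trans_le (le_sSup ⟨g, hg, rfl⟩)
  · set a := sSup ((fun u : ℝ => (u : EReal)) '' G)
    -- Below the supremum the set S has full measure: the rationals q < a give countably many
    -- intervals (0,q], each contained in (0,g] for some gap-free g.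
    have hsub : volume ({u : ℝ | 0 < u ∧ (u : EReal) < a} \ S) = 0 := by
      have hcov : {u : ℝ | 0 < u ∧ (u : EReal) < a} \ S ⊆
          ⋃ q : {q : ℚ // ((q : ℝ) : EReal) < a}, Set.Ioc 0 ((q : ℚ) : ℝ) \ S := by
        rintro u ⟨⟨hu0, hua⟩, huS⟩
        obtain ⟨q, hq1, hq2⟩ := EReal.lt_iff_exists_rat_btwn.1 hua
        refine Set.mem_iUnion.2 ⟨⟨q, hq2⟩, ⟨hu0, ?_⟩, huS⟩
        exact (EReal.coe_lt_coe_iff.1 hq1).le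
      refine measure_mono_null hcov (measure_iUnion_null fun q => ?_)
      obtain ⟨_, ⟨g, hg, rfl⟩, hqg⟩ := lt_sSup_iff.1 q.2
      refine measure_mono_null ?_ hg.2
      have : ((q : ℚ) : ℝ) ≤ g := (EReal.coe_lt_coe_iff.1 hqg).le
      exact Set.sdiff_subset_sdiff_left (Set.Ioc_subset_Ioc_right this)
    have h1 : ∀ᵐ u : ℝ, u ∉ {u : ℝ | 0 < u ∧ (u : EReal) < a} \ S :=
      measure_eq_zero_iff_ae_notMem.1 hsub
    have h2 : ∀ᵐ u : ℝ, u ≠ a.toReal := compl_mem_ae_iff.2 (measure_singleton _)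
    filter_upwards [h1, h2, hG] with u hu1 hu2 hu3
    refine propext ⟨fun hu => ⟨hpos hu, ?_⟩, fun hu => ?_⟩
    · have h3 : (u : EReal) ≤ a := le_sSup ⟨u, hu3 hu, rfl⟩
      refine lt_of_le_of_ne h3 fun h4 => hu2 ?_
      rw [← h4, EReal.toReal_coe]
    · by_contra hS
      exact hu1 ⟨hu, hS⟩

/-- Ward's equation forces the density to live on an initial interval. -/
lemma ae_eq_interval_of_ward (hS : MeasurableSet S) (hpos : S ⊆ Set.Ioi 0)
    (hw : WardEquation (translationKernel (sineTransform (truncatedDensity S)))) :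
    ∃ a : EReal, 0 < a ∧ S =ᵐ[volume] {u : ℝ | 0 < u ∧ (u : EReal) < a} := by
  have hh := superexpDecay_truncatedDensity hS
  have hD := fun y hy => hasDerivAt_gapTransform_of_ward hS hpos hw (y := y) hy
  refine ae_eq_interval_of_volume_gap hpos (fun h0 => ?_) ?_
  · have h1 : sinhTransform (truncatedDensity S) 1 = 0 := by
      rw [sinhTransform]
      refine integral_eq_zero_of_ae ?_
      filter_upwards [measure_eq_zero_iff_ae_notMem.1 h0] with u hu
      simp [truncatedDensity, hu]
    exact (hD 1 one_pos).1.ne' h1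
  · have h1 := gapTransform_eq_zero hS hpos hD one_pos
    have h2 := (integral_eq_zero_iff_of_nonneg (fun u =>
      mul_nonneg (truncatedDensity_nonneg hpos u) (coshGap_nonneg _ _ _))
      (hh.integral_coshGap hS.compl 1).1).1 h1
    filter_upwards [h2] with u hu huS
    have h3 : truncatedDensity S u ≠ 0 := by
      rw [truncatedDensity, Set.indicator_of_mem huS]
      have : 0 < u := hpos huS
      positivity
    exact volume_gap_eq_zero_of_coshGap_eq_zero hS one_ne_zero
      ((mul_eq_zero.1 hu).resolve_left h3)

end Truncated

/-! ### Fourier inversion and the forward implication -/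

lemma integral_eq_two_mul_of_even {f : ℝ → ℂ} (he : ∀ u, f (-u) = f u) (hi : Integrable f) :
    ∫ u, f u = 2 * ∫ u in Set.Ioi (0 : ℝ), f u := by
  have h1 := intervalIntegral.integral_Iic_add_Ioi (hi.integrableOn (s := Set.Iic (0 : ℝ)))
    (hi.integrableOn (s := Set.Ioi (0 : ℝ)))
  have h2 := integral_comp_neg_Ioi (0 : ℝ) f
  simp_rw [he, neg_zero] at h2
  rw [← h1, ← h2]; ring

/-- The interval `(0, a)` for an extended real `a`. -/
def initialInterval (a : EReal) : Set ℝ := {u : ℝ | 0 < u ∧ (u : EReal) < a}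

lemma measurableSet_initialInterval (a : EReal) : MeasurableSet (initialInterval a) :=
  measurableSet_Ioi.inter (measurable_coe_real_ereal measurableSet_Iio)

lemma initialInterval_subset (a : EReal) : initialInterval a ⊆ Set.Ioi 0 := fun _ hu => hu.1

lemma sineTransform_congr {h k : ℝ → ℝ} (hk : h =ᵐ[volume] k) : sineTransform h = sineTransform k := by
  ext z
  refine integral_congr_ae ?_
  filter_upwards [hk] with u hu
  rw [hu]

lemma truncatedDensity_congr {S T : Set ℝ} (h : S =ᵐ[volume] T) :
    truncatedDensity S =ᵐ[volume] truncatedDensity T := by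
  filter_upwards [h] with u hu
  have : u ∈ S ↔ u ∈ T := iff_of_eq hu
  by_cases hS : u ∈ S
  · simp [truncatedDensity, hS, this.1 hS]
  · simp [truncatedDensity, hS, mt this.2 hS]

lemma sineTransform_initialInterval {a : EReal} (ha : 0 < a) (z : ℂ) :
    sineTransform (truncatedDensity (initialInterval a)) z = 1 / (√Real.pi : ℂ) *
      ∫ u in {u : ℝ | -a < (u : EReal) ∧ (u : EReal) < a},
        Complex.exp (-(u : ℂ) ^ 2) * Complex.sin (2 * u * z) / u := by
  have hsq : (√Real.pi : ℂ) ≠ 0 := by exact_mod_cast (Real.sqrt_pos.2 Real.pi_pos).ne'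
  set E : Set ℝ := {u : ℝ | -a < (u : EReal) ∧ (u : EReal) < a} with hE
  have hEm : MeasurableSet E :=
    (measurable_coe_real_ereal measurableSet_Ioi).inter (measurable_coe_real_ereal measurableSet_Iio)
  set f : ℝ → ℂ := fun u => Complex.exp (-(u : ℂ) ^ 2) * Complex.sin (2 * u * z) / u
  have e : ∀ u, (Set.Ioi 0).indicator (E.indicator f) u = (√Real.pi : ℂ) / 2 *
      (Complex.sin (2 * z * u) * truncatedDensity (initialInterval a) u) := fun u => by
    by_cases hu : u ∈ initialInterval a
    · have h1 : u ∈ E := by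
        refine ⟨?_, hu.2⟩
        have h2 : -a < 0 := EReal.neg_lt_comm.1 (by simpa using ha)
        exact h2.trans (by exact_mod_cast hu.1)
      rw [Set.indicator_of_mem (show u ∈ Set.Ioi (0 : ℝ) from hu.1), Set.indicator_of_mem h1,
        truncatedDensity, Set.indicator_of_mem hu]
      simp only [f]
      push_cast
      rw [show 2 * (u : ℂ) * z = 2 * z * u by ring]
      field_simp
    · rw [truncatedDensity, Set.indicator_of_notMem hu, Complex.ofReal_zero, mul_zero, mul_zero]
      by_cases h0 : u ∈ Set.Ioi (0 : ℝ)
      · rw [Set.indicator_of_mem h0, Set.indicator_of_notMem fun h => hu ⟨h0, h.2⟩]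
      · exact Set.indicator_of_notMem h0 _
  have hfe : ∀ u, E.indicator f (-u) = E.indicator f u := fun u => by
    have hiff : -u ∈ E ↔ u ∈ E := by
      simp only [hE, Set.mem_ofPred_eq, EReal.coe_neg, EReal.neg_lt_neg_iff]
      rw [and_comm]
      refine and_congr ?_ Iff.rfl
      exact EReal.neg_lt_comm
    by_cases hu : u ∈ E
    · rw [Set.indicator_of_mem hu, Set.indicator_of_mem (hiff.2 hu)]
      simp only [f]
      push_cast
      rw [show 2 * -(u : ℂ) * z = -(2 * u * z) by ring, Complex.sin_neg, neg_sq, mul_neg,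
        neg_div_neg_eq]
    · rw [Set.indicator_of_notMem hu, Set.indicator_of_notMem (mt hiff.1 hu)]
  have hi : Integrable (E.indicator f) := by
    refine integrable_of_even hfe ((integrable_indicator_iff measurableSet_Ioi).1 ?_)
    refine (((superexpDecay_truncatedDensity
      (measurableSet_initialInterval a)).integrable_sin z).const_mul ((√Real.pi : ℂ) / 2)).congr
      (Eventually.of_forall fun u => (e u).symm)
  rw [← integral_indicator hEm, integral_eq_two_mul_of_even hfe hi,
    ← integral_indicator measurableSet_Ioi]
  simp_rw [e]
  rw [integral_const_mul, sineTransform]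
  field_simp

/-! ### Principal values of odd densities as sine integrals. -/

section Inversion

variable {J : ℝ → ℂ}

lemma aestronglyMeasurable_of_integrable_exp_mul
    (hi : ∀ c : ℝ, Integrable (fun u : ℝ => (Real.exp (c * |u|) : ℂ) * ((u : ℂ) * J u))) :
    AEStronglyMeasurable J := by
  have h0 := hi 0
  simp only [zero_mul, Real.exp_zero, Complex.ofReal_one, one_mul] at h0
  have h1 : AEStronglyMeasurable (fun u : ℝ => (u : ℂ)⁻¹ * ((u : ℂ) * J u)) :=
    AEStronglyMeasurable.mul (Measurable.aestronglyMeasurable (by fun_prop)) h0.1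
  refine h1.congr ?_
  filter_upwards [compl_mem_ae_iff.2 (measure_singleton (0 : ℝ))] with u hu
  have : (u : ℂ) ≠ 0 := Complex.ofReal_ne_zero.2 hu
  field_simp

lemma integrable_sin_mul
    (hi : ∀ c : ℝ, Integrable (fun u : ℝ => (Real.exp (c * |u|) : ℂ) * ((u : ℂ) * J u))) (z : ℂ) :
    Integrable fun u : ℝ => Complex.sin (z * u) * J u := by
  have hJ := aestronglyMeasurable_of_integrable_exp_mul hi
  refine ((hi |z.im|).norm.const_mul ‖z‖).mono' (AEStronglyMeasurable.mul (by fun_prop) hJ)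
    (Eventually.of_forall fun u => ?_)
  have h1 := norm_sin_le_norm_mul_exp (z * u)
  rw [norm_mul, Complex.norm_real, show (z * (u : ℂ)).im = z.im * u by simp, abs_mul] at h1
  rw [norm_mul, norm_mul, norm_mul, Complex.norm_real, Complex.norm_real,
    Real.norm_of_nonneg (Real.exp_nonneg _)]
  calc _ ≤ ‖z‖ * ‖u‖ * Real.exp (|z.im| * |u|) * ‖J u‖ := by gcongr
    _ = _ := by ring

/-- For odd `J` the principal value is an absolutely convergent sine integral. -/
lemma tendsto_inversion (hodd : ∀ u, J (-u) = -J u)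
    (hi : ∀ c : ℝ, Integrable (fun u : ℝ => (Real.exp (c * |u|) : ℂ) * ((u : ℂ) * J u))) (z : ℂ) :
    Tendsto (fun ε : ℝ => 1 / (2 * (Real.pi : ℂ)) *
        ∫ u in {u : ℝ | ε < |u|}, Complex.exp (Complex.I * z * u) * J u)
      (𝓝[>] 0) (𝓝 (Complex.I / (2 * Real.pi) * ∫ u : ℝ, Complex.sin (z * u) * J u)) := by
  have hs := integrable_sin_mul hi z
  have hJ := aestronglyMeasurable_of_integrable_exp_mul hi
  have hset : ∀ ε : ℝ, MeasurableSet {u : ℝ | ε < |u|} := fun ε =>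
    measurableSet_lt measurable_const (by fun_prop)
  have h1 : ∀ ε : ℝ, 0 < ε → ∫ u in {u : ℝ | ε < |u|}, Complex.exp (Complex.I * z * u) * J u =
      Complex.I * ∫ u : ℝ, {u : ℝ | ε < |u|}.indicator (fun u => Complex.sin (z * u) * J u) u :=
    fun ε hε => by
      set F : ℝ → ℂ := {u : ℝ | ε < |u|}.indicator fun u => Complex.exp (Complex.I * z * u) * J u
      have hF : Integrable F := by
        refine ((hi ‖z‖).norm.const_mul ε⁻¹).mono'
          (AEStronglyMeasurable.indicator (AEStronglyMeasurable.mul (by fun_prop) hJ) (hset ε))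
          (Eventually.of_forall fun u => ?_)
        by_cases hu : u ∈ {u : ℝ | ε < |u|}
        · simp only [F]
          have hu' : ε < |u| := hu
          rw [Set.indicator_of_mem hu, norm_mul, Complex.norm_exp, norm_mul, norm_mul,
            Complex.norm_real, Complex.norm_real, Real.norm_of_nonneg (Real.exp_nonneg _)]
          have h2 : (Complex.I * z * (u : ℂ)).re ≤ ‖z‖ * |u| := by
            refine (Complex.re_le_norm _).trans (le_of_eq ?_)
            simp
          have h3 : 1 ≤ ε⁻¹ * ‖u‖ := by
            rw [Real.norm_eq_abs, inv_mul_eq_div, one_le_div hε]; exact hu'.le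
          calc _ ≤ Real.exp (‖z‖ * |u|) * ‖J u‖ * 1 := by
                rw [mul_one]; gcongr
            _ ≤ Real.exp (‖z‖ * |u|) * ‖J u‖ * (ε⁻¹ * ‖u‖) := by gcongr
            _ = _ := by ring
        · simp only [F]
          rw [Set.indicator_of_notMem hu, norm_zero]
          positivity
      rw [← integral_indicator (hset ε)]
      -- Since J is odd, adding the values at ±u turns the exponential into a sine, which cancels
      -- the 1/u singularity and removes the need for a principal value.
      have e : ∀ u, F u + F (-u) = 2 * (Complex.I *
          {u : ℝ | ε < |u|}.indicator (fun u => Complex.sin (z * u) * J u) u) := fun u => by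
        simp only [F]
        by_cases hu : u ∈ {u : ℝ | ε < |u|}
        · have hu' : -u ∈ {u : ℝ | ε < |u|} := by
            change ε < |-u|
            rw [abs_neg]; exact hu
          rw [Set.indicator_of_mem hu, Set.indicator_of_mem hu', Set.indicator_of_mem hu, hodd,
            Complex.sin]
          push_cast
          rw [show Complex.I * z * (u : ℂ) = z * u * Complex.I by ring,
            show Complex.I * z * -(u : ℂ) = -(z * u) * Complex.I by ring]
          linear_combination ((Complex.exp (z * u * Complex.I) -
            Complex.exp (-(z * u) * Complex.I)) * J u) * Complex.I_sq
        · have hu' : -u ∉ {u : ℝ | ε < |u|} := by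
            change ¬ ε < |-u|
            rw [abs_neg]; exact hu
          rw [Set.indicator_of_notMem hu, Set.indicator_of_notMem hu', Set.indicator_of_notMem hu]
          simp
      have h2 : ∫ u, (F u + F (-u)) = 2 * ∫ u, F u := by
        rw [integral_add hF hF.comp_neg, integral_neg_eq_self F]; ring
      simp_rw [e] at h2
      rw [integral_const_mul, integral_const_mul] at h2
      exact (mul_left_cancel₀ two_ne_zero h2).symm
  have h2 : Tendsto (fun ε : ℝ =>
      ∫ u : ℝ, {u : ℝ | ε < |u|}.indicator (fun u => Complex.sin (z * u) * J u) u)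
      (𝓝[>] 0) (𝓝 (∫ u : ℝ, Complex.sin (z * u) * J u)) := by
    refine tendsto_integral_filter_of_dominated_convergence (fun u => ‖Complex.sin (z * u) * J u‖)
      (Eventually.of_forall fun ε => hs.1.indicator (hset ε))
      (Eventually.of_forall fun ε => Eventually.of_forall fun u => norm_indicator_le_norm_self _ _)
      hs.norm (Eventually.of_forall fun u => ?_)
    rcases eq_or_ne u 0 with rfl | hu
    · simp [Set.indicator]
    · refine tendsto_const_nhds.congr' ?_
      filter_upwards [Ioo_mem_nhdsGT (abs_pos.2 hu)] with ε hε
      rw [Set.indicator_of_mem (show u ∈ {u : ℝ | ε < |u|} from hε.2)]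
  have h3 := (h2.const_mul (Complex.I)).const_mul (1 / (2 * (Real.pi : ℂ)))
  have e3 : 1 / (2 * (Real.pi : ℂ)) * (Complex.I * ∫ u : ℝ, Complex.sin (z * u) * J u) =
      Complex.I / (2 * Real.pi) * ∫ u : ℝ, Complex.sin (z * u) * J u := by ring
  rw [e3] at h3
  refine h3.congr' ?_
  filter_upwards [self_mem_nhdsWithin] with ε hε
  rw [h1 ε hε]

end Inversion

/-! ### The forward implication -/

section Forward

variable {J : ℝ → ℂ}

lemma superexpDecay_im
    (hi : ∀ c : ℝ, Integrable (fun u : ℝ => (Real.exp (c * |u|) : ℂ) * ((u : ℂ) * J u))) (s : ℂ) :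
    SuperexpDecay fun u => (s * J (2 * u)).im := by
  intro c
  have h1 := ((((hi (c / 2)).comp_mul_left' (two_ne_zero)).const_mul (s / 2)).im)
  refine h1.congr (Eventually.of_forall fun u => ?_)
  have h2 : c / 2 * |2 * u| = c * |u| := by rw [abs_mul, abs_two]; ring
  simp only [h2, RCLike.im_to_complex]
  have h3 : s / 2 * ((Real.exp (c * |u|) : ℂ) * (((2 * u : ℝ) : ℂ) * J (2 * u))) =
      ((Real.exp (c * |u|) * u : ℝ) : ℂ) * (s * J (2 * u)) := by
    push_cast; ring
  rw [h3, Complex.im_ofReal_mul]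
  ring

lemma memLp_two_im (hi : ∀ c : ℝ,
      Integrable (fun u : ℝ => (Real.exp (c * |u|) : ℂ) * ((u : ℂ) * J u)))
    (h2 : MemLp (fun u : ℝ => ((u / (1 + |u|) : ℝ) : ℂ) * J u) 2) (s : ℂ) :
    MemLp (fun u => u / (1 + |u|) * (s * J (2 * u)).im) 2 := by
  have hm := (superexpDecay_im hi s).aestronglyMeasurable
  have hm2 : AEStronglyMeasurable fun u : ℝ => u / (1 + |u|) * (s * J (2 * u)).im :=
    AEStronglyMeasurable.mul (Measurable.aestronglyMeasurable (by fun_prop)) hm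
  refine (memLp_two_iff_integrable_sq hm2).2 ?_
  have h3 := (((memLp_two_iff_integrable_sq_norm h2.1).1 h2).comp_mul_left'
    (two_ne_zero)).const_mul (‖s‖ ^ 2)
  refine h3.mono' (hm2.pow 2) (Eventually.of_forall fun u => ?_)
  rw [Real.norm_of_nonneg (sq_nonneg _), ← sq_abs, ← mul_pow]
  refine pow_le_pow_left₀ (abs_nonneg _) ?_ 2
  rw [abs_mul, norm_mul, Complex.norm_real, Real.norm_eq_abs]
  have h4 : |u / (1 + |u|)| ≤ |2 * u / (1 + |2 * u|)| := by
    rw [abs_div, abs_div, abs_of_nonneg (by positivity : 0 ≤ 1 + |u|),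
      abs_of_nonneg (by positivity : 0 ≤ 1 + |2 * u|), abs_mul, abs_two,
      div_le_div_iff₀ (by positivity) (by positivity)]
    nlinarith [abs_nonneg u]
  calc _ ≤ |2 * u / (1 + |2 * u|)| * (‖s‖ * ‖J (2 * u)‖) := by
        gcongr
        rw [← norm_mul]
        exact Complex.abs_im_le_norm _
    _ = _ := by ring

/-- The substitution u ↦ 2u matches the frequency convention sin(2zu), and (i/π) J(2u) is split into
real and imaginary parts. Both are written as imaginary parts, so that the same decay and L² lemmas
serve for each. -/
lemma inversion_eq (hi : ∀ c : ℝ,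
      Integrable (fun u : ℝ => (Real.exp (c * |u|) : ℂ) * ((u : ℂ) * J u))) (z : ℂ) :
    Complex.I / (2 * Real.pi) * ∫ u : ℝ, Complex.sin (z * u) * J u =
      sineTransform (fun u => ((-1 / Real.pi : ℂ) * J (2 * u)).im) z +
        Complex.I * sineTransform (fun u => ((Complex.I / Real.pi : ℂ) * J (2 * u)).im) z := by
  have i1 := (superexpDecay_im hi (-1 / Real.pi)).integrable_sin z
  have i2 := (superexpDecay_im hi (Complex.I / Real.pi)).integrable_sin z
  have h1 := Measure.integral_comp_mul_left (fun u : ℝ => Complex.sin (z * u) * J u) 2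
  have h2 : ∫ u : ℝ, Complex.sin (z * u) * J u =
      2 * ∫ u : ℝ, Complex.sin (z * (2 * u : ℝ)) * J (2 * u) := by
    rw [h1, abs_of_pos (by norm_num)]
    simp
  rw [sineTransform, sineTransform, h2, ← integral_const_mul, ← integral_const_mul,
    ← integral_const_mul, ← integral_add i1 (i2.const_mul _)]
  congr 1; ext u
  have h3 : ∀ w : ℂ, (Complex.I / Real.pi) * w = (((-1 / Real.pi : ℂ) * w).im : ℂ) +
      Complex.I * (((Complex.I / Real.pi : ℂ) * w).im : ℂ) := fun w => by
    have e1 : (-1 / Real.pi : ℂ) = ((-1 / Real.pi : ℝ) : ℂ) := by push_cast; ring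
    have e2 : (Complex.I / Real.pi : ℂ) = ((1 / Real.pi : ℝ) : ℂ) * Complex.I := by push_cast; ring
    rw [e1, e2, Complex.im_ofReal_mul, mul_assoc, Complex.im_ofReal_mul]
    apply Complex.ext <;> simp
    ring
  have h4 := h3 (J (2 * u))
  have h5 : z * ((2 * u : ℝ) : ℂ) = 2 * z * u := by push_cast; ring
  rw [h5]
  linear_combination Complex.sin (2 * z * u) * h4

/-- If the one-point function is real, the density is real. -/
lemma exists_real_density {κ : ℂ → ℂ → ℂ} (hκ : IsTranslationInvariantPreKernel κ)
    (hreal : ∀ z : ℂ, z.im ≠ 0 → (onePoint κ z).im = 0) :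
    ∃ h : ℝ → ℝ, SuperexpDecay h ∧ (∀ u, h (-u) = -h u) ∧
      MemLp (fun u => u / (1 + |u|) * h u) 2 ∧ κ = translationKernel (sineTransform h) := by
  obtain ⟨Ψ, J, hΨ, hJ, hκ⟩ := hκ
  set h : ℝ → ℝ := fun u => ((-1 / Real.pi : ℂ) * J (2 * u)).im
  set k : ℝ → ℝ := fun u => ((Complex.I / Real.pi : ℂ) * J (2 * u)).im
  have hodd : ∀ s : ℂ, ∀ u : ℝ, (s * J (2 * -u)).im = -(s * J (2 * u)).im := fun s u => by
    rw [mul_neg, hJ.odd]; simp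
  have hΨeq : ∀ z, Ψ z = sineTransform h z + Complex.I * sineTransform k z := fun z => by
    rw [← inversion_eq hJ.integrable]
    exact tendsto_nhds_unique (hJ.inversion z) (tendsto_inversion hJ.odd hJ.integrable z)
  have hκ' : κ = translationKernel Ψ := by
    ext z w
    rw [hκ, translationKernel]
  have hk : SuperexpDecay k := superexpDecay_im hJ.integrable _
  -- On the imaginary axis the imaginary part of R is a nonzero multiple of the sinh transform of k,
  -- which must therefore vanish.
  have hk0 : k =ᵐ[volume] 0 := by
    refine hk.ae_eq_zero_of_sinhTransform_eq_zero (hodd _) fun y => ?_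
    rcases eq_or_ne y 0 with rfl | hy
    · simp [sinhTransform]
    · have h1 := hreal ⟨0, y⟩ hy
      rw [hκ', onePoint_translationKernel hΨ, hΨeq, sineTransform_I_mul, sineTransform_I_mul] at h1
      simp only at h1
      have h2 : -2 * Complex.I * (y : ℂ) * Complex.exp (-4 * (y : ℂ) ^ 2) *
          (Complex.I * (sinhTransform h y : ℂ) + Complex.I * (Complex.I * (sinhTransform k y : ℂ))) =
          ((2 * y * Real.exp (-4 * y ^ 2) * sinhTransform h y : ℝ) : ℂ) +
          ((2 * y * Real.exp (-4 * y ^ 2) * sinhTransform k y : ℝ) : ℂ) * Complex.I := by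
        push_cast
        linear_combination (-2 * (y : ℂ) * Complex.exp (-4 * (y : ℂ) ^ 2) *
          ((sinhTransform h y : ℂ) + Complex.I * (sinhTransform k y : ℂ))) * Complex.I_sq
      rw [h2] at h1
      simp only [Complex.add_im, Complex.ofReal_im, Complex.mul_im, Complex.ofReal_re,
        Complex.I_im, Complex.I_re, mul_one, mul_zero, zero_add, add_zero] at h1
      have := Real.exp_ne_zero (-4 * y ^ 2)
      simpa [hy, this] using h1
  refine ⟨h, superexpDecay_im hJ.integrable _, hodd _, memLp_two_im hJ.integrable hJ.memLp_two _, ?_⟩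
  rw [hκ']
  congr 1; ext z
  rw [hΨeq, sineTransform_congr hk0]
  simp [sineTransform]

/-- An odd density with values in `{0, e^{-u²}/(√π u)}` has the same sine transform as a truncated
density. -/
lemma exists_sineTransform_eq_truncatedDensity {h : ℝ → ℝ} (hh : SuperexpDecay h)
    (hodd : ∀ u, h (-u) = -h u)
    (hv : ∀ᵐ u, h u = 0 ∨ h u = Real.exp (-u ^ 2) / (√Real.pi * u)) :
    ∃ S : Set ℝ, MeasurableSet S ∧ S ⊆ Set.Ioi 0 ∧
      sineTransform h = sineTransform (truncatedDensity S) := by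
  have hm := hh.aestronglyMeasurable
  -- The support is taken for a measurable representative of h. Restricting to the positive
  -- half-line doubles the density, whence 2/√π in `truncatedDensity`.
  refine ⟨{u | hm.mk h u ≠ 0} ∩ Set.Ioi 0,
    (measurableSet_eq_fun hm.stronglyMeasurable_mk.measurable measurable_const).compl.inter
      measurableSet_Ioi, Set.inter_subset_right, ?_⟩
  set S : Set ℝ := {u | hm.mk h u ≠ 0} ∩ Set.Ioi 0
  ext z
  have he : ∀ u : ℝ, Complex.sin (2 * z * (-u : ℝ)) * h (-u) = Complex.sin (2 * z * u) * h u :=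
    fun u => by
      rw [hodd]; push_cast
      rw [mul_neg (2 * z), Complex.sin_neg]; ring
  rw [sineTransform, sineTransform, integral_eq_two_mul_of_even he (hh.integrable_sin z),
    ← integral_const_mul, ← integral_indicator measurableSet_Ioi]
  refine integral_congr_ae ?_
  filter_upwards [hv, hm.ae_eq_mk] with u hu hmk
  by_cases h0 : u ∈ Set.Ioi (0 : ℝ)
  · have h0' : (0 : ℝ) < u := h0
    rw [Set.indicator_of_mem h0]
    by_cases hS : hm.mk h u = 0
    · rw [truncatedDensity, Set.indicator_of_notMem fun h => h.1 hS, hmk, hS]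
      simp
    · have h1 := hu.resolve_left (by rw [hmk]; exact hS)
      rw [truncatedDensity, Set.indicator_of_mem (show u ∈ S from ⟨hS, h0⟩), h1]
      push_cast
      ring
  · rw [Set.indicator_of_notMem h0, truncatedDensity, Set.indicator_of_notMem fun h => h0 h.2]
    simp

lemma exists_interval_of_massOne_of_ward {κ : ℂ → ℂ → ℂ}
    (hκ : IsTranslationInvariantPreKernel κ) (hm : MassOneEquation κ) (hw : WardEquation κ) :
    ∃ a : EReal, 0 < a ∧
      κ = translationKernel (sineTransform (truncatedDensity (initialInterval a))) := by
  obtain ⟨h, hh, hodd, h2, rfl⟩ := exists_real_density hκ fun z hz => (hw.1 z hz).1.1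
  obtain ⟨S, hS, hpos, hSh⟩ :=
    exists_sineTransform_eq_truncatedDensity hh hodd (hh.eq_of_massOne hodd h2 hm)
  rw [hSh] at hw ⊢
  obtain ⟨a, ha, hSa⟩ := ae_eq_interval_of_ward hS hpos hw
  exact ⟨a, ha, by rw [sineTransform_congr (truncatedDensity_congr hSa)]; rfl⟩

end Forward

/-! ### Decay of the sine transform of an initial interval -/

lemma exp_bound_of_abs_le {y v s u : ℝ} (hs : |s| ≤ |y| + |v|) (hu : 0 ≤ u) :
    Real.exp (2 * |s| * u) * Real.exp (-u ^ 2) ≤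
      Real.exp (6 * y ^ 2 + 3 / 2 * v ^ 2) * Real.exp (-(u ^ 2 / 6)) := by
  rw [← Real.exp_add, ← Real.exp_add]
  refine Real.exp_le_exp.2 ?_
  have h1 : 2 * |s| * u ≤ 2 * (|y| + |v|) * u := by gcongr
  have h2 : 2 * |v| * u ≤ 3 / 2 * v ^ 2 + 2 / 3 * u ^ 2 := by
    rw [← sq_abs v]; nlinarith [sq_nonneg (3 * |v| - 2 * u)]
  have h3 : 2 * |y| * u ≤ 6 * y ^ 2 + 1 / 6 * u ^ 2 := by
    rw [← sq_abs y]; nlinarith [sq_nonneg (6 * |y| - u)]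
  linarith

/-- Integrate the cosine by parts. The boundary term at b contributes 1/2, and ∫ 2u e^{-u²/6} du ≤ 6
contributes 6/2, in total 7/2. The bound does not depend on b, so it survives b → ∞. -/
lemma norm_integral_cos_gaussian_le {y v : ℝ} {z : ℂ} (hz : z ≠ 0) (hs : |z.im| ≤ |y| + |v|) {b : ℝ}
    (hb : 0 ≤ b) : ‖∫ u in (0 : ℝ)..b, Complex.cos (2 * z * u) * (Real.exp (-u ^ 2) : ℂ)‖ ≤
      7 / 2 * Real.exp (6 * y ^ 2 + 3 / 2 * v ^ 2) / ‖z‖ := by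
  set E := Real.exp (6 * y ^ 2 + 3 / 2 * v ^ 2)
  have hsin : ∀ u : ℝ, 0 ≤ u → ‖Complex.sin (2 * z * u) / (2 * z) * (Real.exp (-u ^ 2) : ℂ)‖ ≤
      E / (2 * ‖z‖) * Real.exp (-(u ^ 2 / 6)) := fun u hu => by
    have h1 := norm_sin_le_exp (2 * z * u)
    rw [show (2 * z * (u : ℂ)).im = 2 * z.im * u by simp, abs_mul, abs_mul, abs_two,
      abs_of_nonneg hu] at h1
    rw [norm_mul, norm_div, norm_mul, Complex.norm_ofNat, Complex.norm_real,
      Real.norm_of_nonneg (Real.exp_nonneg _)]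
    calc _ ≤ Real.exp (2 * |z.im| * u) / (2 * ‖z‖) * Real.exp (-u ^ 2) := by gcongr
      _ = Real.exp (2 * |z.im| * u) * Real.exp (-u ^ 2) / (2 * ‖z‖) := by ring
      _ ≤ E * Real.exp (-(u ^ 2 / 6)) / (2 * ‖z‖) := by
        gcongr ?_ / _
        exact exp_bound_of_abs_le hs hu
      _ = _ := by ring
  have hg : ∀ u : ℝ, HasDerivAt (fun u : ℝ => (Real.exp (-u ^ 2) : ℂ))
      ((-(2 * u) * Real.exp (-u ^ 2) : ℝ) : ℂ) u := fun u => by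
    refine HasDerivAt.ofReal_comp ?_
    refine ((hasDerivAt_pow 2 u).neg.exp).congr_deriv ?_
    simp; ring
  have hd : ∀ u : ℝ, HasDerivAt (fun u : ℝ => Complex.sin (2 * z * u) / (2 * z) *
      (Real.exp (-u ^ 2) : ℂ)) (Complex.cos (2 * z * u) * (Real.exp (-u ^ 2) : ℂ) +
        -(2 * u : ℂ) * (Complex.sin (2 * z * u) / (2 * z) * (Real.exp (-u ^ 2) : ℂ))) u := fun u => by
    have h1 : HasDerivAt (fun w : ℂ => 2 * z * w) (2 * z) (u : ℂ) := by
      simpa using (hasDerivAt_id (u : ℂ)).const_mul (2 * z)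
    have h2 := (h1.csin.div_const (2 * z)).comp_ofReal.mul (hg u)
    refine h2.congr_deriv ?_
    push_cast
    field_simp
  have hint := intervalIntegral.integral_eq_sub_of_hasDerivAt (a := 0) (b := b) (fun u _ => hd u)
    (Continuous.intervalIntegrable (by fun_prop) _ _)
  rw [intervalIntegral.integral_add (Continuous.intervalIntegrable (by fun_prop) _ _)
    (Continuous.intervalIntegrable (by fun_prop) _ _), ← eq_sub_iff_add_eq] at hint
  have h0 : ‖Complex.sin (2 * z * b) / (2 * z) * (Real.exp (-b ^ 2) : ℂ)‖ ≤ E / (2 * ‖z‖) := by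
    refine (hsin b hb).trans (mul_le_of_le_one_right (by positivity) ?_)
    exact Real.exp_le_one_iff.2 (by nlinarith [sq_nonneg b])
  have hG : ∀ u : ℝ, HasDerivAt (fun u : ℝ => -(6 * Real.exp (-(u ^ 2 / 6))))
      (2 * u * Real.exp (-(u ^ 2 / 6))) u := fun u => by
    refine ((((hasDerivAt_pow 2 u).div_const 6).neg.exp).const_mul 6).neg.congr_deriv ?_
    simp; ring
  have h1 : ‖∫ u in (0 : ℝ)..b, -(2 * u : ℂ) * (Complex.sin (2 * z * u) / (2 * z) *
      (Real.exp (-u ^ 2) : ℂ))‖ ≤ E / (2 * ‖z‖) * 6 := by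
    refine (intervalIntegral.norm_integral_le_of_norm_le hb
      (g := fun u => E / (2 * ‖z‖) * (2 * u * Real.exp (-(u ^ 2 / 6))))
      (Eventually.of_forall fun u hu => ?_) (Continuous.intervalIntegrable (by fun_prop) _ _)).trans ?_
    · rw [norm_mul, norm_neg, norm_mul, Complex.norm_ofNat, Complex.norm_real,
        Real.norm_of_nonneg hu.1.le]
      calc _ ≤ 2 * u * (E / (2 * ‖z‖) * Real.exp (-(u ^ 2 / 6))) :=
            mul_le_mul_of_nonneg_left (hsin u hu.1.le) (by linarith [hu.1])
        _ = _ := by ring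
    · rw [intervalIntegral.integral_const_mul, intervalIntegral.integral_eq_sub_of_hasDerivAt
        (fun u _ => hG u) (Continuous.intervalIntegrable (by fun_prop) _ _)]
      have := Real.exp_pos (-(b ^ 2 / 6))
      gcongr
      simp
      linarith
  rw [hint]
  refine (norm_sub_le _ _).trans ((add_le_add (norm_sub_le _ _) h1).trans ?_)
  have e : 7 / 2 * E / ‖z‖ = E / (2 * ‖z‖) + E / (2 * ‖z‖) * 6 := by ring
  rw [e]
  simpa using h0

lemma norm_setIntegral_cos_gaussian_le {y v : ℝ} {z : ℂ} (hz : z ≠ 0) (hs : |z.im| ≤ |y| + |v|)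
    {a : EReal} (ha : 0 < a) :
    ‖∫ u in initialInterval a, Complex.cos (2 * z * u) * (Real.exp (-u ^ 2) : ℂ)‖ ≤
      7 / 2 * Real.exp (6 * y ^ 2 + 3 / 2 * v ^ 2) / ‖z‖ := by
  induction a with
  | bot => exact absurd ha (by simp)
  | coe r =>
    have hr : 0 < r := by exact_mod_cast ha
    have e : initialInterval (r : EReal) = Set.Ioo 0 r := by
      ext u; simp [initialInterval]
    rw [e, ← integral_Ioc_eq_integral_Ioo, ← intervalIntegral.integral_of_le hr.le]
    exact norm_integral_cos_gaussian_le hz hs hr.le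
  | top =>
    have e : initialInterval (⊤ : EReal) = Set.Ioi 0 := by
      ext u; simp [initialInterval]
    rw [e]
    have hi : IntegrableOn (fun u : ℝ => Complex.cos (2 * z * u) * (Real.exp (-u ^ 2) : ℂ))
        (Set.Ioi 0) := by
      have h1 : Integrable fun u : ℝ => Real.exp (6 * z.im ^ 2 + 3 / 2 * 0 ^ 2) *
          Real.exp (-(1 / 6) * u ^ 2) := (integrable_exp_neg_mul_sq (by norm_num)).const_mul _
      refine h1.integrableOn.mono' (Continuous.aestronglyMeasurable (by fun_prop)) ?_
      filter_upwards [ae_restrict_mem measurableSet_Ioi] with u hu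
      have hu' : 0 ≤ u := le_of_lt hu
      have h2 := norm_cos_le (2 * z * u)
      rw [show (2 * z * (u : ℂ)).im = 2 * z.im * u by simp, abs_mul, abs_mul, abs_two,
        abs_of_nonneg hu'] at h2
      rw [norm_mul, Complex.norm_real, Real.norm_of_nonneg (Real.exp_nonneg _)]
      refine (mul_le_mul_of_nonneg_right h2 (Real.exp_nonneg _)).trans ?_
      refine (exp_bound_of_abs_le (y := z.im) (v := 0) (by simp) hu').trans (le_of_eq ?_)
      ring_nf
    exact le_of_tendsto (intervalIntegral_tendsto_integral_Ioi 0 hi tendsto_id).norm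
      ((eventually_ge_atTop 0).mono fun b hb => norm_integral_cos_gaussian_le hz hs hb)

/-- Differentiation removes the 1/u of the density and leaves a cosine integral of the Gaussian over
an interval. A general set S would not permit the integration by parts that gives the decay 1/|z|.
-/
lemma norm_deriv_sineTransform_le {y v : ℝ} {z : ℂ} (hz : z ≠ 0) (hs : |z.im| ≤ |y| + |v|)
    {a : EReal} (ha : 0 < a) :
    ‖deriv (sineTransform (truncatedDensity (initialInterval a))) z‖ ≤
      14 / √Real.pi * Real.exp (6 * y ^ 2 + 3 / 2 * v ^ 2) / ‖z‖ := by
  have hA := measurableSet_initialInterval a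
  rw [((superexpDecay_truncatedDensity hA).hasDerivAt_sineTransform z).deriv]
  have e : ∀ u : ℝ, Complex.cos (2 * z * u) * (2 * u) * truncatedDensity (initialInterval a) u =
      (4 / √Real.pi : ℂ) * (initialInterval a).indicator
        (fun u : ℝ => Complex.cos (2 * z * u) * (Real.exp (-u ^ 2) : ℂ)) u := fun u => by
    by_cases hu : u ∈ initialInterval a
    · have h0 : (u : ℂ) ≠ 0 := Complex.ofReal_ne_zero.2 (ne_of_gt hu.1)
      rw [truncatedDensity, Set.indicator_of_mem hu, Set.indicator_of_mem hu]
      push_cast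
      field_simp
      ring
    · rw [truncatedDensity, Set.indicator_of_notMem hu, Set.indicator_of_notMem hu]
      simp
  simp_rw [e]
  rw [integral_const_mul, integral_indicator hA, norm_mul]
  have h1 : ‖(4 / √Real.pi : ℂ)‖ = 4 / √Real.pi := by
    rw [norm_div, Complex.norm_real, Real.norm_of_nonneg (Real.sqrt_nonneg _), Complex.norm_ofNat]
  rw [h1]
  calc _ ≤ 4 / √Real.pi * (7 / 2 * Real.exp (6 * y ^ 2 + 3 / 2 * v ^ 2) / ‖z‖) := by
        gcongr; exact norm_setIntegral_cos_gaussian_le hz hs ha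
    _ = _ := by ring

lemma exists_norm_sineTransform_le_rpow {S : Set ℝ} (hS : MeasurableSet S) (hpos : S ⊆ Set.Ioi 0)
    (y : ℝ) : ∃ W, 0 ≤ W ∧ ∀ v s t : ℝ, |s| ≤ |y| + |v| →
      ‖sineTransform (truncatedDensity S) (t + s * Complex.I)‖ ≤
        W * (1 + |v|) * Real.exp (3 / 2 * v ^ 2) * (1 + t ^ 2) ^ (1 / 8 : ℝ) := by
  have hW := integrable_frequencyWeight_mul hS hpos y
  set W := ∫ u, ‖frequencyWeight y u * truncatedDensity S u‖
  have hW0 : 0 ≤ W := integral_nonneg fun u => norm_nonneg _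
  refine ⟨2 * (1 + |y|) * W, by positivity, fun v s t hs => ?_⟩
  set X := 4 * (1 + |y| + |v|) ^ 2 * (1 + t ^ 2) ^ (1 / 2 : ℝ)
  have h1 : ‖sineTransform (truncatedDensity S) (t + s * Complex.I)‖ ≤
      X ^ (1 / 4 : ℝ) * Real.exp (3 / 2 * v ^ 2) * W := by
    rw [← integral_const_mul]
    refine norm_integral_le_of_norm_le (hW.norm.const_mul _) (Eventually.of_forall fun u => ?_)
    rw [norm_mul, norm_mul, Complex.norm_real, Real.norm_of_nonneg (frequencyWeight_nonneg _ _)]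
    calc _ ≤ (X ^ (1 / 4 : ℝ) * Real.exp (3 / 2 * v ^ 2) * frequencyWeight y u) *
          ‖truncatedDensity S u‖ := by
          gcongr; exact norm_sin_two_mul_le_frequencyWeight hs u t
      _ = _ := by ring
  have h2 : X ^ (1 / 4 : ℝ) ≤ 2 * (1 + |y|) * (1 + |v|) * (1 + t ^ 2) ^ (1 / 8 : ℝ) := by
    -- The bound is enlarged to a perfect fourth power so that its fourth root is explicit.
    have h3 : X ≤ (2 * (1 + |y|) * (1 + |v|)) ^ (4 : ℕ) * (1 + t ^ 2) ^ (1 / 2 : ℝ) := by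
      simp only [X]
      gcongr
      have h4 : 1 + |y| + |v| ≤ (1 + |y|) * (1 + |v|) := by
        nlinarith [mul_nonneg (abs_nonneg y) (abs_nonneg v)]
      have h5 : 1 ≤ (1 + |y|) * (1 + |v|) := by
        nlinarith [mul_nonneg (abs_nonneg y) (abs_nonneg v), abs_nonneg y, abs_nonneg v]
      set q := (1 + |y|) * (1 + |v|)
      have h6 : (1 + |y| + |v|) ^ 2 ≤ q ^ 2 := by gcongr
      calc 4 * (1 + |y| + |v|) ^ 2 ≤ 4 * q ^ 2 := by linarith
        _ ≤ 16 * q ^ 4 := by nlinarith [sq_nonneg q, one_le_pow₀ h5 (n := 2)]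
        _ = _ := by simp only [q]; ring
    refine (Real.rpow_le_rpow (by positivity) h3 (by norm_num)).trans (le_of_eq ?_)
    rw [Real.mul_rpow (by positivity) (by positivity), ← Real.rpow_mul (by positivity),
      ← Real.rpow_natCast, ← Real.rpow_mul (by positivity)]
    norm_num
  calc _ ≤ _ := h1
    _ ≤ 2 * (1 + |y|) * (1 + |v|) * (1 + t ^ 2) ^ (1 / 8 : ℝ) * Real.exp (3 / 2 * v ^ 2) * W := by
      gcongr
    _ = _ := by ring

/-- The difference of squares of the sine transform on two horizontal lines decays. -/
lemma exists_sineTransform_diff_le {a : EReal} (ha : 0 < a) (y : ℝ) :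
    ∃ C, 0 ≤ C ∧ ∀ v t : ℝ,
      ‖sineTransform (truncatedDensity (initialInterval a)) (t + (y + v : ℝ) * Complex.I) -
        sineTransform (truncatedDensity (initialInterval a)) (t + (y - v : ℝ) * Complex.I)‖ *
      (‖sineTransform (truncatedDensity (initialInterval a)) (t + (y + v : ℝ) * Complex.I)‖ +
        ‖sineTransform (truncatedDensity (initialInterval a)) (t + (y - v : ℝ) * Complex.I)‖) ≤
      C * (1 + |v|) ^ 2 * Real.exp (3 * v ^ 2) * (1 + t ^ 2) ^ (-(3 / 8) : ℝ) := by
  have hA := measurableSet_initialInterval a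
  have hh := superexpDecay_truncatedDensity hA
  obtain ⟨W, hW0, hW⟩ := exists_norm_sineTransform_le_rpow hA (initialInterval_subset a) y
  set Ψ := sineTransform (truncatedDensity (initialInterval a))
  set K := 14 / √Real.pi * Real.exp (6 * y ^ 2)
  have hK0 : 0 ≤ K := by positivity
  refine ⟨8 * W ^ 2 + 8 * K * W, by positivity, fun v t => ?_⟩
  have hb : |y + v| ≤ |y| + |v| := abs_add_le _ _
  have ha : |y - v| ≤ |y| + |v| := abs_sub _ _
  have h1 := hW v (y + v) t hb
  have h2 := hW v (y - v) t ha
  set Q := (1 + |v|) * Real.exp (3 / 2 * v ^ 2)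
  have hQ : Q ^ 2 = (1 + |v|) ^ 2 * Real.exp (3 * v ^ 2) := by
    simp only [Q]
    rw [mul_pow, ← Real.exp_nat_mul]
    congr 2; push_cast; ring
  have hQ0 : 0 ≤ Q := by positivity
  set p := (1 + t ^ 2) ^ (1 / 8 : ℝ)
  have hp0 : 0 ≤ p := by positivity
  have h1' : ‖Ψ (t + (y + v : ℝ) * Complex.I)‖ ≤ W * Q * p := by
    refine h1.trans (le_of_eq ?_); ring
  have h2' : ‖Ψ (t + (y - v : ℝ) * Complex.I)‖ ≤ W * Q * p := by
    refine h2.trans (le_of_eq ?_); ring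
  have hsum : ‖Ψ (t + (y + v : ℝ) * Complex.I)‖ + ‖Ψ (t + (y - v : ℝ) * Complex.I)‖ ≤
      2 * (W * Q * p) := by linarith
  have hgoal : (8 * W ^ 2 + 8 * K * W) * (1 + |v|) ^ 2 * Real.exp (3 * v ^ 2) *
      (1 + t ^ 2) ^ (-(3 / 8) : ℝ) = (8 * W ^ 2 + 8 * K * W) * Q ^ 2 *
      (1 + t ^ 2) ^ (-(3 / 8) : ℝ) := by rw [hQ]; ring
  rw [hgoal]
  set r := (1 + t ^ 2) ^ (-(3 / 8) : ℝ)
  have hr0 : 0 ≤ r := by positivity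
  have h1t : (0 : ℝ) < 1 + t ^ 2 := by positivity
  -- For |t| ≤ 1 the growth bound for Ψ suffices, as all powers of 1+t² are comparable there. For
  -- |t| ≥ 1 the difference is estimated by the derivative: (1+t²)^{1/8} against 1/|t| gives the
  -- exponent 1/8 - 1/2 = -3/8.
  rcases le_total |t| 1 with ht | ht
  · have hpr : p * p ≤ 2 * r := by
      have e : p * p = (1 + t ^ 2) ^ (5 / 8 : ℝ) * r := by
        simp only [p, r]
        rw [← Real.rpow_add h1t, ← Real.rpow_add h1t]; norm_num
      rw [e]
      gcongr
      have h3 : 1 + t ^ 2 ≤ 2 := by rw [← sq_abs]; nlinarith [abs_nonneg t]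
      calc (1 + t ^ 2) ^ (5 / 8 : ℝ) ≤ 2 ^ (5 / 8 : ℝ) := by gcongr
        _ ≤ 2 ^ (1 : ℝ) := Real.rpow_le_rpow_of_exponent_le (by norm_num) (by norm_num)
        _ = 2 := by norm_num
    calc _ ≤ (2 * (W * Q * p)) * (2 * (W * Q * p)) := by
          gcongr
          exact (norm_sub_le _ _).trans hsum
      _ = 4 * W ^ 2 * Q ^ 2 * (p * p) := by ring
      _ ≤ 4 * W ^ 2 * Q ^ 2 * (2 * r) := by gcongr
      _ ≤ _ := by nlinarith [mul_nonneg (mul_nonneg hK0 hW0) (mul_nonneg (sq_nonneg Q) hr0)]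
  · have ht0 : 0 < |t| := one_pos.trans_le ht
    have hdiff : ‖Ψ (t + (y + v : ℝ) * Complex.I) - Ψ (t + (y - v : ℝ) * Complex.I)‖ ≤
        K * Real.exp (3 / 2 * v ^ 2) / |t| * (2 * |v|) := by
      -- The mean value inequality is used on the vertical segment Re z = t of length 2|v|, where
      -- |z| ≥ |t|.
      have hconv : Convex ℝ {z : ℂ | z.re = t ∧ |z.im| ≤ |y| + |v|} := by
        have : {z : ℂ | z.re = t ∧ |z.im| ≤ |y| + |v|} = Complex.reLm ⁻¹' {t} ∩
            Complex.imLm ⁻¹' (Set.Icc (-(|y| + |v|)) (|y| + |v|)) := by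
          ext z; simp [abs_le]
        rw [this]
        exact ((convex_singleton t).linear_preimage _).inter ((convex_Icc _ _).linear_preimage _)
      have hd := hconv.norm_image_sub_le_of_norm_hasDerivWithin_le (f := Ψ)
        (C := K * Real.exp (3 / 2 * v ^ 2) / |t|)
        (fun z _ => (hh.differentiable_sineTransform z).hasDerivAt.hasDerivWithinAt)
        (fun z hz => ?_) (x := t + (y - v : ℝ) * Complex.I) (y := t + (y + v : ℝ) * Complex.I)
        (by simpa using ha) (by simpa using hb)
      · refine hd.trans (le_of_eq ?_)
        congr 1
        rw [show (t + (y + v : ℝ) * Complex.I - (t + (y - v : ℝ) * Complex.I) : ℂ) =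
          2 * v * Complex.I by push_cast; ring]
        simp
      · have hzt : |t| ≤ ‖z‖ := by rw [← hz.1]; exact Complex.abs_re_le_norm z
        have hz0 : z ≠ 0 := norm_pos_iff.1 (ht0.trans_le hzt)
        refine (norm_deriv_sineTransform_le hz0 hz.2 ‹0 < a›).trans ?_
        rw [Real.exp_add, ← mul_assoc]
        gcongr
    have hpr : p / |t| ≤ 2 * r := by
      have e : p = (1 + t ^ 2) ^ (1 / 2 : ℝ) * r := by
        simp only [p, r]
        rw [← Real.rpow_add h1t]; norm_num
      rw [e, div_le_iff₀ ht0, mul_right_comm]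
      gcongr
      rw [← Real.sqrt_eq_rpow]
      refine Real.sqrt_le_iff.2 ⟨by positivity, ?_⟩
      rw [mul_pow, sq_abs]
      nlinarith [sq_abs t, abs_nonneg t]
    have hv : Real.exp (3 / 2 * v ^ 2) * |v| ≤ Q := by
      simp only [Q]
      rw [mul_comm]
      gcongr
      linarith
    calc _ ≤ (K * Real.exp (3 / 2 * v ^ 2) / |t| * (2 * |v|)) * (2 * (W * Q * p)) := by gcongr
      _ = 4 * K * W * (Real.exp (3 / 2 * v ^ 2) * |v|) * Q * (p / |t|) := by ring
      _ ≤ 4 * K * W * Q * Q * (2 * r) := by gcongr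
      _ ≤ _ := by nlinarith [mul_nonneg (sq_nonneg W) (mul_nonneg (sq_nonneg Q) hr0)]

/-! ### The odd density and the translation-invariant pre-kernel -/

/-- The odd function that agrees with `e^{-u²}/(√π u)` on `(0, a)` and vanishes on `[a, ∞)`. -/
def oddDensity (a : EReal) (u : ℝ) : ℝ :=
  (truncatedDensity (initialInterval a) u - truncatedDensity (initialInterval a) (-u)) / 2

variable {a : EReal}

lemma oddDensity_neg (a : EReal) (u : ℝ) : oddDensity a (-u) = -oddDensity a u := by
  rw [oddDensity, oddDensity, neg_neg]; ring

lemma measurable_oddDensity (a : EReal) : Measurable (oddDensity a) :=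
  ((measurable_truncatedDensity (measurableSet_initialInterval a)).sub
    ((measurable_truncatedDensity (measurableSet_initialInterval a)).comp measurable_neg)).div_const 2

lemma superexpDecay_comp_neg {h : ℝ → ℝ} (hh : SuperexpDecay h) : SuperexpDecay fun u => -h (-u) :=
  fun c => ((hh c).comp_neg).congr (Eventually.of_forall fun u => by simp only [abs_neg]; ring)

lemma superexpDecay_oddDensity (a : EReal) : SuperexpDecay (oddDensity a) := fun c => by
  have hh := superexpDecay_truncatedDensity (measurableSet_initialInterval a)
  refine (((hh c).add (superexpDecay_comp_neg hh c)).div_const 2).congr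
    (Eventually.of_forall fun u => ?_)
  simp only [Pi.add_apply, oddDensity]; ring

lemma sineTransform_oddDensity (a : EReal) :
    sineTransform (oddDensity a) = sineTransform (truncatedDensity (initialInterval a)) := by
  ext z
  have hh := superexpDecay_truncatedDensity (measurableSet_initialInterval a)
  set f : ℝ → ℂ := fun u => Complex.sin (2 * z * u) * truncatedDensity (initialInterval a) u
  have e : ∀ u : ℝ, Complex.sin (2 * z * u) * oddDensity a u = (f u + f (-u)) / 2 := fun u => by
    simp only [f, oddDensity]
    push_cast
    rw [mul_neg (2 * z), Complex.sin_neg]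
    ring
  have hi : Integrable f := hh.integrable_sin z
  rw [sineTransform]
  simp_rw [e]
  rw [integral_div, integral_add hi hi.comp_neg, integral_neg_eq_self f, sineTransform]
  ring

lemma abs_mul_oddDensity_le (u : ℝ) :
    |u * oddDensity a u| ≤ 2 / √Real.pi * Real.exp (-u ^ 2) := by
  have h1 := abs_mul_truncatedDensity_le (S := initialInterval a) u
  have h2 := abs_mul_truncatedDensity_le (S := initialInterval a) (-u)
  rw [neg_sq, neg_mul, abs_neg] at h2
  have h3 : u * oddDensity a u = (u * truncatedDensity (initialInterval a) u -
    u * truncatedDensity (initialInterval a) (-u)) / 2 := by rw [oddDensity]; ring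
  rw [h3, abs_div, abs_two, div_le_iff₀ two_pos]
  refine (abs_sub _ _).trans ?_
  linarith

/-- This is the quadratic equation that the mass-one equation imposes; in the converse it turns the
Gaussian integral back into Φ. -/
lemma oddDensity_eq_sq (a : EReal) (u : ℝ) :
    √Real.pi * u * Real.exp (u ^ 2) * oddDensity a u ^ 2 = oddDensity a u := by
  have hp := (Real.sqrt_pos.2 Real.pi_pos).ne'
  have key : ∀ u : ℝ, 0 < u →
      √Real.pi * u * Real.exp (u ^ 2) * oddDensity a u ^ 2 = oddDensity a u := fun u hu => by
    rw [oddDensity, truncatedDensity_of_nonpos (initialInterval_subset a) (by linarith : -u ≤ 0)]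
    by_cases hu' : u ∈ initialInterval a
    · rw [truncatedDensity, Set.indicator_of_mem hu', Real.exp_neg]
      have := hu.ne'
      field_simp
      norm_num
    · rw [truncatedDensity, Set.indicator_of_notMem hu']
      simp
  rcases lt_trichotomy u 0 with hu | rfl | hu
  · have h1 := key (-u) (by linarith)
    rw [oddDensity_neg, neg_sq, neg_sq] at h1
    linarith
  · simp [oddDensity]
  · exact key u hu

lemma memLp_two_sinh_mul_oddDensity (a : EReal) (b : ℝ) :
    MemLp (fun u => Real.sinh (2 * b * u) * oddDensity a u) 2 := by
  have hm : AEStronglyMeasurable fun u => Real.sinh (2 * b * u) * oddDensity a u :=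
    AEStronglyMeasurable.mul (by fun_prop) (measurable_oddDensity a).aestronglyMeasurable
  refine (memLp_two_iff_integrable_sq hm).2 ?_
  have h1 : Integrable fun u : ℝ => (|2 * b| * (2 / √Real.pi) * Real.exp ((2 * b) ^ 2 / 2)) ^ 2 *
      Real.exp (-1 * u ^ 2) := (integrable_exp_neg_mul_sq one_pos).const_mul _
  refine h1.mono' (hm.pow 2) (Eventually.of_forall fun u => ?_)
  rw [Real.norm_of_nonneg (sq_nonneg _), ← sq_abs]
  have h2 : |Real.sinh (2 * b * u) * oddDensity a u| ≤
      |2 * b| * (2 / √Real.pi) * Real.exp ((2 * b) ^ 2 / 2) * Real.exp (-(u ^ 2 / 2)) := by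
    rw [abs_mul]
    calc _ ≤ |2 * b| * (Real.exp (|2 * b| * |u|) * |u|) * |oddDensity a u| := by
          gcongr; exact abs_sinh_mul_le _ _
      _ = |2 * b| * Real.exp (|2 * b| * |u|) * |u * oddDensity a u| := by rw [abs_mul u]; ring
      _ ≤ |2 * b| * Real.exp ((2 * b) ^ 2 / 2 + u ^ 2 / 2) *
          (2 / √Real.pi * Real.exp (-u ^ 2)) := by
        gcongr
        · rw [← sq_abs (2 * b), ← sq_abs u]
          nlinarith [sq_nonneg (|2 * b| - |u|)]
        · exact abs_mul_oddDensity_le u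
      _ = _ := by
        have h3 : Real.exp (-(u ^ 2 / 2)) = Real.exp (u ^ 2 / 2) * Real.exp (-u ^ 2) := by
          rw [← Real.exp_add]; ring_nf
        rw [h3, Real.exp_add]; ring
  calc _ ≤ (|2 * b| * (2 / √Real.pi) * Real.exp ((2 * b) ^ 2 / 2) * Real.exp (-(u ^ 2 / 2))) ^ 2 := by
        gcongr
    _ = _ := by
      rw [mul_pow _ (Real.exp _), ← Real.exp_nat_mul (-(u ^ 2 / 2))]
      congr 2; push_cast; ring

/-- The choice of J inverts the relation (i/π) J(2u) = h(u) with h = `oddDensity a`.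
Square-integrability holds because the weight removes the 1/u singularity at 0. -/
lemma isFourierInversion_oddDensity (a : EReal) :
    IsFourierInversion (sineTransform (truncatedDensity (initialInterval a)))
      (fun u => -Complex.I * Real.pi * oddDensity a (u / 2)) := by
  have hodd : ∀ u : ℝ, -Complex.I * Real.pi * (oddDensity a (-u / 2) : ℂ) =
      -(-Complex.I * Real.pi * oddDensity a (u / 2)) := fun u => by
    rw [neg_div, oddDensity_neg]; push_cast; ring
  have hint : ∀ c : ℝ, Integrable (fun u : ℝ => (Real.exp (c * |u|) : ℂ) *
      ((u : ℂ) * (-Complex.I * Real.pi * oddDensity a (u / 2)))) := fun c => by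
    have h1 := (((superexpDecay_oddDensity a (2 * c)).comp_div two_ne_zero).ofReal
      (𝕜 := ℂ)).const_mul (-2 * Complex.I * Real.pi)
    refine h1.congr (Eventually.of_forall fun u => ?_)
    simp only
    rw [abs_div, abs_two, show 2 * c * (|u| / 2) = c * |u| by ring]
    simp only [Complex.coe_algebraMap]
    push_cast
    ring
  refine ⟨hodd, hint, ?_, fun z => ?_⟩
  · have hm : AEStronglyMeasurable fun u : ℝ => ((u / (1 + |u|) : ℝ) : ℂ) *
        (-Complex.I * Real.pi * oddDensity a (u / 2)) := by
      have := measurable_oddDensity a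
      exact Measurable.aestronglyMeasurable (by fun_prop)
    refine (memLp_two_iff_integrable_sq_norm hm).2 ?_
    have h1 : Integrable fun u : ℝ => (Real.pi * 2 * (2 / √Real.pi)) ^ 2 *
        Real.exp (-(1 / 2) * u ^ 2) := (integrable_exp_neg_mul_sq (by norm_num)).const_mul _
    refine h1.mono' (hm.norm.pow 2) (Eventually.of_forall fun u => ?_)
    rw [Real.norm_of_nonneg (sq_nonneg _)]
    have h2 : ‖((u / (1 + |u|) : ℝ) : ℂ) * (-Complex.I * Real.pi * oddDensity a (u / 2))‖ ≤
        Real.pi * 2 * (2 / √Real.pi) * Real.exp (-(u / 2) ^ 2) := by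
      rw [norm_mul, norm_mul, norm_mul, norm_neg, Complex.norm_I, one_mul, Complex.norm_real,
        Complex.norm_real, Complex.norm_real, Real.norm_of_nonneg Real.pi_pos.le, Real.norm_eq_abs,
        abs_div, abs_of_nonneg (by positivity : 0 ≤ 1 + |u|)]
      have h3 : |u| / (1 + |u|) ≤ |u| := div_le_self (abs_nonneg u) (by linarith [abs_nonneg u])
      calc _ ≤ |u| * (Real.pi * ‖oddDensity a (u / 2)‖) := by gcongr
        _ = Real.pi * 2 * |u / 2 * oddDensity a (u / 2)| := by
          rw [abs_mul, abs_div, abs_two, Real.norm_eq_abs]; ring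
        _ ≤ Real.pi * 2 * (2 / √Real.pi * Real.exp (-(u / 2) ^ 2)) := by
          gcongr; exact abs_mul_oddDensity_le _
        _ = _ := by ring
    calc _ ≤ (Real.pi * 2 * (2 / √Real.pi) * Real.exp (-(u / 2) ^ 2)) ^ 2 := by gcongr
      _ = _ := by
        rw [mul_pow _ (Real.exp _), ← Real.exp_nat_mul]
        congr 2; push_cast; ring
  · have h1 := tendsto_inversion hodd hint z
    have h2 := Measure.integral_comp_mul_left (fun u : ℝ => Complex.sin (z * u) *
      (-Complex.I * Real.pi * oddDensity a (u / 2))) 2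
    have h3 : Complex.I / (2 * Real.pi) * ∫ u : ℝ, Complex.sin (z * u) *
        (-Complex.I * Real.pi * oddDensity a (u / 2)) = sineTransform (oddDensity a) z := by
      have e : ∀ u : ℝ, Complex.sin (z * (2 * u : ℝ)) *
          (-Complex.I * Real.pi * oddDensity a (2 * u / 2)) =
          (-Complex.I * Real.pi) * (Complex.sin (2 * z * u) * oddDensity a u) := fun u => by
        rw [mul_div_cancel_left₀ u two_ne_zero, show z * ((2 * u : ℝ) : ℂ) = 2 * z * u by
          push_cast; ring]
        ring
      simp_rw [e] at h2
      rw [integral_const_mul, abs_of_pos (by norm_num), Complex.real_smul] at h2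
      have h4 : ∫ u : ℝ, Complex.sin (z * u) * (-Complex.I * Real.pi * oddDensity a (u / 2)) =
          2 * ((-Complex.I * Real.pi) * sineTransform (oddDensity a) z) := by
        rw [sineTransform, h2]; push_cast; ring
      rw [h4]
      have := Complex.ofReal_ne_zero.2 Real.pi_ne_zero
      field_simp
      linear_combination (-sineTransform (oddDensity a) z) * Complex.I_sq
    rw [h3, sineTransform_oddDensity] at h1
    exact h1

lemma isTranslationInvariantPreKernel_initialInterval (a : EReal) :
    IsTranslationInvariantPreKernel
      (translationKernel (sineTransform (truncatedDensity (initialInterval a)))) :=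
  ⟨_, _, sineTransform_neg _, isFourierInversion_oddDensity a, fun _ _ => rfl⟩

/-! ### The mass-one equation for an initial interval -/

variable {a : EReal}

lemma continuous_sineTransform_line {h : ℝ → ℝ} (hh : SuperexpDecay h) (b : ℝ) :
    Continuous fun t : ℝ => sineTransform h (t + b * Complex.I) :=
  hh.differentiable_sineTransform.continuous.comp (by fun_prop)

lemma continuous_lineDiff {h : ℝ → ℝ} (hh : SuperexpDecay h) (y v : ℝ) :
    Continuous (lineDiff h y v) := by
  unfold lineDiff
  exact ((continuous_sineTransform_line hh _).norm.pow 2).sub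
    ((continuous_sineTransform_line hh _).norm.pow 2)

lemma exists_lineDiff_le (ha : 0 < a) (y : ℝ) : ∃ C, 0 ≤ C ∧ ∀ v t : ℝ,
    |lineDiff (truncatedDensity (initialInterval a)) y v t| ≤
      C * (1 + |v|) ^ 2 * Real.exp (3 * v ^ 2) * (1 + t ^ 2) ^ (-(3 / 8) : ℝ) := by
  obtain ⟨C, hC0, hC⟩ := exists_sineTransform_diff_le ha y
  refine ⟨C, hC0, fun v t => le_trans ?_ (hC v t)⟩
  rw [lineDiff, sq_sub_sq, abs_mul, mul_comm, abs_of_nonneg (by positivity : 0 ≤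
    ‖sineTransform (truncatedDensity (initialInterval a)) (t + (y + v : ℝ) * Complex.I)‖ +
    ‖sineTransform (truncatedDensity (initialInterval a)) (t + (y - v : ℝ) * Complex.I)‖)]
  gcongr
  exact abs_norm_sub_norm_le _ _

lemma tendsto_rpow_neg_atTop_zero (x : ℝ) :
    Tendsto (fun T : ℝ => (1 + (T - x) ^ 2) ^ (-(3 / 8) : ℝ)) atTop (𝓝 0) := by
  refine (tendsto_rpow_neg_atTop (by norm_num : (0 : ℝ) < 3 / 8)).comp ?_
  refine tendsto_atTop_add_const_left _ _ ?_
  exact (tendsto_pow_atTop two_ne_zero).comp (tendsto_atTop_add_const_right _ _ tendsto_id)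

/-- The contour shift for the square of the sine transform. -/
lemma tendsto_integral_sq_shift (ha : 0 < a) (b : ℝ) :
    Tendsto (fun T : ℝ => (∫ t in (-T)..T,
        sineTransform (truncatedDensity (initialInterval a)) (t + b * Complex.I) ^ 2) -
      ∫ t in (-T)..T, sineTransform (truncatedDensity (initialInterval a)) (t : ℂ) ^ 2)
      atTop (𝓝 0) := by
  have hh := superexpDecay_truncatedDensity (measurableSet_initialInterval a)
  obtain ⟨C, hC0, hC⟩ := exists_sineTransform_diff_le ha 0
  set Ψ := sineTransform (truncatedDensity (initialInterval a)) with hΨ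
  have hb : ∀ T : ℝ, ‖(∫ t in (-T)..T, Ψ (t + b * Complex.I) ^ 2) - ∫ t in (-T)..T, Ψ (t : ℂ) ^ 2‖ ≤
      C * (1 + |b|) ^ 2 * Real.exp (3 * b ^ 2) * |b| * (1 + (T - 0) ^ 2) ^ (-(3 / 8) : ℝ) := fun T => by
    have h1 := integral_horizontal_shift (hh.differentiable_sineTransform.pow 2) b T
    simp only [Pi.pow_apply] at h1
    rw [← hΨ] at h1
    rw [h1, add_sub_cancel_left, norm_mul, Complex.norm_I, one_mul, sub_zero]
    refine (intervalIntegral.norm_integral_le_of_norm_le_const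
      (C := C * (1 + |b|) ^ 2 * Real.exp (3 * b ^ 2) * (1 + T ^ 2) ^ (-(3 / 8) : ℝ))
      fun s hs => ?_).trans (le_of_eq ?_)
    · have hs' : |s| ≤ |b| := by
        simpa using Set.abs_sub_left_of_mem_uIcc (Set.uIoc_subset_uIcc hs)
      -- By oddness Ψ(-T+is) = -Ψ(T-is), so the difference of Ψ² on the two vertical sides is a
      -- difference across the real axis at the same abscissa, covered by the decay estimate with y
      -- = 0.
      have h2 : Ψ (-T + s * Complex.I) = -Ψ (T + (0 - s : ℝ) * Complex.I) := by
        rw [hΨ, ← sineTransform_neg]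
        congr 1; push_cast; ring
      have h3 := hC s T
      rw [zero_add] at h3
      rw [h2, neg_sq, sq_sub_sq, norm_mul, mul_comm]
      refine (mul_le_mul_of_nonneg_left (norm_add_le _ _) (norm_nonneg _)).trans (h3.trans ?_)
      have h4 : s ^ 2 ≤ b ^ 2 := sq_le_sq.2 hs'
      gcongr
    · rw [sub_zero]; ring
  refine squeeze_zero_norm hb ?_
  have := (tendsto_rpow_neg_atTop_zero 0).const_mul
    (C * (1 + |b|) ^ 2 * Real.exp (3 * b ^ 2) * |b|)
  rwa [mul_zero] at this

/-- For an interval the contour shift of Ψ² holds for the plain symmetric integrals, so the real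
parts of Ψ² cancel in the limit without Gaussian weights; Plancherel evaluates the squared imaginary
parts. -/
lemma tendsto_integral_lineDiff_symm (ha : 0 < a) (y v : ℝ) :
    Tendsto (fun T : ℝ => ∫ t in (-T)..T, lineDiff (truncatedDensity (initialInterval a)) y v t)
      atTop (𝓝 (2 * Real.pi *
        ∫ u, Real.sinh (4 * y * u) * Real.sinh (4 * v * u) * oddDensity a u ^ 2)) := by
  have hh := superexpDecay_truncatedDensity (measurableSet_initialInterval a)
  have him := fun b : ℝ => (superexpDecay_oddDensity a).integral_im_sq (oddDensity_neg a)
    (memLp_two_sinh_mul_oddDensity a b)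
  rw [sineTransform_oddDensity] at him
  set Ψ := sineTransform (truncatedDensity (initialInterval a)) with hΨ
  have hcont : ∀ b : ℝ, Continuous fun t : ℝ => Ψ (t + b * Complex.I) :=
    continuous_sineTransform_line hh
  have hre : Tendsto (fun T : ℝ => (∫ t in (-T)..T, (Ψ (t + (y + v : ℝ) * Complex.I) ^ 2).re) -
      ∫ t in (-T)..T, (Ψ (t + (y - v : ℝ) * Complex.I) ^ 2).re) atTop (𝓝 0) := by
    have h1 := (tendsto_integral_sq_shift ha (y + v)).sub (tendsto_integral_sq_shift ha (y - v))
    have h2 := (Complex.continuous_re.tendsto _).comp h1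
    simp only [sub_self, Complex.zero_re] at h2
    refine h2.congr fun T => ?_
    have e : ∀ b : ℝ, ∫ t in (-T)..T, (Ψ (t + b * Complex.I) ^ 2).re =
        (∫ t in (-T)..T, Ψ (t + b * Complex.I) ^ 2).re := fun b =>
      Complex.reCLM.intervalIntegral_comp_comm (((hcont b).pow 2).intervalIntegrable _ _)
    rw [e, e]
    simp only [Function.comp_apply, Complex.sub_re, ← hΨ]
    ring
  have hI : ∀ b : ℝ, Tendsto (fun T : ℝ => ∫ t in (-T)..T, (Ψ (t + b * Complex.I)).im ^ 2) atTop
      (𝓝 (Real.pi * ∫ u, (Real.sinh (2 * b * u) * oddDensity a u) ^ 2)) := fun b => by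
    rw [← (him b).2]
    exact intervalIntegral_tendsto_integral (him b).1 tendsto_neg_atTop_atBot tendsto_id
  have hlim := hre.add (((hI (y + v)).sub (hI (y - v))).const_mul 2)
  have e2 : 0 + 2 * (Real.pi * (∫ u, (Real.sinh (2 * (y + v) * u) * oddDensity a u) ^ 2) -
      Real.pi * ∫ u, (Real.sinh (2 * (y - v) * u) * oddDensity a u) ^ 2) = 2 * Real.pi *
        ∫ u, Real.sinh (4 * y * u) * Real.sinh (4 * v * u) * oddDensity a u ^ 2 := by
    rw [← mul_sub, zero_add, ← mul_assoc, ← integral_sub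
      (memLp_two_sinh_mul_oddDensity a _).integrable_sq
      (memLp_two_sinh_mul_oddDensity a _).integrable_sq]
    congr 2; ext u
    have h3 := sinh_sq_sub_sinh_sq (2 * (y - v) * u) (2 * (y + v) * u)
    rw [show 2 * (y + v) * u + 2 * (y - v) * u = 4 * y * u by ring,
      show 2 * (y + v) * u - 2 * (y - v) * u = 4 * v * u by ring] at h3
    rw [← h3]; ring
  rw [e2] at hlim
  refine hlim.congr fun T => ?_
  have i1 : ∀ b : ℝ, IntervalIntegrable (fun t : ℝ => (Ψ (t + b * Complex.I) ^ 2).re) volume (-T) T :=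
    fun b => (Complex.continuous_re.comp ((hcont b).pow 2)).intervalIntegrable _ _
  have i2 : ∀ b : ℝ, IntervalIntegrable (fun t : ℝ => (Ψ (t + b * Complex.I)).im ^ 2) volume (-T) T :=
    fun b => ((Complex.continuous_im.comp (hcont b)).pow 2).intervalIntegrable _ _
  rw [← intervalIntegral.integral_sub (i1 _) (i1 _), ← intervalIntegral.integral_sub (i2 _) (i2 _),
    ← intervalIntegral.integral_const_mul, ← intervalIntegral.integral_add ((i1 _).sub (i1 _))
      (((i2 _).sub (i2 _)).const_mul 2)]
  refine intervalIntegral.integral_congr fun t _ => ?_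
  simp only [lineDiff]
  rw [← hΨ, norm_sq_eq_re_sq_add, norm_sq_eq_re_sq_add]
  ring

/-- The window for x is centred at 0 rather than at Re z. Recentering changes the integral over two
end intervals of length |x|, where the integrand tends to 0. -/
lemma tendsto_integral_lineDiff (ha : 0 < a) (y v x : ℝ) :
    Tendsto (fun T : ℝ => ∫ t in (-T - x)..(T - x),
        lineDiff (truncatedDensity (initialInterval a)) y v t)
      atTop (𝓝 (2 * Real.pi *
        ∫ u, Real.sinh (4 * y * u) * Real.sinh (4 * v * u) * oddDensity a u ^ 2)) := by
  have hh := superexpDecay_truncatedDensity (measurableSet_initialInterval a)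
  obtain ⟨C, hC0, hC⟩ := exists_lineDiff_le ha y
  set L := lineDiff (truncatedDensity (initialInterval a)) y v with hL
  have hcont : Continuous L := continuous_lineDiff hh y v
  set M := C * (1 + |v|) ^ 2 * Real.exp (3 * v ^ 2)
  have hM0 : 0 ≤ M := by positivity
  have hbound : ∀ T : ℝ, |x| ≤ T → ∀ s : ℝ, T - |x| ≤ |s| →
      ‖L s‖ ≤ M * (1 + (T - |x|) ^ 2) ^ (-(3 / 8) : ℝ) := fun T hT s hs => by
    refine (hC v s).trans ?_
    gcongr M * ?_
    refine Real.rpow_le_rpow_of_nonpos (by positivity) ?_ (by norm_num)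
    rw [← sq_abs s]
    have : 0 ≤ T - |x| := by linarith
    gcongr
  have hsmall : ∀ᶠ T : ℝ in atTop, ‖(∫ t in (-T - x)..(T - x), L t) - ∫ t in (-T)..T, L t‖ ≤
      2 * (M * |x|) * (1 + (T - |x|) ^ 2) ^ (-(3 / 8) : ℝ) := by
    filter_upwards [eventually_ge_atTop |x|] with T hT
    have e : (∫ t in (-T - x)..(T - x), L t) - ∫ t in (-T)..T, L t =
        (∫ t in (-T - x)..(-T), L t) - ∫ t in (T - x)..T, L t := by
      rw [intervalIntegral.integral_interval_sub_interval_comm] <;>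
        exact hcont.intervalIntegrable _ _
    have hx := abs_le.1 (le_refl |x|)
    have h1 : ‖∫ t in (-T - x)..(-T), L t‖ ≤
        M * (1 + (T - |x|) ^ 2) ^ (-(3 / 8) : ℝ) * |-T - (-T - x)| := by
      refine intervalIntegral.norm_integral_le_of_norm_le_const fun s hs => hbound T hT s ?_
      have h3 : s ≤ -T + |x| := by
        rcases Set.mem_uIoc.1 hs with h | h <;> linarith [h.2, abs_nonneg x]
      exact (by linarith : T - |x| ≤ -s).trans (neg_le_abs s)
    have h2 : ‖∫ t in (T - x)..T, L t‖ ≤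
        M * (1 + (T - |x|) ^ 2) ^ (-(3 / 8) : ℝ) * |T - (T - x)| := by
      refine intervalIntegral.norm_integral_le_of_norm_le_const fun s hs => hbound T hT s ?_
      have h3 : T - |x| ≤ s := by
        rcases Set.mem_uIoc.1 hs with h | h <;> linarith [h.1, abs_nonneg x]
      exact h3.trans (le_abs_self s)
    rw [sub_sub_cancel] at h1 h2
    rw [e]
    refine (norm_sub_le _ _).trans ((add_le_add h1 h2).trans (le_of_eq ?_))
    ring
  have hz : Tendsto (fun T : ℝ => (∫ t in (-T - x)..(T - x), L t) - ∫ t in (-T)..T, L t) atTop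
      (𝓝 0) := by
    refine squeeze_zero_norm' hsmall ?_
    have := (tendsto_rpow_neg_atTop_zero |x|).const_mul (2 * (M * |x|))
    rwa [mul_zero] at this
  have := hz.add (tendsto_integral_lineDiff_symm ha y v)
  rw [zero_add] at this
  refine this.congr fun T => ?_
  rw [← hL, sub_add_cancel]

lemma sinhTransform_eq_of_sineTransform_eq {h k : ℝ → ℝ} (hk : sineTransform h = sineTransform k) :
    sinhTransform h = sinhTransform k := by
  ext y
  have h1 := congrFun hk (2 * Complex.I * y)
  rw [sineTransform_I_mul, sineTransform_I_mul] at h1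
  exact_mod_cast mul_left_cancel₀ Complex.I_ne_zero h1

/-- The iterated Gaussian integral behind the mass-one equation. -/
lemma integral_gaussian_limit (a : EReal) (y : ℝ) :
    Integrable (fun v : ℝ => v * Real.exp (-4 * v ^ 2) *
      ∫ u, Real.sinh (4 * y * u) * Real.sinh (4 * v * u) * oddDensity a u ^ 2) ∧
    ∫ v : ℝ, v * Real.exp (-4 * v ^ 2) *
      ∫ u, Real.sinh (4 * y * u) * Real.sinh (4 * v * u) * oddDensity a u ^ 2 =
      1 / 4 * sinhTransform (oddDensity a) y := by
  have hh := superexpDecay_oddDensity a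
  set g : ℝ → ℝ → ℝ := fun u v => Real.sinh (4 * y * u) * oddDensity a u ^ 2 *
    (v * Real.exp (-4 * v ^ 2) * Real.sinh (2 * (2 * u) * v)) with hg
  have hinner : ∀ u, ∫ v, g u v = 1 / 4 * (Real.sinh (4 * y * u) * oddDensity a u) := fun u => by
    simp only [g]
    rw [integral_const_mul, (gaussian_sinh (2 * u)).2, show (2 * u) ^ 2 / 4 = u ^ 2 by ring]
    nth_rewrite 2 [← oddDensity_eq_sq a u]
    ring
  have hnorm : ∀ u, ∫ v, ‖g u v‖ = ‖1 / 4 * (Real.sinh (4 * y * u) * oddDensity a u)‖ := fun u => by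
    set f : ℝ → ℝ := fun v => v * Real.exp (-4 * v ^ 2) * Real.sinh (2 * (2 * u) * v) with hf
    -- For fixed u the function f has constant sign, so the norm of its integral equals the integral
    -- of its norm; this gives absolute integrability on the product space.
    have hsign : ∫ v, ‖f v‖ = ‖∫ v, f v‖ := by
      have e : ∀ v, f v = Real.exp (-4 * v ^ 2) * (v * Real.sinh (2 * (2 * u) * v)) := fun v => by
        simp only [hf]; ring
      rcases le_total 0 u with hu | hu
      · have h0 : ∀ v, 0 ≤ f v := fun v => by
          rw [e]
          refine mul_nonneg (Real.exp_nonneg _) ?_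
          rcases le_total 0 v with hv | hv
          · exact mul_nonneg hv (Real.sinh_nonneg_iff.2 (by positivity))
          · exact mul_nonneg_of_nonpos_of_nonpos hv (Real.sinh_nonpos_iff.2 (by nlinarith))
        rw [Real.norm_of_nonneg (integral_nonneg h0)]
        simp_rw [fun v => Real.norm_of_nonneg (h0 v)]
      · have h0 : ∀ v, f v ≤ 0 := fun v => by
          rw [e]
          refine mul_nonpos_of_nonneg_of_nonpos (Real.exp_nonneg _) ?_
          rcases le_total 0 v with hv | hv
          · exact mul_nonpos_of_nonneg_of_nonpos hv (Real.sinh_nonpos_iff.2 (by nlinarith))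
          · exact mul_nonpos_of_nonpos_of_nonneg hv (Real.sinh_nonneg_iff.2 (by nlinarith))
        rw [Real.norm_of_nonpos (integral_nonpos h0)]
        simp_rw [fun v => Real.norm_of_nonpos (h0 v)]
        rw [integral_neg]
    rw [← hinner]
    simp only [g]
    rw [integral_const_mul, norm_mul, ← hsign, ← integral_const_mul]
    simp only [norm_mul, hf]
  have hprod : Integrable (Function.uncurry g) (volume.prod volume) := by
    refine (integrable_prod_iff ?_).2 ⟨Eventually.of_forall fun u =>
      (gaussian_sinh (2 * u)).1.const_mul (Real.sinh (4 * y * u) * oddDensity a u ^ 2), ?_⟩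
    · have := measurable_oddDensity a
      apply Measurable.aestronglyMeasurable
      simp only [hg, Function.uncurry_def]
      fun_prop
    · simp only [Function.uncurry_apply_pair, hnorm]
      exact ((hh.integrable_sinh (4 * y)).const_mul (1 / 4)).norm
  have e : ∀ v : ℝ, v * Real.exp (-4 * v ^ 2) *
      ∫ u, Real.sinh (4 * y * u) * Real.sinh (4 * v * u) * oddDensity a u ^ 2 = ∫ u, g u v :=
    fun v => by
      rw [← integral_const_mul]
      congr 1; ext u
      simp only [g]
      rw [show 2 * (2 * u) * v = 4 * v * u by ring]
      ring
  simp_rw [e]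
  refine ⟨hprod.integral_prod_right, ?_⟩
  rw [← integral_integral_swap hprod]
  simp_rw [hinner]
  rw [integral_const_mul, sinhTransform]

/-! ### The converse implication -/

variable {a : EReal}

lemma volume_initialInterval_ne_zero (ha : 0 < a) : volume (initialInterval a) ≠ 0 := by
  obtain ⟨q, hq0, hqa⟩ := EReal.lt_iff_exists_real_btwn.1 ha
  have hq : 0 < q := by exact_mod_cast hq0
  have hsub : Set.Ioo 0 q ⊆ initialInterval a := fun u hu =>
    ⟨hu.1, (EReal.coe_lt_coe_iff.2 hu.2).trans hqa⟩
  have h1 : 0 < volume (Set.Ioo 0 q) := by simp [hq]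
  exact (h1.trans_le (measure_mono hsub)).ne'

lemma sinhTransform_initialInterval_pos (ha : 0 < a) {y : ℝ} (hy : 0 < y) :
    0 < sinhTransform (truncatedDensity (initialInterval a)) y := by
  have hA := measurableSet_initialInterval a
  have hpos := initialInterval_subset a
  have hh := superexpDecay_truncatedDensity hA
  have hne : ∫ u, u * truncatedDensity (initialInterval a) u ≠ 0 := fun h => by
    have h0 : ∀ u, 0 ≤ u * truncatedDensity (initialInterval a) u := fun u => by
      rcases le_or_gt u 0 with hu | hu
      · simp [truncatedDensity_of_nonpos hpos hu]
      · exact mul_nonneg hu.le (truncatedDensity_nonneg hpos u)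
    refine volume_initialInterval_ne_zero ha (measure_eq_zero_iff_ae_notMem.2 ?_)
    filter_upwards [(integral_eq_zero_iff_of_nonneg h0 hh.integrable_mul).1 h] with u hu huA
    have hu0 : 0 < u := huA.1
    rw [truncatedDensity, Set.indicator_of_mem huA] at hu
    have h3 : u * (2 / √Real.pi * (Real.exp (-u ^ 2) / u)) ≠ 0 := by positivity
    exact h3 hu
  have hge : 0 ≤ ∫ u, u * truncatedDensity (initialInterval a) u := integral_nonneg fun u => by
    rcases le_or_gt u 0 with hu | hu
    · simp [truncatedDensity_of_nonpos hpos hu]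
    · exact mul_nonneg hu.le (truncatedDensity_nonneg hpos u)
  have h4 : 0 < ∫ u, u * truncatedDensity (initialInterval a) u := lt_of_le_of_ne hge hne.symm
  exact lt_of_lt_of_le (by positivity) (le_sinhTransform_truncatedDensity hA hpos hy)

lemma mul_sinhTransform_initialInterval_pos (ha : 0 < a) {y : ℝ} (hy : y ≠ 0) :
    0 < y * sinhTransform (truncatedDensity (initialInterval a)) y := by
  rcases lt_or_gt_of_ne hy with h | h
  · have h1 := sinhTransform_initialInterval_pos ha (neg_pos.2 h)
    rw [sinhTransform_neg] at h1
    nlinarith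
  · exact mul_pos h (sinhTransform_initialInterval_pos ha h)

lemma massOneEquation_initialInterval (ha : 0 < a) :
    MassOneEquation (translationKernel (sineTransform (truncatedDensity (initialInterval a)))) := by
  intro z hz
  set h := truncatedDensity (initialInterval a)
  set y := z.im with hy
  have hΦ : sinhTransform h y ≠ 0 := fun h0 => by
    have := mul_sinhTransform_initialInterval_pos ha hz
    rw [h0, mul_zero] at this
    exact lt_irrefl _ this
  set c : ℝ → ℝ := fun v => 2 * v * Real.exp (-4 * v ^ 2) / sinhTransform h y
  set l : ℝ → ℝ := fun v => 2 * Real.pi *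
    ∫ u, Real.sinh (4 * y * u) * Real.sinh (4 * v * u) * oddDensity a u ^ 2
  obtain ⟨i1, e1⟩ := integral_gaussian_limit a y
  have e2 : ∀ v, c v * l v = 4 * Real.pi / sinhTransform h y * (v * Real.exp (-4 * v ^ 2) *
      ∫ u, Real.sinh (4 * y * u) * Real.sinh (4 * v * u) * oddDensity a u ^ 2) := fun v => by
    simp only [c, l]; ring
  refine ⟨?_, fun v => ((c v * l v : ℝ) : ℂ), fun v => ?_, ?_, ?_⟩
  · rw [onePoint_sineTransform, Complex.ofReal_ne_zero]
    have := Real.exp_ne_zero (-4 * z.im ^ 2)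
    positivity
  · have h1 : ∀ T : ℝ, ∫ x in (-T)..T, berezin (translationKernel (sineTransform h)) z ⟨x, v⟩ =
        ((c v * ∫ t in (-T - z.re)..(T - z.re), lineDiff h y v t : ℝ) : ℂ) := fun T => by
      rw [← intervalIntegral.integral_comp_sub_right (fun t => lineDiff h y v t),
        ← intervalIntegral.integral_const_mul, ← intervalIntegral.integral_ofReal]
      exact intervalIntegral.integral_congr fun x _ => berezin_sineTransform h hz _
    simp_rw [h1]
    exact (Complex.continuous_ofReal.tendsto _).comp
      ((tendsto_integral_lineDiff ha y v z.re).const_mul (c v))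
  · simp_rw [e2]
    exact (i1.const_mul _).ofReal
  · rw [integral_complex_ofReal]
    simp_rw [e2]
    rw [integral_const_mul, e1, sinhTransform_eq_of_sineTransform_eq (sineTransform_oddDensity a)]
    have := Real.pi_ne_zero
    rw [← Complex.ofReal_inv, ← Complex.ofReal_mul, ← Complex.ofReal_one]
    congr 1
    change Real.pi⁻¹ * (4 * Real.pi / sinhTransform h y * (1 / 4 * sinhTransform h y)) = 1
    field_simp

/-- In polar coordinates the area factor r cancels the singularity 1/r. -/
lemma integrable_indicator_ball_inv_norm (z : ℂ) :
    Integrable fun w : ℂ => (Metric.ball z 1).indicator (fun w => ‖z - w‖⁻¹) w := by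
  have h1 : IntegrableOn (fun w : ℂ => ‖w‖⁻¹) (Metric.ball 0 1) := by
    rw [integrableOn_fun_norm_addHaar (volume : Measure ℂ) (f := fun r => r⁻¹)]
    have h2 : IntegrableOn (fun _ : ℝ => (1 : ℝ)) (Set.Ioo 0 1) := by simp
    refine h2.congr_fun (fun r hr => ?_) measurableSet_Ioo
    have : r ≠ 0 := hr.1.ne'
    simp [this]
  have h3 := ((integrable_indicator_iff measurableSet_ball).2 h1).comp_sub_left z
  refine h3.congr (Eventually.of_forall fun w => ?_)
  simp only [Set.indicator, mem_ball_iff_norm, sub_zero, norm_sub_rev w z]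

lemma integrable_gaussian_mul_rpow (x : ℝ) :
    Integrable fun w : ℂ => Real.exp (-(1 / 2) * w.im ^ 2) *
      (1 + (w.re - x) ^ 2) ^ (-(7 / 4 : ℝ) / 2) := by
  have i1 : Integrable fun t : ℝ => (1 + t ^ 2) ^ (-(7 / 4 : ℝ) / 2) := by
    simpa using integrable_rpow_neg_one_add_norm_sq (E := ℝ) (μ := volume) (r := 7 / 4) (by norm_num)
  have i2 : Integrable fun v : ℝ => Real.exp (-(1 / 2) * v ^ 2) :=
    integrable_exp_neg_mul_sq (by norm_num)
  have h1 := (i1.comp_sub_right x).mul_prod i2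
  rw [← Measure.volume_eq_prod] at h1
  have h2 := (Complex.volume_preserving_equiv_real_prod.integrable_comp_emb
    (MeasurableEquiv.measurableEmbedding _)).2 h1
  refine h2.congr (Eventually.of_forall fun w => ?_)
  simp only [Function.comp_apply, Complex.measurableEquivRealProd_apply]
  ring

lemma abs_mul_sq_mul_exp_le (v : ℝ) : |v| * (1 + |v|) ^ 2 * Real.exp (-v ^ 2) ≤
    Real.exp (9 / 2) * Real.exp (-(1 / 2) * v ^ 2) := by
  have h1 : 1 + |v| ≤ Real.exp |v| := by linarith [Real.add_one_le_exp |v|]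
  have h2 : |v| ≤ Real.exp |v| := by linarith
  calc |v| * (1 + |v|) ^ 2 * Real.exp (-v ^ 2)
      ≤ Real.exp |v| * Real.exp |v| ^ 2 * Real.exp (-v ^ 2) := by gcongr
    _ = Real.exp (3 * |v| - v ^ 2) := by
      rw [← Real.exp_nat_mul, ← Real.exp_add, ← Real.exp_add]
      congr 1; push_cast; ring
    _ ≤ Real.exp (9 / 2 + -(1 / 2) * v ^ 2) := by
      refine Real.exp_le_exp.2 ?_
      rw [← sq_abs v]
      nlinarith [sq_nonneg (|v| - 3)]
    _ = _ := Real.exp_add _ _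

/-- Near w = z the Berezin kernel is bounded and 1/|z-w| is locally integrable. Away from z the
decay (1+t²)^{-3/8} of the kernel, t = Re w - Re z, combines with (1+t²)^{-1/2} to give
(1+t²)^{-7/8}, which is integrable in t, while v e^{-4v²} controls the growth in v. -/
lemma integrable_berezin_div (ha : 0 < a) {z : ℂ} (hz : z.im ≠ 0) :
    Integrable fun w : ℂ => berezin
      (translationKernel (sineTransform (truncatedDensity (initialInterval a)))) z w / (z - w) := by
  have hh := superexpDecay_truncatedDensity (measurableSet_initialInterval a)
  obtain ⟨C, hC0, hC⟩ := exists_lineDiff_le ha z.im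
  set h := truncatedDensity (initialInterval a)
  simp_rw [berezin_sineTransform h hz]
  set Φ := sinhTransform h z.im
  set M := 2 / |Φ| * C * Real.exp (9 / 2)
  have hM0 : 0 ≤ M := by positivity
  have hdom := ((integrable_indicator_ball_inv_norm z).const_mul M).add
    ((integrable_gaussian_mul_rpow z.re).const_mul (M * 2))
  refine hdom.mono' ?_ (Eventually.of_forall fun w => ?_)
  · have hm : Measurable fun w : ℂ => lineDiff h z.im w.im (w.re - z.re) := by
      have hc := hh.differentiable_sineTransform.continuous
      apply Continuous.measurable
      unfold lineDiff
      fun_prop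
    apply Measurable.aestronglyMeasurable
    fun_prop
  · have hb : ‖((2 * w.im * Real.exp (-4 * w.im ^ 2) / Φ *
        lineDiff h z.im w.im (w.re - z.re) : ℝ) : ℂ)‖ ≤
        M * (Real.exp (-(1 / 2) * w.im ^ 2) * (1 + (w.re - z.re) ^ 2) ^ (-(3 / 8) : ℝ)) := by
      rw [Complex.norm_real, Real.norm_eq_abs, abs_mul, abs_div, abs_mul, abs_mul, abs_two,
        Real.abs_exp]
      have h4 : Real.exp (-4 * w.im ^ 2) * Real.exp (3 * w.im ^ 2) = Real.exp (-w.im ^ 2) := by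
        rw [← Real.exp_add]; ring_nf
      calc _ ≤ 2 * |w.im| * Real.exp (-4 * w.im ^ 2) / |Φ| * (C * (1 + |w.im|) ^ 2 *
            Real.exp (3 * w.im ^ 2) * (1 + (w.re - z.re) ^ 2) ^ (-(3 / 8) : ℝ)) := by
            gcongr; exact hC _ _
        _ = 2 / |Φ| * C * (|w.im| * (1 + |w.im|) ^ 2 * Real.exp (-w.im ^ 2)) *
            (1 + (w.re - z.re) ^ 2) ^ (-(3 / 8) : ℝ) := by rw [← h4]; ring
        _ ≤ 2 / |Φ| * C * (Real.exp (9 / 2) * Real.exp (-(1 / 2) * w.im ^ 2)) *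
            (1 + (w.re - z.re) ^ 2) ^ (-(3 / 8) : ℝ) := by
            gcongr 2 / |Φ| * C * ?_ * _; exact abs_mul_sq_mul_exp_le _
        _ = _ := by simp only [M]; ring
    rw [norm_div, div_eq_mul_inv]
    have hone : Real.exp (-(1 / 2) * w.im ^ 2) * (1 + (w.re - z.re) ^ 2) ^ (-(3 / 8) : ℝ) ≤ 1 := by
      refine mul_le_one₀ (Real.exp_le_one_iff.2 (by nlinarith [sq_nonneg w.im])) (by positivity) ?_
      exact Real.rpow_le_one_of_one_le_of_nonpos (by nlinarith [sq_nonneg (w.re - z.re)])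
        (by norm_num)
    simp only [Pi.add_apply]
    by_cases hw : w ∈ Metric.ball z 1
    · rw [Set.indicator_of_mem hw]
      refine le_add_of_le_of_nonneg ?_ (by positivity)
      gcongr
      exact hb.trans (mul_le_of_le_one_right hM0 hone)
    · rw [Set.indicator_of_notMem hw, mul_zero, zero_add]
      have h1 : 1 ≤ ‖z - w‖ := by
        rw [mem_ball_iff_norm, norm_sub_rev] at hw
        exact not_lt.1 hw
      have h2 : |w.re - z.re| ≤ ‖z - w‖ := by
        rw [norm_sub_rev, ← Complex.sub_re]; exact Complex.abs_re_le_norm _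
      have h3 : (1 + (w.re - z.re) ^ 2) ^ (1 / 2 : ℝ) ≤ 2 * ‖z - w‖ := by
        rw [← Real.sqrt_eq_rpow]
        refine Real.sqrt_le_iff.2 ⟨by positivity, ?_⟩
        rw [← sq_abs (w.re - z.re)]
        have := mul_le_mul h2 h2 (abs_nonneg _) (norm_nonneg _)
        nlinarith
      have h4 : ‖z - w‖⁻¹ ≤ 2 * (1 + (w.re - z.re) ^ 2) ^ (-(1 / 2) : ℝ) := by
        rw [Real.rpow_neg (by positivity), ← div_eq_mul_inv, inv_eq_one_div,
          div_le_div_iff₀ (by positivity) (by positivity)]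
        linarith
      have h5 : (1 + (w.re - z.re) ^ 2) ^ (-(7 / 4 : ℝ) / 2) =
          (1 + (w.re - z.re) ^ 2) ^ (-(3 / 8) : ℝ) * (1 + (w.re - z.re) ^ 2) ^ (-(1 / 2) : ℝ) := by
        rw [← Real.rpow_add (by positivity)]; norm_num
      rw [h5]
      calc _ ≤ M * (Real.exp (-(1 / 2) * w.im ^ 2) * (1 + (w.re - z.re) ^ 2) ^ (-(3 / 8) : ℝ)) *
            (2 * (1 + (w.re - z.re) ^ 2) ^ (-(1 / 2) : ℝ)) := by gcongr
        _ = _ := by ring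

lemma gapTransform_initialInterval (a : EReal) (y : ℝ) : gapTransform (initialInterval a) y = 0 := by
  refine integral_eq_zero_of_ae (Eventually.of_forall fun u => ?_)
  by_cases hu : u ∈ initialInterval a
  · have h1 : Set.Ioc 0 u ∩ (initialInterval a)ᶜ = ∅ := by
      refine Set.eq_empty_of_forall_notMem fun u' hu' => hu'.2 ⟨hu'.1.1, ?_⟩
      exact (EReal.coe_le_coe_iff.2 hu'.1.2).trans_lt hu.2
    simp [coshGap, h1]
  · simp [truncatedDensity, hu]

lemma wardEquation_initialInterval (ha : 0 < a) :
    WardEquation (translationKernel (sineTransform (truncatedDensity (initialInterval a)))) :=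
  wardEquation_of_gapTransform_eq_zero (measurableSet_initialInterval a) (initialInterval_subset a)
    (fun _ hy => mul_sinhTransform_initialInterval_pos ha hy) (fun _ hz => integrable_berezin_div ha hz)
    (gapTransform_initialInterval a)

lemma translationKernel_initialInterval (ha : 0 < a) (z w : ℂ) :
    translationKernel (sineTransform (truncatedDensity (initialInterval a))) z w =
      1 / (√Real.pi : ℂ) * Complex.exp (z ^ 2 + w ^ 2) *
        ∫ u in {u : ℝ | -a < (u : EReal) ∧ (u : EReal) < a},
          Complex.exp (-(u : ℂ) ^ 2) * Complex.sin (2 * u * (z - w)) / u := by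
  rw [translationKernel, sineTransform_initialInterval ha]
  ring

end

end PlanarSymplectic

theorem mainTheorem5 (κ : ℂ → ℂ → ℂ) :
    (PlanarSymplectic.IsTranslationInvariantPreKernel κ ∧
      PlanarSymplectic.MassOneEquation κ ∧ PlanarSymplectic.WardEquation κ) ↔
    ∃ a : EReal, 0 < a ∧ ∀ z w : ℂ,
      κ z w = 1 / (Real.sqrt Real.pi : ℂ) * Complex.exp (z ^ 2 + w ^ 2) *
        ∫ u in {u : ℝ | -a < (u : EReal) ∧ (u : EReal) < a},
          Complex.exp (-(u : ℂ) ^ 2) * Complex.sin (2 * u * (z - w)) / u := by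
  constructor
  · rintro ⟨hκ, hm, hw⟩
    obtain ⟨a, ha, rfl⟩ := PlanarSymplectic.exists_interval_of_massOne_of_ward hκ hm hw
    exact ⟨a, ha, PlanarSymplectic.translationKernel_initialInterval ha⟩
  · rintro ⟨a, ha, hκ⟩
    have h : κ = PlanarSymplectic.translationKernel (PlanarSymplectic.sineTransform
        (PlanarSymplectic.truncatedDensity (PlanarSymplectic.initialInterval a))) := by
      ext z w
      rw [hκ, PlanarSymplectic.translationKernel_initialInterval ha]
    rw [h]
    exact ⟨PlanarSymplectic.isTranslationInvariantPreKernel_initialInterval a,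
      PlanarSymplectic.massOneEquation_initialInterval ha,
      PlanarSymplectic.wardEquation_initialInterval ha⟩
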